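/- **Fractured domain.** Let $\Omega\subset\mathbb R^n$ be the union of finitely many pairwise disjoint bounded pieces $\Omega_{d,i}$ ($0\le d\le n$, $1\le i\le n_d$), where each $\Omega_{d,i}$ is an embedded smooth $d$-dimensional manifold which is smooth up to its boundary $\partial\Omega_{d,i}=\overline{\Omega_{d,i}}\setminus\Omega_{d,i}$ in the following sense: $\overline{\Omega_{d,i}}$ is contained in a smooth embedded $d$-dimensional manifold without boundary; $\partial\Omega_{d,i}\subset\bigcup_{l<d}\bigcup_j\Omega_{l,j}$; and at each point of $\partial\Omega_{d,i}\cap\Omega_{d-1,j}$ there are smooth coordinates of $\mathbb R^n$ in which $\Omega_{d,i}$ is a $d$-dimensional open half space with boundary plane $\Omega_{d-1,j}$. Each piece is contained either in $\partial\Omega$ or in the interior of $\Omega$. The *components* are the pieces in the interior of $\Omega$; their collection is denoted by $\mathcal O$, and all functions and vector fields below are families indexed by the components (the pieces in $\partial\Omega$ carry no unknowns). Components carry the $d$-dimensional and their boundaries the $(d-1)$-dimensional surface measure, $\nu_{d,i}$ is the exterior unit normal to $\partial\Omega_{d,i}$ tangential to $\Omega_{d,i}$, and $\partial\mathcal O_I=\bigsqcup_{d,i}(\partial\Omega_{d,i}\setminus\partial\Omega)$,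 $\partial\mathcal O_B=\bigsqcup_{d,i}(\partial\Omega_{d,i}\cap\partial\Omega)$, over the components. The products $(\cdot,\cdot)_{\mathcal O}$, $(\cdot,\cdot)_{\partial\mathcal O_I}$, $(\cdot,\cdot)_{\partial\mathcal O_B}$ are the sums of the $L^2$ products over components, respectively over their boundaries. **Operators.** Let $\beta$ be a smooth tangential vector field on $\mathcal O$ (each $\beta_{d,i}$ is tangential to $\Omega_{d,i}$ and smooth up to its boundary) and let $\alpha\in L^\infty(\mathcal O)$. Let $V_\beta$ be the space of $v\in L^2(\mathcal O)$ such that on each component the weak derivative $\beta\cdot\nabla v$ is in $L^2$ and $v$ has a trace on $\partial\Omega_{d,i}$ that is square integrable with weight $|\nu\cdot\beta|$; here the trace, also written $v_{d,i}$ and determined where $\nu\cdot\beta\ne0$, is the function for which $\nu\cdot\beta\,v$ is the normal trace of $\beta v$: $$\int_{\Omega_{d,i}}(\beta\cdot\nabla v)\,\varphi+\int_{\Omega_{d,i}}v\,\nabla_d\cdot(\varphi\beta)=\int_{\partial\Omega_{d,i}}\nu\cdot\beta\,v\,\varphi\qquad\forall\varphi\in C_c^\infty(\mathbb R^n).$$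 For $v\in V_\beta$ let $[v]_{d,i}=v_{d,i}-v_{d-1,j}$ on $\partial\Omega_{d,i}\cap\Omega_{d-1,j}$ (for components $\Omega_{d,i},\Omega_{d-1,j}$), and at points of $\Omega_{d,j}$ let $$(D_\beta v)_d=\beta_d\cdot\nabla_dv_d-\sum_i\nu_{d+1,i}\cdot\beta_{d+1,i}\,[v]_{d+1,i},\qquad(\operatorname{Div}\beta)_d=\nabla_d\cdot\beta_d-\sum_i\nu_{d+1,i}\cdot\beta_{d+1,i},$$ where the sums run over the $(d+1)$-dimensional components having the point on their boundary. With $\gamma=\alpha+\operatorname{Div}\beta$ and $|t|_-=|\min(t,0)|$ put $$a(v,w)=(D_\beta v,w)_{\mathcal O}+(\gamma v,w)_{\mathcal O}+(|\nu\cdot\beta|_-[v],[w])_{\partial\mathcal O_I}+(|\nu\cdot\beta|_-v,w)_{\partial\mathcal O_B}.$$ **Lemma (Coercivity).** Let $c_0>0$. There is a constant $C>0$, depending only on $c_0$, such that for every fractured domain, $\beta$ and $\alpha$ as above with $$c_0\le2\alpha+\operatorname{Div}\beta\quad\text{almost everywhere on }\mathcal O$$ one has, for all $v\in V_\beta$,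 $$\|v\|_{\mathcal O}^2+\big\||\nu\cdot\beta|_-^{1/2}[v]\big\|_{\partial\mathcal O_I}^2+\big\||\nu\cdot\beta|_-^{1/2}v\big\|_{\partial\mathcal O_B}^2\le C\,a(v,v).$$ -/

import Mathlib

open MeasureTheory Set
open scoped ContDiff

noncomputable section

namespace Fractured

/-- Euclidean `n`-space. -/
abbrev E (n : ℕ) : Type := EuclideanSpace ℝ (Fin n)

/-- A local `C^∞` diffeomorphism of `ℝⁿ` (between open sets). -/
def IsSmoothChart {n : ℕ} (Φ : OpenPartialHomeomorph (E n) (E n)) : Prop :=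
  ContDiffOn ℝ ∞ Φ Φ.source ∧ ContDiffOn ℝ ∞ Φ.symm Φ.target

/-- `M` is an embedded `C^∞` submanifold of `ℝⁿ` of dimension `d` without boundary: around each of
its points there are smooth coordinates of `ℝⁿ` in which `M` is the coordinate plane on which all
but the first `d` coordinates vanish. -/
def IsSmoothSubmanifold {n : ℕ} (d : ℕ) (M : Set (E n)) : Prop :=
  ∀ x ∈ M, ∃ Φ : OpenPartialHomeomorph (E n) (E n), IsSmoothChart Φ ∧ x ∈ Φ.source ∧
    ∀ y ∈ Φ.source, (y ∈ M ↔ ∀ k : Fin n, d ≤ (k : ℕ) → Φ y k = 0)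

/-- The boundary `∂S` of a (relatively open) piece `S` of a submanifold: its closure minus itself. -/
def bdry {n : ℕ} (S : Set (E n)) : Set (E n) := closure S \ S

/-- A fractured (composite) domain in `ℝⁿ`: the set `Ω = ⋃ i, S i` is partitioned into finitely many
bounded smooth pieces `S i` of dimension `dim i ∈ {0, …, n}`. The pieces that lie on the boundary
of `Ω` are listed too; they only serve to describe the geometry of `∂Ω`. -/
structure FracturedDomain (n : ℕ) where
  /-- number of pieces -/
  N : ℕ
  /-- dimension of the pieces -/
  dim : Fin N → ℕ
  /-- the pieces -/
  S : Fin N → Set (E n)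
  dim_le : ∀ i, dim i ≤ n
  bounded : ∀ i, Bornology.IsBounded (S i)
  disjoint : ∀ i j, i ≠ j → Disjoint (S i) (S j)
  /-- each piece is a smooth manifold ... -/
  smooth : ∀ i, IsSmoothSubmanifold (dim i) (S i)
  /-- ... which is smooth up to its boundary: its closure is contained in a slightly larger
  submanifold of the same dimension ... -/
  smooth_closure : ∀ i, ∃ M, IsSmoothSubmanifold (dim i) M ∧ closure (S i) ⊆ M
  /-- ... and at each point of a piece `S j` of one dimension less on its boundary, it is in
  suitable smooth coordinates a half space with the boundary `S j`. -/
  half_space : ∀ i j, dim j + 1 = dim i → ∀ x ∈ S j ∩ closure (S i),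
    ∃ Φ : OpenPartialHomeomorph (E n) (E n), IsSmoothChart Φ ∧ x ∈ Φ.source ∧ ∀ y ∈ Φ.source,
      (y ∈ S i ↔ (∀ k : Fin n, dim i ≤ (k : ℕ) → Φ y k = 0) ∧
        ∀ k : Fin n, (k : ℕ) + 1 = dim i → 0 < Φ y k) ∧
      (y ∈ S j ↔ ∀ k : Fin n, dim j ≤ (k : ℕ) → Φ y k = 0)
  /-- the boundary of each piece is contained in the union of the pieces of lower dimension -/
  bdry_subset : ∀ i, bdry (S i) ⊆ ⋃ j ∈ {j | dim j < dim i}, S j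
  /-- `∂Ω` is a union of pieces -/
  frontier_or_interior : ∀ i, S i ⊆ frontier (⋃ j, S j) ∨ S i ⊆ interior (⋃ j, S j)

/-- The (smallest linear space containing the) tangent directions to `S` at `x`. For a submanifold
this is the tangent space, also at smooth boundary points. -/
def tangentSpace {n : ℕ} (S : Set (E n)) (x : E n) : Submodule ℝ (E n) :=
  Submodule.span ℝ (tangentConeAt ℝ S x)

/-- `ν` is the unit exterior normal to `S` at its boundary point `x`: it is a unit vector, tangential
to `S`, orthogonal to `∂S`, and points out of `S`. -/
def IsExteriorNormal {n : ℕ} (S : Set (E n)) (x ν : E n) : Prop :=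
  ‖ν‖ = 1 ∧ ν ∈ tangentSpace S x ∧ ν ∈ (tangentSpace (bdry S) x)ᗮ ∧ ν ∉ posTangentConeAt S x

/-- The unit exterior normal field `ν` on `∂S`. -/
def normal {n : ℕ} (S : Set (E n)) (x : E n) : E n :=
  Classical.epsilon (IsExteriorNormal S x)

/-- The surface divergence `∇_S · b` at `x`: the trace of the tangential part `P (Db)` of the
derivative of `b`, with `P` the orthogonal projection onto the tangent space of `S`. -/
def surfDiv {n : ℕ} (S : Set (E n)) (b : E n → E n) (x : E n) : ℝ :=
  LinearMap.trace ℝ (E n) ((tangentSpace S x).starProjection ∘L fderiv ℝ b x : E n →L[ℝ] E n)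

/-- The size `|t|_- = |min(t, 0)|` of the negative part. -/
def absNeg (t : ℝ) : ℝ := |min t 0|

/-- `g` is the weak derivative `b · ∇_S v` on the `d`-dimensional manifold `S`:
`∫_S g φ = - ∫_S v ∇_S · (φ b)` for all smooth `φ` supported away from `∂S`. -/
def HasWeakDeriv {n : ℕ} (d : ℕ) (S : Set (E n)) (b : E n → E n) (v g : E n → ℝ) : Prop :=
  ∀ φ : E n → ℝ, ContDiff ℝ ∞ φ → HasCompactSupport φ → Disjoint (tsupport φ) (bdry S) →
    ∫ x in S, g x * φ x ∂μHE[d] = - ∫ x in S, v x * surfDiv S (fun y => φ y • b y) x ∂μHE[d]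

/-- `τ` is the trace on `∂S` of a function `v` with weak derivative `g = b · ∇_S v` on `S`, in the
sense that `(ν · b) τ` is the normal trace of the field `v b`: for all smooth `φ`,
`∫_S g φ + ∫_S v ∇_S · (φ b) = ∫_{∂S} (ν · b) τ φ`.
It is determined where `ν · b ≠ 0`, and it is the restriction of `v` to `∂S` for smooth `v`. -/
def HasTrace {n : ℕ} (d : ℕ) (S : Set (E n)) (b : E n → E n) (v g τ : E n → ℝ) : Prop :=
  ∀ φ : E n → ℝ, ContDiff ℝ ∞ φ → HasCompactSupport φ →
    ∫ x in S, g x * φ x ∂μHE[d] + ∫ x in S, v x * surfDiv S (fun y => φ y • b y) x ∂μHE[d] =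
      ∫ x in bdry S, inner ℝ (normal S x) (b x) * τ x * φ x ∂μHE[d - 1]

namespace FracturedDomain

variable {n : ℕ} (D : FracturedDomain n)

/-- The set `Ω`. -/
def Ω : Set (E n) := ⋃ i, D.S i

open Classical in
/-- The components of `𝒪`: the pieces in the interior of `Ω`. They carry the unknowns. -/
def comps : Finset (Fin D.N) := Finset.univ.filter fun i => D.S i ⊆ interior D.Ω

/-- A (scalar) function on `𝒪`, or on `∂𝒪`: one function for each component. -/
abbrev Fun : Type := Fin D.N → E n → ℝ

/-- The natural measure on a component. -/
def vol (i : Fin D.N) : Measure (E n) := μHE[D.dim i].restrict (D.S i)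

/-- The natural measure on the boundary of a component. -/
def bvol (i : Fin D.N) : Measure (E n) := μHE[D.dim i - 1].restrict (bdry (D.S i))

/-- `(v, w)_𝒪` -/
def ip (v w : D.Fun) : ℝ := ∑ i ∈ D.comps, ∫ x, v i x * w i x ∂D.vol i

/-- `(v, w)` on the interior boundary `∂𝒪_I = ⊔ i, ∂(S i) \ ∂Ω` -/
def ipI (v w : D.Fun) : ℝ :=
  ∑ i ∈ D.comps, ∫ x in (frontier D.Ω)ᶜ, v i x * w i x ∂D.bvol i

/-- `(v, w)` on the outer boundary `∂𝒪_B = ⊔ i, ∂(S i) ∩ ∂Ω` -/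
def ipB (v w : D.Fun) : ℝ :=
  ∑ i ∈ D.comps, ∫ x in frontier D.Ω, v i x * w i x ∂D.bvol i

/-- A smooth tangential vector field on `𝒪`. (A field that is smooth up to the boundary of a
component is extended to a smooth field on `ℝⁿ`; only its values on the closure of the component
matter.) -/
def IsSmoothTangential (β : Fin D.N → E n → E n) : Prop :=
  ∀ i ∈ D.comps, ContDiff ℝ ∞ (β i) ∧ ∀ x ∈ D.S i, β i x ∈ tangentSpace (D.S i) x

/-- A function in `L^∞(𝒪)`. -/
def IsBounded (α : D.Fun) : Prop := ∀ i ∈ D.comps, MemLp (α i) ⊤ (D.vol i)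

variable (β : Fin D.N → E n → E n)

/-- `ν · β` on `∂𝒪`. -/
def nuBeta : D.Fun := fun i x => inner ℝ (normal (D.S i) x) (β i x)

/-- The derivative `β · ∇ v` on the components. -/
def betaGrad (v : D.Fun) : D.Fun := fun i => Classical.epsilon fun g =>
  MemLp g 2 (D.vol i) ∧ HasWeakDeriv (D.dim i) (D.S i) (β i) (v i) g

/-- `τ` is a trace of `v` on the boundary of the component `i`, with `|ν · β|^{1/2} τ` in `L²`. -/
def IsTrace (v : D.Fun) (i : Fin D.N) (τ : E n → ℝ) : Prop :=
  MemLp (fun x => √|D.nuBeta β i x| * τ x) 2 (D.bvol i) ∧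
    HasTrace (D.dim i) (D.S i) (β i) (v i) (D.betaGrad β v i) τ

/-- The trace of `v` on `∂𝒪`. -/
def trace (v : D.Fun) : D.Fun := fun i => Classical.epsilon (D.IsTrace β v i)

/-- The space `V_β` of functions `v ∈ L²(𝒪)` with `β · ∇ v ∈ L²(𝒪)`, and with a trace on `∂𝒪` that
is square integrable with the weight `|ν · β|`. -/
def V : Set D.Fun := {v | ∀ i ∈ D.comps, MemLp (v i) 2 (D.vol i) ∧
  (∃ g, MemLp g 2 (D.vol i) ∧ HasWeakDeriv (D.dim i) (D.S i) (β i) (v i) g) ∧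
  ∃ τ, D.IsTrace β v i τ}

open Classical in
/-- The jump operator `⟦f⟧`, which sums, at a point of a component, the contributions of the
components of one dimension more that have it on their boundary. -/
def sumJump (f : D.Fun) : D.Fun := fun j x =>
  ∑ i ∈ D.comps with D.dim i = D.dim j + 1 ∧ x ∈ bdry (D.S i), f i x

open Classical in
/-- The jump `[v]` on `∂𝒪_I`: the trace of `v` from the component minus the value of `v` on the
component of one dimension less. -/
def jump (v : D.Fun) : D.Fun := fun i x =>
  D.trace β v i x - ∑ j ∈ D.comps with D.dim j + 1 = D.dim i ∧ x ∈ D.S j, v j x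

/-- The directional derivative `D_β v = β · ∇ v - ⟦ν · β [v]⟧`. -/
def dirDeriv (v : D.Fun) : D.Fun := fun j x =>
  D.betaGrad β v j x - D.sumJump (fun i y => D.nuBeta β i y * D.jump β v i y) j x

/-- The divergence `Div β = ∇ · β - ⟦ν · β⟧`. -/
def Div : D.Fun := fun j x => surfDiv (D.S j) (β j) x - D.sumJump (D.nuBeta β) j x

/-- The inflow weight `|ν · β|_-`. -/
def inflow : D.Fun := fun i x => absNeg (D.nuBeta β i x)

/-- The form `a(v, w) = (D_β v, w)_𝒪 + (γ v, w)_𝒪 + (|ν · β|_- [v], [w])_{∂𝒪_I}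
+ (|ν · β|_- v, w)_{∂𝒪_B}` with `γ = α + Div β`. -/
def a (α v w : D.Fun) : ℝ :=
  D.ip (D.dirDeriv β v) w + D.ip (fun i x => (α i x + D.Div β i x) * v i x) w
    + D.ipI (fun i x => D.inflow β i x * D.jump β v i x) (D.jump β w)
    + D.ipB (fun i x => D.inflow β i x * D.trace β v i x) (D.trace β w)

/-- `‖v‖²_𝒪` -/
def normSq (v : D.Fun) : ℝ := D.ip v v

/-- `‖w‖²_{|ν · β|, ∂𝒪_I} = ‖(|ν · β|_-)^{1/2} w‖²_{∂𝒪_I}` -/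
def normSqI (w : D.Fun) : ℝ :=
  D.ipI (fun i x => √(D.inflow β i x) * w i x) (fun i x => √(D.inflow β i x) * w i x)

/-- `‖w‖²_{|ν · β|, ∂𝒪_B} = ‖(|ν · β|_-)^{1/2} w‖²_{∂𝒪_B}` -/
def normSqB (w : D.Fun) : ℝ :=
  D.ipB (fun i x => √(D.inflow β i x) * w i x) (fun i x => √(D.inflow β i x) * w i x)

end FracturedDomain

end Fractured

end

/-! For smooth `v` the estimate is an algebraic identity. On a component, the divergence theorem
gives the energy identity: the integral of `2 v (β · ∇v) + v² ∇ · β` equals the boundary integral of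
`(ν · β) τ²`, with `τ` the trace of `v`. On an interface with a component carrying the value `u`,
the jump is `[v] = τ - u`, so `2 [v] u = τ² - [v]² - u²`. Insert both in `2 a(v, v)`. The terms `(ν
· β) τ²` on the interior boundary cancel against those of the energy identity, and the terms `(ν ·
β) u²` cancel against the jump part of one copy of `Div β`. What is left is `(2 α + Div β) v²` on
the components, and the weight `ν · β + 2 |ν · β|_- = |ν · β|` times `[v]²` on the interior and
times `τ²` on the outer boundary (`two_mul_a`). All three are bounded below by the terms of the norm
(`coercivity`).

The real work is the energy identity for `v` in `V_β`, where the trace is given only weakly, by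
testing against smooth functions. It follows from renormalization: for bounded `q` of class `C¹`
with bounded derivative, `q ∘ v` satisfies the balance law with derivative `q'(v) (β · ∇v)` and
trace `q(τ)`. The choice `q(t) = t² / (1 + δ t²)` and the limit `δ → 0` give `energy_identity`.

Renormalization is proved in the half space (`flat_renormalization`). Friedrichs mollifiers that
look only in the inward direction yield smooth functions which converge to `v` in `L¹`, together
with their derivatives along the field, up to the boundary (`exists_smooth_approx`). An `L¹` trace
estimate with the squared normal component as weight makes their boundary values converge, and the
limit is the weak trace (`tendsto_trace`). The chain rule for smooth functions then passes to the
limit.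

Charts carry this to the pieces. The ingredients are an area formula for the Hausdorff measure
(`muHE_image_eq_lintegral_jac`), the formula for the tangential divergence in a parametrization
(`jac_mul_trace_eq`), and the relation between the surface elements of a piece and of its boundary
(`jac_mul_inner_normal`). Charts exist off a compact set which is null for the measure of the
boundary. Such a set can be cut out by functions whose gradients are small in `L¹`
(`exists_cutoff_null`). Since `q(v)` is bounded, the error vanishes in the limit and the local laws
add up to a global one (`integral_eq_of_local`). -/

noncomputable section

namespace Fractured

open Filter Topology

/-! ### Coordinate planes and the divergence theorem in the half space. -/

/-- The isometric embedding of `ℝᵐ` into `ℝⁿ` as the plane of the first `m` coordinates. -/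
def incl {m n : ℕ} (h : m ≤ n) : E m →ₗᵢ[ℝ] E n where
  toFun y := WithLp.toLp 2 fun i => if hi : (i : ℕ) < m then y ⟨i, hi⟩ else 0
  map_add' x y := by
    ext i
    by_cases hi : (i : ℕ) < m <;> simp [hi]
  map_smul' c y := by
    ext i
    by_cases hi : (i : ℕ) < m <;> simp [hi]
  norm_map' y := by
    simp only [LinearMap.coe_mk, AddHom.coe_mk, EuclideanSpace.norm_eq]
    congr 1
    rw [← Finset.sum_subset (Finset.subset_univ (Finset.univ.map (Fin.castLEEmb h)))]
    · simp
    · intro i _ hi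
      have : ¬ (i : ℕ) < m := fun hi' => hi (by
        simp only [Finset.mem_map, Finset.mem_univ, true_and]
        exact ⟨⟨i, hi'⟩, by ext; simp⟩)
      simp [this]

/-- The projection of `ℝⁿ` onto the first `m` coordinates. -/
def projl {m n : ℕ} (h : m ≤ n) : E n →L[ℝ] E m :=
  LinearMap.toContinuousLinearMap
    { toFun := fun z => WithLp.toLp 2 fun i => z (Fin.castLE h i)
      map_add' := fun x y => by ext i; simp
      map_smul' := fun c x => by ext i; simp }

lemma incl_apply {m n : ℕ} (h : m ≤ n) (y : E m) (i : Fin n) :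
    incl h y i = if hi : (i : ℕ) < m then y ⟨i, hi⟩ else 0 := rfl

lemma projl_apply {m n : ℕ} (h : m ≤ n) (z : E n) (i : Fin m) :
    projl h z i = z (Fin.castLE h i) := rfl

@[simp] lemma projl_incl {m n : ℕ} (h : m ≤ n) (y : E m) : projl h (incl h y) = y := by
  ext i
  simp [projl_apply, incl_apply]

lemma incl_incl {l m n : ℕ} (h : l ≤ m) (h' : m ≤ n) (y : E l) :
    incl h' (incl h y) = incl (h.trans h') y := by
  ext i
  by_cases hi : (i : ℕ) < l
  · simp [incl_apply, hi, hi.trans_le h]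
  · simp [incl_apply, hi]

lemma incl_projl {m n : ℕ} (h : m ≤ n) (z : E n) (hz : ∀ i : Fin n, m ≤ (i : ℕ) → z i = 0) :
    incl h (projl h z) = z := by
  ext i
  by_cases hi : (i : ℕ) < m
  · simp only [incl_apply, hi, dite_true, projl_apply]
    rfl
  · simp [incl_apply, hi, hz i (not_lt.1 hi)]

/-- The open upper half space. -/
def upper (k : ℕ) : Set (E (k + 1)) := {y | 0 < y (Fin.last k)}

/-- The boundary plane of the half space. -/
abbrev face (k : ℕ) : E k →ₗᵢ[ℝ] E (k + 1) := incl k.le_succ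

@[simp] lemma face_last (k : ℕ) (z : E k) : face k z (Fin.last k) = 0 := by
  simp [incl_apply]

lemma continuous_last (k : ℕ) : Continuous fun y : E (k + 1) => y (Fin.last k) := by fun_prop

lemma isOpen_upper (k : ℕ) : IsOpen (upper k) := isOpen_lt continuous_const (continuous_last k)

lemma measurableSet_upper (k : ℕ) : MeasurableSet (upper k) := (isOpen_upper k).measurableSet

lemma trace_eq_sum {m : ℕ} (L : E m →L[ℝ] E m) :
    LinearMap.trace ℝ (E m) (L : E m →ₗ[ℝ] E m)
      = ∑ i, L (EuclideanSpace.single i 1) i := by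
  rw [LinearMap.trace_eq_sum_inner _ (EuclideanSpace.basisFun (Fin m) ℝ)]
  simp [EuclideanSpace.inner_single_left]

/-- Gauss' theorem in the half space. -/
theorem integral_trace_fderiv_upper {k : ℕ} {F : E (k + 1) → E (k + 1)} (hF : ContDiff ℝ 1 F)
    (hc : HasCompactSupport F) :
    ∫ y in upper k, LinearMap.trace ℝ (E (k + 1)) (fderiv ℝ F y : E (k + 1) →ₗ[ℝ] E (k + 1))
      = - ∫ z : E k, F (face k z) (Fin.last k) := by
  obtain ⟨R, hR0, hR⟩ : ∃ R : ℝ, 0 < R ∧ ∀ y, F y ≠ 0 → ∀ i, |y i| < R := by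
    obtain ⟨R, hR⟩ := hc.isBounded.exists_norm_le
    refine ⟨max R 0 + 1, by positivity, fun y hy i => ?_⟩
    have h1 := hR y (subset_tsupport _ hy)
    have h2 : ‖y i‖ ≤ ‖y‖ := PiLp.norm_apply_le y i
    rw [Real.norm_eq_abs] at h2
    linarith [le_max_left R 0]
  have hcD : HasCompactSupport (fderiv ℝ F) := hc.fderiv ℝ
  have hDR : ∀ y, fderiv ℝ F y ≠ 0 → ∀ i, |y i| ≤ R := by
    intro y hy i
    have : y ∈ closure (Function.support F) := support_fderiv_subset ℝ hy
    refine closure_minimal (s := Function.support F) (t := {y : E (k + 1) | |y i| ≤ R})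
      (fun y hy => (hR y hy i).le) (isClosed_le (by fun_prop) continuous_const) this
  -- The box has its bottom on the boundary plane, and all its other faces lie outside the support
  -- of `F`, so that only the bottom contributes.
  set a : Fin (k + 1) → ℝ := fun i => if i = Fin.last k then 0 else -(R + 1) with ha
  set b : Fin (k + 1) → ℝ := fun _ => R + 1 with hb
  have hle : a ≤ b := by
    intro i
    by_cases hi : i = Fin.last k <;> simp [ha, hb, hi] <;> linarith
  let P : (Fin (k + 1) → ℝ) →L[ℝ] E (k + 1) :=
    ((EuclideanSpace.equiv (Fin (k + 1)) ℝ).symm : (Fin (k + 1) → ℝ) →L[ℝ] E (k + 1))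
  have hPi : ∀ x i, P x i = x i := fun x i => rfl
  have hdF : ∀ y, HasFDerivAt F (fderiv ℝ F y) y := fun y =>
    (hF.differentiable one_ne_zero y).hasFDerivAt
  have key := integral_divergence_of_hasFDerivAt_off_countable' a b hle
    (fun i x => F (P x) i)
    (fun i x => (EuclideanSpace.proj i : E (k + 1) →L[ℝ] ℝ) ∘L (fderiv ℝ F (P x)) ∘L P) ∅
    countable_empty
    (fun i => by
      have := hF.continuous
      exact (((EuclideanSpace.proj i : E (k + 1) →L[ℝ] ℝ).continuous.comp this).comp
        P.continuous).continuousOn)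
    (fun x _ i => ((EuclideanSpace.proj i : E (k + 1) →L[ℝ] ℝ).hasFDerivAt.comp x
      ((hdF (P x)).comp x P.hasFDerivAt)))
    (by
      apply ContinuousOn.integrableOn_compact isCompact_Icc
      have h1 := (hF.continuous_fderiv one_ne_zero).comp P.continuous
      apply Continuous.continuousOn
      refine continuous_finsetSum _ fun i _ => ?_
      have : Continuous fun x => (fderiv ℝ F (P x)) (P (Pi.single i 1)) :=
        h1.clm_apply continuous_const
      exact (EuclideanSpace.proj i : E (k + 1) →L[ℝ] ℝ).continuous.comp this)
  have hsum : ∀ x : Fin (k + 1) → ℝ, ∑ i, ((EuclideanSpace.proj i : E (k + 1) →L[ℝ] ℝ) ∘L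
      (fderiv ℝ F (P x)) ∘L P) (Pi.single i 1) = LinearMap.trace ℝ (E (k + 1))
      (fderiv ℝ F (P x) : E (k + 1) →ₗ[ℝ] E (k + 1)) := by
    intro x
    rw [trace_eq_sum]
    rfl
  simp only [hsum] at key
  have hL : ∫ y in upper k, LinearMap.trace ℝ (E (k + 1))
      (fderiv ℝ F y : E (k + 1) →ₗ[ℝ] E (k + 1)) = ∫ x in Icc a b, LinearMap.trace ℝ (E (k + 1))
      (fderiv ℝ F (P x) : E (k + 1) →ₗ[ℝ] E (k + 1)) := by
    have h1 := (PiLp.volume_preserving_toLp (Fin (k + 1))).setIntegral_preimage_emb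
      (MeasurableEquiv.toLp 2 (Fin (k + 1) → ℝ)).measurableEmbedding
      (fun y => LinearMap.trace ℝ (E (k + 1)) (fderiv ℝ F y : E (k + 1) →ₗ[ℝ] E (k + 1))) (upper k)
    rw [← h1]
    -- The half-open box lies in the open half space and differs from the closed box by a null set.
    have h2 : (Set.univ.pi fun i => Ioc (a i) (b i)) =ᵐ[volume] Icc a b :=
      Measure.univ_pi_Ioc_ae_eq_Icc
    rw [← setIntegral_congr_set h2]
    refine setIntegral_eq_of_subset_of_forall_sdiff_eq_zero ?_ ?_ ?_
    · exact (measurableSet_upper k).preimage (MeasurableEquiv.toLp 2 (Fin (k + 1) → ℝ)).measurable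
    · intro x hx
      have := (hx (Fin.last k) (mem_univ _)).1
      simpa [ha, upper] using this
    · rintro x ⟨hx1, hx2⟩
      have hx1' : 0 < x (Fin.last k) := hx1
      by_contra hne
      have hD : fderiv ℝ F (P x) ≠ 0 := by
        intro h0
        apply hne
        have h0' : fderiv ℝ F (WithLp.toLp 2 x) = 0 := h0
        simp [h0']
      apply hx2
      intro i _
      have h3 := hDR _ hD i
      rw [hPi, abs_le] at h3
      refine ⟨?_, by simp only [hb]; linarith⟩
      by_cases hi : i = Fin.last k
      · subst hi; simpa [ha] using hx1'
      · simp only [ha, hi, if_false]; linarith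
  rw [hL, key, Finset.sum_eq_single (Fin.last k)]
  · have hzero : ∀ y, ¬ (∀ i, |y i| < R) → F y = 0 := fun y h => by
      by_contra h'
      exact h (hR y h')
    have h1 : ∀ x : Fin k → ℝ, F (P ((Fin.last k).insertNth (b (Fin.last k)) x)) = 0 := by
      intro x
      apply hzero
      intro h
      have := h (Fin.last k)
      rw [hPi, Fin.insertNth_apply_same, abs_lt] at this
      simp only [hb] at this
      linarith
    have h2 : ∀ x : Fin k → ℝ, P ((Fin.last k).insertNth (a (Fin.last k)) x)
        = face k (WithLp.toLp 2 x) := by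
      intro x
      ext i
      rw [hPi]
      refine Fin.lastCases ?_ (fun i => ?_) i
      · simp [ha]
      · rw [← Fin.succAbove_last_apply, Fin.insertNth_apply_succAbove]
        simp [incl_apply]
    simp only [h1, h2]
    simp only [PiLp.zero_apply, integral_zero, zero_sub]
    congr 1
    have h3 := (PiLp.volume_preserving_toLp (Fin k)).integral_comp
      (MeasurableEquiv.toLp 2 (Fin k → ℝ)).measurableEmbedding
      (fun z => F (face k z) (Fin.last k))
    rw [← h3]
    refine setIntegral_eq_integral_of_forall_compl_eq_zero fun x hx => ?_
    rw [hzero]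
    · rfl
    · intro h
      apply hx
      refine ⟨fun i => ?_, fun i => ?_⟩ <;>
      · have h5 : |x i| < R := by
          have := h i.castSucc
          simpa [incl_apply] using this
        rw [abs_lt] at h5
        simp [ha, hb]
        linarith
  · intro i _ hi
    have hb' : ∀ (c : ℝ), R ≤ |c| → ∀ x : Fin k → ℝ, F (P (i.insertNth c x)) = 0 := by
      intro c hc x
      by_contra h
      have := hR _ h i
      rw [hPi, Fin.insertNth_apply_same] at this
      linarith
    have hbi : R ≤ |b i| := by
      simp only [hb]
      exact (by linarith : R ≤ R + 1).trans (le_abs_self _)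
    have hai : R ≤ |a i| := by
      simp only [ha, hi, if_false, abs_neg]
      exact (by linarith : R ≤ R + 1).trans (le_abs_self _)
    simp [hb' _ hbi, hb' _ hai]
  · simp

end Fractured

end

/-! ### Continuity of translations in `L¹` and averages over small balls. -/

noncomputable section

namespace Fractured

open Filter Topology
open scoped ENNReal

/-- Translations are continuous in `L¹`. -/
theorem tendsto_lintegral_translate {m : ℕ} {u : E m → ℝ} (hu : Integrable u) :
    Tendsto (fun z => ∫⁻ x, ‖u (x + z) - u x‖ₑ) (𝓝 0) (𝓝 0) := by
  have hu1 : MemLp u 1 := memLp_one_iff_integrable.2 hu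
  let f : Lp ℝ 1 (volume : Measure (E m)) := hu1.toLp u
  -- Currying the addition makes the translations depend continuously on `z` in the compact-open
  -- topology, as the continuity of composition in `Lp` requires.
  let g : C(E m, C(E m, E m)) := ContinuousMap.curry ⟨fun p : E m × E m => p.2 + p.1, by fun_prop⟩
  have hg : ∀ z, MeasurePreserving (g z) (volume : Measure (E m)) volume := fun z =>
    measurePreserving_add_right volume z
  have h := Filter.Tendsto.compMeasurePreservingLp (f := fun _ : E m => f) (f₀ := f) (g := g)
    (g₀ := g 0) (l := 𝓝 0) tendsto_const_nhds (g.continuous.tendsto 0) hg (hg 0) ENNReal.one_ne_top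
  have h2 := (h.sub_const f).enorm
  have h3 : Lp.compMeasurePreserving (g 0) (hg 0) f = f := by
    ext1
    filter_upwards [Lp.coeFn_compMeasurePreserving f (hg 0)] with x hx
    rw [hx]
    simp [g]
  rw [h3, sub_self, enorm_zero] at h2
  refine h2.congr fun z => ?_
  rw [Lp.enorm_def, eLpNorm_one_eq_lintegral_enorm]
  refine lintegral_congr_ae ?_
  have h4 : ∀ᵐ x, f x = u x := hu1.coeFn_toLp
  have h5 : ∀ᵐ x, f (g z x) = u (g z x) := (hg z).quasiMeasurePreserving.ae h4
  filter_upwards [Lp.coeFn_compMeasurePreserving f (hg z), h4, h5,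
    Lp.coeFn_sub (Lp.compMeasurePreserving (g z) (hg z) f) f] with x h6 h7 h8 h9
  rw [h9, Pi.sub_apply, h6, Function.comp_apply, h8, h7]
  rfl

/-- Averages of differences over small balls tend to zero in `L¹`. -/
theorem eventually_lintegral_kernel_le {m : ℕ} {u : E m → ℝ} (hu : Integrable u) (C R : ℝ)
    (hR : 0 ≤ R) {η : ℝ≥0∞} (hη : 0 < η) :
    ∀ᶠ ε in 𝓝[>] (0 : ℝ), ∀ κ : E m → E m → ℝ,
      (∀ x y, |κ x y| ≤ C * (ε ^ m)⁻¹) → (∀ x y, R * ε < ‖x - y‖ → κ x y = 0) →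
      ∫⁻ x, ‖∫ y, (u y - u x) * κ x y‖ₑ ≤ η := by
  -- `K` bounds the mass of the kernels: their height `C * ε⁻ᵐ` times the volume of a ball of radius
  -- `R * ε`. It does not depend on `ε`.
  set K : ℝ≥0∞ := ENNReal.ofReal C * (ENNReal.ofReal (R ^ m) * volume (Metric.ball (0 : E m) 1))
    with hK
  have hKtop : K ≠ ⊤ := by
    refine ENNReal.mul_ne_top ENNReal.ofReal_ne_top (ENNReal.mul_ne_top ENNReal.ofReal_ne_top measure_ball_lt_top.ne)
  obtain ⟨θ, hθ0, hθ⟩ : ∃ θ : ℝ≥0∞, 0 < θ ∧ K * θ ≤ η := by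
    by_cases hη' : η = ⊤
    · exact ⟨1, one_pos, by simp [hη']⟩
    -- The summand `1` avoids a division by zero when `K = 0`.
    refine ⟨η / (K + 1), ENNReal.div_pos hη.ne' (by simp [hKtop]), ?_⟩
    calc K * (η / (K + 1)) ≤ (K + 1) * (η / (K + 1)) := by gcongr; exact le_self_add
      _ ≤ η := ENNReal.mul_div_le
  have h1 : ∀ᶠ z in 𝓝 (0 : E m), ∫⁻ x, ‖u (x + z) - u x‖ₑ ≤ θ :=
    (tendsto_lintegral_translate hu).eventually (Iic_mem_nhds hθ0)
  obtain ⟨δ, hδ, hδ'⟩ := Metric.eventually_nhds_iff.1 h1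
  have h2 : ∀ᶠ ε in 𝓝[>] (0 : ℝ), R * ε < δ := by
    have : Tendsto (fun ε : ℝ => R * ε) (𝓝[>] 0) (𝓝 (R * 0)) :=
      (tendsto_id.const_mul R).mono_left nhdsWithin_le_nhds
    rw [mul_zero] at this
    exact this.eventually (gt_mem_nhds hδ)
  filter_upwards [h2, self_mem_nhdsWithin] with ε hε hε0 κ hκ1 hκ2
  have hε0 : 0 < ε := hε0
  have hεm : 0 < ε ^ m := pow_pos hε0 m
  set A : ℝ≥0∞ := ENNReal.ofReal (C * (ε ^ m)⁻¹) with hA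
  set S : Set (E m) := Metric.closedBall 0 (R * ε) with hS
  calc ∫⁻ x, ‖∫ y, (u y - u x) * κ x y‖ₑ
      ≤ ∫⁻ x, ∫⁻ y, ‖(u y - u x) * κ x y‖ₑ :=
        lintegral_mono fun x => enorm_integral_le_lintegral_enorm _
    -- After the substitution `y = x + z` Tonelli's theorem leaves, for each small `z`, the `L¹`
    -- distance of `u` to its translate.
    _ = ∫⁻ x, ∫⁻ z, ‖(u (x + z) - u x) * κ x (x + z)‖ₑ := by
        refine lintegral_congr fun x => ?_
        rw [← lintegral_add_left_eq_self (fun y => ‖(u y - u x) * κ x y‖ₑ) x]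
    _ ≤ ∫⁻ x, ∫⁻ z, S.indicator (fun z => A * ‖u (x + z) - u x‖ₑ) z := by
        refine lintegral_mono fun x => lintegral_mono fun z => ?_
        by_cases hz : z ∈ S
        · rw [indicator_of_mem hz, enorm_mul, mul_comm]
          gcongr
          rw [Real.enorm_eq_ofReal_abs]
          exact ENNReal.ofReal_le_ofReal (hκ1 _ _)
        · have : κ x (x + z) = 0 := by
            apply hκ2
            have : R * ε < ‖z‖ := by simpa [hS] using hz
            simpa using this
          simp [this]
    _ = ∫⁻ z, ∫⁻ x, S.indicator (fun z => A * ‖u (x + z) - u x‖ₑ) z := by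
        rw [lintegral_lintegral_swap]
        -- As `u` is only almost everywhere measurable, the composition is justified by the addition
        -- map being quasi measure preserving.
        have h3 : AEMeasurable (fun p : E m × E m => u (p.1 + p.2))
            ((volume : Measure (E m)).prod volume) := by
          have h4 : Measure.QuasiMeasurePreserving (fun p : E m × E m => p.1 + p.2)
              ((volume : Measure (E m)).prod volume) volume := by
            have := Measure.quasiMeasurePreserving_snd (μ := (volume : Measure (E m)))
              (ν := (volume : Measure (E m)))
            exact this.comp
              (measurePreserving_prod_add volume (volume : Measure (E m))).quasiMeasurePreserving
          exact hu.1.aemeasurable.comp_quasiMeasurePreserving h4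
        have h5 : AEMeasurable (fun p : E m × E m => u p.1)
            ((volume : Measure (E m)).prod volume) :=
          hu.1.aemeasurable.comp_quasiMeasurePreserving Measure.quasiMeasurePreserving_fst
        have h6 : AEMeasurable (fun p : E m × E m => A * ‖u (p.1 + p.2) - u p.1‖ₑ)
            ((volume : Measure (E m)).prod volume) := (h3.sub h5).enorm.const_mul A
        have hSm : MeasurableSet (Prod.snd ⁻¹' S : Set (E m × E m)) :=
          measurable_snd Metric.isClosed_closedBall.measurableSet
        have h7 := h6.indicator hSm
        refine h7.congr (Eventually.of_forall fun p => ?_)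
        by_cases hp : p.2 ∈ S
        · have hp' : p ∈ Prod.snd ⁻¹' S := hp
          rw [indicator_of_mem hp']
          simp only [Function.uncurry, indicator_of_mem hp]
        · have hp' : p ∉ Prod.snd ⁻¹' S := hp
          rw [indicator_of_notMem hp']
          simp only [Function.uncurry, indicator_of_notMem hp]
    _ ≤ ∫⁻ z, S.indicator (fun _ => A * θ) z := by
        refine lintegral_mono fun z => ?_
        by_cases hz : z ∈ S
        · simp only [indicator_of_mem hz]
          rw [lintegral_const_mul' _ _ ENNReal.ofReal_ne_top]
          gcongr
          apply hδ'
          have : ‖z‖ ≤ R * ε := by simpa [hS] using hz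
          simpa using this.trans_lt hε
        · simp [indicator_of_notMem hz]
    _ = A * θ * (ENNReal.ofReal ((R * ε) ^ m) * volume (Metric.ball (0 : E m) 1)) := by
        rw [lintegral_indicator Metric.isClosed_closedBall.measurableSet, lintegral_const,
          Measure.restrict_apply_univ, Measure.addHaar_closedBall _ _ (by positivity)]
        simp
    _ = K * θ := by
        have : A * ENNReal.ofReal ((R * ε) ^ m) = ENNReal.ofReal C * ENNReal.ofReal (R ^ m) := by
          rw [hA, ← ENNReal.ofReal_mul' (by positivity), ← ENNReal.ofReal_mul' (by positivity)]
          congr 1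
          rw [mul_pow]
          field_simp
        rw [hK, ← mul_assoc (ENNReal.ofReal C), ← this]
        ring
    _ ≤ η := hθ

end Fractured

end

/-! ### One-sided mollification and Friedrichs' lemma. -/

noncomputable section

namespace Fractured

open Filter Topology
open scoped ENNReal

/-- The divergence of a vector field. -/
def dvg {m : ℕ} (B : E m → E m) (y : E m) : ℝ :=
  LinearMap.trace ℝ (E m) (fderiv ℝ B y : E m →ₗ[ℝ] E m)

lemma dvg_smul {m : ℕ} {f : E m → ℝ} {B : E m → E m} {y : E m} (hf : DifferentiableAt ℝ f y)
    (hB : DifferentiableAt ℝ B y) :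
    dvg (fun y => f y • B y) y = fderiv ℝ f y (B y) + f y * dvg B y := by
  have h1 : fderiv ℝ (fun y => f y • B y) y
      = f y • fderiv ℝ B y + (fderiv ℝ f y).smulRight (B y) := fderiv_fun_smul hf hB
  rw [dvg, dvg, h1, trace_eq_sum, trace_eq_sum, Finset.mul_sum]
  simp only [_root_.add_apply, _root_.smul_apply, PiLp.add_apply,
    PiLp.smul_apply, smul_eq_mul, ContinuousLinearMap.smulRight_apply, Finset.sum_add_distrib]
  rw [add_comm]
  congr 1
  conv_rhs => rw [← (EuclideanSpace.basisFun (Fin m) ℝ).sum_repr (B y)]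
  simp [map_sum, mul_comm]

lemma continuous_dvg {m : ℕ} {B : E m → E m} (hB : ContDiff ℝ 1 B) : Continuous (dvg B) := by
  have h : Continuous (fderiv ℝ B) := hB.continuous_fderiv one_ne_zero
  have : dvg B = fun y => ∑ i, fderiv ℝ B y (EuclideanSpace.single i 1) i := by
    funext y; exact trace_eq_sum _
  rw [this]
  refine continuous_finsetSum _ fun i _ => ?_
  exact (EuclideanSpace.proj i : E m →L[ℝ] ℝ).continuous.comp (h.clm_apply continuous_const)

lemma hasCompactSupport_dvg {m : ℕ} {B : E m → E m} (hc : HasCompactSupport B) :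
    HasCompactSupport (dvg B) := by
  refine (hc.fderiv ℝ).mono fun y hy => ?_
  intro h
  apply hy
  simp [dvg, h]

/-- Integration by parts in the half space. -/
theorem integral_upper_by_parts {k : ℕ} {f : E (k + 1) → ℝ} {B : E (k + 1) → E (k + 1)}
    (hf : ContDiff ℝ 1 f) (hB : ContDiff ℝ 1 B) (hc : HasCompactSupport fun y => f y • B y) :
    ∫ y in upper k, (fderiv ℝ f y (B y) + f y * dvg B y)
      = - ∫ z : E k, B (face k z) (Fin.last k) * f (face k z) := by
  have h := integral_trace_fderiv_upper (F := fun y => f y • B y) (hf.smul hB) hc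
  have h2 : ∀ y, fderiv ℝ f y (B y) + f y * dvg B y = LinearMap.trace ℝ (E (k + 1))
      (fderiv ℝ (fun y => f y • B y) y : E (k + 1) →ₗ[ℝ] E (k + 1)) := fun y =>
    (dvg_smul (hf.differentiable one_ne_zero y) (hB.differentiable one_ne_zero y)).symm
  simp only [h2]
  rw [h]
  simp [mul_comm]

/-- A bump of radius `1` around the point at depth `2` below the boundary plane. In `r (x - y)` such
a kernel averages over points `y` that lie higher than `x`, so at points of the half space no values
from outside are used. -/
lemma exists_mollifier (k : ℕ) : ∃ ρ : E (k + 1) → ℝ, ContDiff ℝ ∞ ρ ∧ HasCompactSupport ρ ∧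
    ∫ z, ρ z = 1 ∧ ∀ z ∈ tsupport ρ, z (Fin.last k) < 0 ∧ ‖z‖ ≤ 3 := by
  set c : E (k + 1) := EuclideanSpace.single (Fin.last k) (-2) with hcdef
  let φ : ContDiffBump c := ⟨1 / 2, 1, by norm_num, by norm_num⟩
  refine ⟨φ.normed volume, φ.contDiff_normed, φ.hasCompactSupport_normed, φ.integral_normed, ?_⟩
  intro z hz
  rw [φ.tsupport_normed_eq, mem_closedBall_iff_norm] at hz
  have hz : ‖z - c‖ ≤ 1 := hz
  have h1 : ‖(z - c) (Fin.last k)‖ ≤ ‖z - c‖ := PiLp.norm_apply_le _ _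
  have h2 : (z - c) (Fin.last k) = z (Fin.last k) + 2 := by simp [hcdef]
  rw [h2, Real.norm_eq_abs, abs_le] at h1
  have h3 : ‖z‖ ≤ ‖z - c‖ + ‖c‖ := by simpa using norm_add_le (z - c) c
  have h4 : ‖c‖ = 2 := by simp [hcdef]
  constructor <;> linarith [h1.2]

/-- Mollifiers at the scale `ε`, which look in the inward direction of the half space. -/
lemma exists_scaled_mollifier (k : ℕ) : ∃ A : ℝ, 0 ≤ A ∧ ∀ ε : ℝ, 0 < ε → ∃ r : E (k + 1) → ℝ,
    ContDiff ℝ ∞ r ∧ HasCompactSupport r ∧ ∫ z, r z = 1 ∧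
    (∀ z ∈ tsupport r, z (Fin.last k) < 0) ∧ (∀ z, 3 * ε < ‖z‖ → r z = 0 ∧ fderiv ℝ r z = 0) ∧
    (∀ z, |r z| ≤ A * (ε ^ (k + 1))⁻¹) ∧ ∀ z, ‖fderiv ℝ r z‖ ≤ A * (ε ^ (k + 1))⁻¹ * ε⁻¹ := by
  obtain ⟨ρ, hρ, hρc, hρ1, hρs⟩ := exists_mollifier k
  obtain ⟨A₁, hA₁⟩ := hρc.exists_bound_of_continuous hρ.continuous
  obtain ⟨A₂, hA₂⟩ := (hρc.fderiv ℝ).exists_bound_of_continuous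
    (hρ.continuous_fderiv (by simp))
  have hA₁0 : 0 ≤ A₁ := (norm_nonneg _).trans (hA₁ 0)
  refine ⟨max A₁ A₂, le_max_of_le_left hA₁0, fun ε hε => ?_⟩
  have hm : 0 < ε ^ (k + 1) := pow_pos hε _
  have hsm : ∀ z : E (k + 1), HasFDerivAt (fun z => (ε ^ (k + 1))⁻¹ * ρ (ε⁻¹ • z))
      ((ε ^ (k + 1))⁻¹ • (fderiv ℝ ρ (ε⁻¹ • z) ∘L (ε⁻¹ • ContinuousLinearMap.id ℝ (E (k + 1))))) z := by
    intro z
    have h1 : HasFDerivAt (fun z : E (k + 1) => ε⁻¹ • z)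
        (ε⁻¹ • ContinuousLinearMap.id ℝ (E (k + 1))) z := (hasFDerivAt_id z).const_smul ε⁻¹
    have h2 : HasFDerivAt ρ (fderiv ℝ ρ (ε⁻¹ • z)) (ε⁻¹ • z) :=
      (hρ.differentiable (by simp) _).hasFDerivAt
    exact (h2.comp z h1).const_mul _
  have hts : tsupport (fun z => (ε ^ (k + 1))⁻¹ * ρ (ε⁻¹ • z)) ⊆ {z | ε⁻¹ • z ∈ tsupport ρ} := by
    refine closure_minimal (fun z hz => ?_)
      ((isClosed_tsupport ρ).preimage (continuous_const_smul ε⁻¹))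
    exact subset_tsupport _ (right_ne_zero_of_mul hz)
  have hfar : ∀ z : E (k + 1), 3 * ε < ‖z‖ → ε⁻¹ • z ∉ tsupport ρ := by
    intro z hz h
    have := (hρs _ h).2
    rw [norm_smul, norm_inv, Real.norm_of_nonneg hε.le, inv_mul_le_iff₀ hε] at this
    linarith
  refine ⟨fun z => (ε ^ (k + 1))⁻¹ * ρ (ε⁻¹ • z), ?_, ?_, ?_, ?_, ?_, ?_, ?_⟩
  · exact contDiff_const.mul (hρ.comp (contDiff_const_smul _))
  · refine HasCompactSupport.of_support_subset_isCompact (isCompact_closedBall 0 (3 * ε)) ?_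
    intro z hz
    by_contra h
    apply hz
    have : ρ (ε⁻¹ • z) = 0 := image_eq_zero_of_notMem_tsupport
      (hfar z (by simpa using h))
    simp [this]
  · rw [integral_const_mul, Measure.integral_comp_inv_smul, hρ1]
    simp [abs_of_pos hm, hm.ne']
  · intro z hz
    have h1 := (hρs _ (hts hz)).1
    have h2 : ε⁻¹ * z (Fin.last k) < 0 := by simpa using h1
    by_contra h3
    have := mul_nonneg (inv_nonneg.2 hε.le) (not_lt.1 h3)
    linarith
  · intro z hz
    have h1 := hfar z hz
    constructor
    · simp [image_eq_zero_of_notMem_tsupport h1]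
    · rw [(hsm z).fderiv]
      have : fderiv ℝ ρ (ε⁻¹ • z) = 0 := by
        by_contra h
        exact h1 (support_fderiv_subset ℝ h)
      simp [this]
  · intro z
    rw [abs_mul, abs_of_pos (inv_pos.2 hm), mul_comm]
    gcongr
    exact (hA₁ _).trans (le_max_left _ _)
  · intro z
    rw [(hsm z).fderiv, norm_smul, norm_inv, Real.norm_of_nonneg hm.le]
    calc (ε ^ (k + 1))⁻¹ * ‖fderiv ℝ ρ (ε⁻¹ • z) ∘L (ε⁻¹ • ContinuousLinearMap.id ℝ (E (k + 1)))‖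
        ≤ (ε ^ (k + 1))⁻¹ * (max A₁ A₂ * ε⁻¹) := by
          gcongr
          refine (ContinuousLinearMap.opNorm_comp_le _ _).trans ?_
          gcongr
          · exact (hA₂ _).trans (le_max_right _ _)
          · rw [norm_smul, norm_inv, Real.norm_of_nonneg hε.le]
            exact mul_le_of_le_one_right (inv_nonneg.2 hε.le) ContinuousLinearMap.norm_id_le
      _ = _ := by ring

lemma integrable_mul_translate {m : ℕ} {u : E m → ℝ} (hu : Integrable u) {r : E m → ℝ}
    (hr : Continuous r) (hrc : HasCompactSupport r) (x : E m) :
    Integrable fun y => u y * r (x - y) := by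
  obtain ⟨C, hC⟩ := hrc.exists_bound_of_continuous hr
  exact hu.mul_bdd (c := C) (hr.comp (continuous_const.sub continuous_id)).aestronglyMeasurable (Eventually.of_forall fun y => hC _)

lemma integral_mul_translate_sub {m : ℕ} {u : E m → ℝ} (hu : Integrable u) {r : E m → ℝ}
    (hr : Continuous r) (hrc : HasCompactSupport r) (hr1 : ∫ z, r z = 1) (x : E m) :
    (∫ y, u y * r (x - y)) - u x = ∫ y, (u y - u x) * r (x - y) := by
  have h1 : Integrable r := hr.integrable_of_hasCompactSupport hrc
  have h2 : ∫ y, r (x - y) = 1 := by rw [integral_sub_left_eq_self r volume x, hr1]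
  simp only [sub_mul]
  rw [integral_sub (integrable_mul_translate hu hr hrc x) ((h1.comp_sub_left x).const_mul _),
    integral_const_mul, h2, mul_one]

lemma hasFDerivAt_mollify {m : ℕ} {v : E m → ℝ} (hv : Integrable v) {r : E m → ℝ}
    (hr : ContDiff ℝ ∞ r) (hrc : HasCompactSupport r) (x b : E m) :
    fderiv ℝ (fun x => ∫ y, v y * r (x - y)) x b = ∫ y, v y * fderiv ℝ r (x - y) b := by
  have h1 := hrc.hasFDerivAt_convolution_right (ContinuousLinearMap.mul ℝ ℝ)
    hv.locallyIntegrable (hr.of_le (by simp)) x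
  have h2 : (fun x => ∫ y, v y * r (x - y)) = convolution v r (ContinuousLinearMap.mul ℝ ℝ) volume := by
    funext x
    simp [convolution_def]
  rw [h2, h1.fderiv, convolution_def, ContinuousLinearMap.integral_apply]
  · simp [ContinuousLinearMap.precompR_apply]
  · refine (HasCompactSupport.convolutionExists_right _ (hrc.fderiv ℝ)
      hv.locallyIntegrable (hr.continuous_fderiv (by simp))) x

lemma contDiff_mollify {m : ℕ} {v : E m → ℝ} (hv : Integrable v) {r : E m → ℝ}
    (hr : ContDiff ℝ ∞ r) (hrc : HasCompactSupport r) :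
    ContDiff ℝ ∞ (fun x => ∫ y, v y * r (x - y)) := by
  have h1 := hrc.contDiff_convolution_right (n := (⊤ : ℕ∞)) (ContinuousLinearMap.mul ℝ ℝ)
    hv.locallyIntegrable hr
  have h2 : (fun x => ∫ y, v y * r (x - y)) = convolution v r (ContinuousLinearMap.mul ℝ ℝ) volume := by
    funext x
    simp [convolution_def]
  rw [h2]
  exact h1

/-- Friedrichs' commutator identity. -/
theorem fderiv_mollify_sub {k : ℕ} {v g r : E (k + 1) → ℝ} {B : E (k + 1) → E (k + 1)}
    (hv : Integrable v) (hg : Integrable g) (hB : ContDiff ℝ 1 B)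
    (hweak : ∀ h : E (k + 1) → ℝ, ContDiff ℝ ∞ h → HasCompactSupport h → tsupport h ⊆ upper k →
      ∫ y, (g y * h y + v y * (fderiv ℝ h y (B y) + h y * dvg B y)) = 0)
    (hr : ContDiff ℝ ∞ r) (hrc : HasCompactSupport r) (hr1 : ∫ z, r z = 1)
    (hrs : ∀ z ∈ tsupport r, z (Fin.last k) < 0) {x : E (k + 1)} (hx : x ∈ upper k) :
    fderiv ℝ (fun x => ∫ y, v y * r (x - y)) x (B x) - g x
      = (∫ y, (g y - g x) * r (x - y)) +
        ∫ y, (v y - v x) * (fderiv ℝ r (x - y) (B x - B y) + r (x - y) * dvg B y) := by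
  -- For `x` in the half space the kernel is itself an admissible test function, because its support
  -- in `y` stays above `x`.
  set h : E (k + 1) → ℝ := fun y => r (x - y) with hh
  have hsub : ContDiff ℝ ∞ fun y : E (k + 1) => x - y := contDiff_const.sub contDiff_id
  have hhs : ContDiff ℝ ∞ h := hr.comp hsub
  have hhc : HasCompactSupport h := by
    have := hrc.comp_homeomorph (Homeomorph.subLeft x)
    exact this
  have hdh : ∀ y b, fderiv ℝ h y b = - fderiv ℝ r (x - y) b := by
    intro y b
    have h1 : HasFDerivAt (fun y : E (k + 1) => x - y) (-ContinuousLinearMap.id ℝ _) y :=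
      (hasFDerivAt_id y).const_sub x
    have h2 : HasFDerivAt r (fderiv ℝ r (x - y)) (x - y) :=
      (hr.differentiable (by simp) _).hasFDerivAt
    have h3 : HasFDerivAt h _ y := h2.comp y h1
    rw [h3.fderiv]
    simp
  have hhu : tsupport h ⊆ upper k := by
    have h1 : tsupport h ⊆ {y | x - y ∈ tsupport r} :=
      closure_minimal (fun y hy => subset_tsupport r hy)
        ((isClosed_tsupport r).preimage (by fun_prop))
    intro y hy
    have h2 := hrs _ (h1 hy)
    have h3 : 0 < x (Fin.last k) := hx
    have h4 : x (Fin.last k) - y (Fin.last k) < 0 := h2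
    show 0 < y (Fin.last k)
    linarith
  have hDc : Continuous (fderiv ℝ r) := hr.continuous_fderiv (by simp)
  have hdv := continuous_dvg hB
  -- The derivative of the kernel, of relative size `ε⁻¹`, meets the difference `B x - B y`, of size
  -- `ε`, so `κ` is no larger than a mollifier.
  set κ : E (k + 1) → ℝ := fun y => fderiv ℝ r (x - y) (B x - B y) + r (x - y) * dvg B y with hκ
  have hκcont : Continuous κ := by
    have h1 : Continuous fun y => fderiv ℝ r (x - y) (B x - B y) :=
      (hDc.comp (by fun_prop)).clm_apply (continuous_const.sub hB.continuous)
    have h2 : Continuous fun y => r (x - y) := hhs.continuous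
    exact h1.add (h2.mul hdv)
  have hκc : HasCompactSupport κ := by
    have h1 : HasCompactSupport fun y => fderiv ℝ r (x - y) :=
      (hrc.fderiv ℝ).comp_homeomorph (Homeomorph.subLeft x)
    refine (hhc.union h1).of_isClosed_subset (isClosed_tsupport _) ?_
    refine closure_minimal (fun y hy => ?_) ((isClosed_tsupport _).union (isClosed_tsupport _))
    by_contra hcon
    rw [mem_union, not_or] at hcon
    apply hy
    have e1 : r (x - y) = 0 := image_eq_zero_of_notMem_tsupport (f := h) hcon.1
    have e2 : fderiv ℝ r (x - y) = 0 :=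
      image_eq_zero_of_notMem_tsupport (f := fun y => fderiv ℝ r (x - y)) hcon.2
    simp [hκ, e1, e2]
  have hκint : Integrable κ := hκcont.integrable_of_hasCompactSupport hκc
  obtain ⟨Cκ, hCκ⟩ := hκc.exists_bound_of_continuous hκcont
  have hvκ : Integrable fun y => v y * κ y :=
    hv.mul_bdd hκcont.aestronglyMeasurable (Eventually.of_forall hCκ)
  -- `κ` is the divergence of `h • (B - B x)`, which has compact support in the half space. Its
  -- integral therefore vanishes, and `v y` may be replaced by `v y - v x`.
  have hκ0 : ∫ y, κ y = 0 := by
    have h1 := integral_upper_by_parts (f := h) (B := fun y => B y - B x)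
      (hhs.of_le (by simp)) (hB.sub contDiff_const) (hhc.smul_right)
    have h2 : ∀ y, fderiv ℝ h y (B y - B x) + h y * dvg (fun y => B y - B x) y = κ y := by
      intro y
      have : dvg (fun y => B y - B x) y = dvg B y := by
        simp only [dvg, fderiv_sub_const]
      rw [this, hdh, ← map_neg, neg_sub]
    simp only [h2] at h1
    have h3 : ∀ z : E k, h (face k z) = 0 := by
      intro z
      apply image_eq_zero_of_notMem_tsupport
      intro hz
      have h4 : 0 < (face k z) (Fin.last k) := hhu hz
      simp at h4
    simp only [h3, mul_zero, integral_zero, neg_zero] at h1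
    rw [← h1]
    refine (setIntegral_eq_integral_of_forall_compl_eq_zero fun y hy => ?_).symm
    have e1 : y ∉ tsupport h := fun h' => hy (hhu h')
    have e2 : h y = 0 := image_eq_zero_of_notMem_tsupport e1
    have e3 : fderiv ℝ h y = 0 := by
      by_contra h'
      exact e1 (support_fderiv_subset ℝ h')
    rw [← h2, e2, e3]
    simp
  have hw := hweak h hhs hhc hhu
  have hI1 : Integrable fun y => g y * h y := integrable_mul_translate hg hr.continuous hrc x
  have hI2 : Integrable fun y => v y * fderiv ℝ r (x - y) (B x) := by
    have hc1 : Continuous fun z => fderiv ℝ r z (B x) := hDc.clm_apply continuous_const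
    have hc2 : HasCompactSupport fun z => fderiv ℝ r z (B x) := by
      refine (hrc.fderiv ℝ).mono fun z hz h0 => hz (by simp [h0])
    exact integrable_mul_translate hv hc1 hc2 x
  have e1 : ∀ y, g y * h y + v y * (fderiv ℝ h y (B y) + h y * dvg B y)
      = g y * h y + (v y * κ y - v y * fderiv ℝ r (x - y) (B x)) := by
    intro y
    rw [hdh]
    simp only [hκ, map_sub]
    ring
  simp only [e1] at hw
  have hw2 : ∫ y, (g y * h y + (v y * κ y - v y * fderiv ℝ r (x - y) (B x)))
      = (∫ y, g y * h y) + ∫ y, (v y * κ y - v y * fderiv ℝ r (x - y) (B x)) :=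
    integral_add hI1 (hvκ.sub hI2)
  rw [hw2, integral_sub hvκ hI2] at hw
  have e2 : ∫ y, (v y - v x) * κ y = ∫ y, v y * κ y := by
    simp only [sub_mul]
    rw [integral_sub hvκ (hκint.const_mul _), integral_const_mul, hκ0]
    simp
  rw [hasFDerivAt_mollify hv hr hrc, e2, ← integral_mul_translate_sub hg hr.continuous hrc hr1]
  linarith

/-- Friedrichs' lemma in the half space. -/
theorem exists_smooth_approx {k : ℕ} {v g : E (k + 1) → ℝ} {B : E (k + 1) → E (k + 1)}
    (hv : Integrable v) (hg : Integrable g) (hB : ContDiff ℝ 1 B) (hBc : HasCompactSupport B)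
    (hweak : ∀ h : E (k + 1) → ℝ, ContDiff ℝ ∞ h → HasCompactSupport h → tsupport h ⊆ upper k →
      ∫ y, (g y * h y + v y * (fderiv ℝ h y (B y) + h y * dvg B y)) = 0) :
    ∃ w : ℕ → E (k + 1) → ℝ, (∀ p, ContDiff ℝ ∞ (w p)) ∧
      Tendsto (fun p => ∫⁻ x, ‖w p x - v x‖ₑ) atTop (𝓝 0) ∧
      Tendsto (fun p => ∫⁻ x in upper k, ‖fderiv ℝ (w p) x (B x) - g x‖ₑ) atTop (𝓝 0) := by
  obtain ⟨A, hA0, hA⟩ := exists_scaled_mollifier k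
  obtain ⟨L, hL⟩ := hB.lipschitzWith_of_hasCompactSupport hBc one_ne_zero
  obtain ⟨D, hD⟩ := (hasCompactSupport_dvg hBc).exists_bound_of_continuous (continuous_dvg hB)
  have hD0 : 0 ≤ D := (norm_nonneg _).trans (hD 0)
  -- The case `p = 0` needs no exception, since the inverse of zero is `⊤` here.
  have main : ∀ p : ℕ, ∃ w : E (k + 1) → ℝ, ContDiff ℝ ∞ w ∧
      ∫⁻ x, ‖w x - v x‖ₑ ≤ (p : ℝ≥0∞)⁻¹ ∧
      ∫⁻ x in upper k, ‖fderiv ℝ w x (B x) - g x‖ₑ ≤ (p : ℝ≥0∞)⁻¹ + (p : ℝ≥0∞)⁻¹ := by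
    intro p
    have hp : (0 : ℝ≥0∞) < (p : ℝ≥0∞)⁻¹ := by simp
    have h1 := eventually_lintegral_kernel_le hv A 3 (by norm_num) hp
    have h2 := eventually_lintegral_kernel_le hg A 3 (by norm_num) hp
    -- In the commutator kernel, `3 * L` comes from the Lipschitz bound of `B` at distance at most
    -- `3 * ε`, which absorbs `ε⁻¹`, and `D` bounds the divergence of `B`.
    have h3 := eventually_lintegral_kernel_le hv (A * (3 * L + D)) 3 (by norm_num) hp
    obtain ⟨ε, ⟨⟨hε1, hε2⟩, hε3⟩, hε0⟩ := ((h1.and h2).and h3 |>.and self_mem_nhdsWithin).exists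
    have hε0 : 0 < ε := hε0
    have hm : 0 < (ε ^ (k + 1))⁻¹ := inv_pos.2 (pow_pos hε0 _)
    obtain ⟨r, hr, hrc, hr1, hrs, hr0, hrb, hrd⟩ := hA ε hε0
    refine ⟨fun x => ∫ y, v y * r (x - y), contDiff_mollify hv hr hrc, ?_, ?_⟩
    · simp only [integral_mul_translate_sub hv hr.continuous hrc hr1]
      exact hε1 (fun x y => r (x - y)) (fun x y => hrb _) (fun x y hxy => (hr0 _ hxy).1)
    · have e1 : ∫⁻ x in upper k, ‖fderiv ℝ (fun x => ∫ y, v y * r (x - y)) x (B x) - g x‖ₑ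
          ≤ ∫⁻ x in upper k, (‖∫ y, (g y - g x) * r (x - y)‖ₑ +
            ‖∫ y, (v y - v x) * (fderiv ℝ r (x - y) (B x - B y) + r (x - y) * dvg B y)‖ₑ) := by
        refine setLIntegral_mono_ae' (measurableSet_upper k) (Eventually.of_forall fun x hx => ?_)
        rw [fderiv_mollify_sub hv hg hB hweak hr hrc hr1 hrs hx]
        exact enorm_add_le _ _
      refine e1.trans ((lintegral_mono' Measure.restrict_le_self le_rfl).trans ?_)
      rw [lintegral_add_left']
      · refine add_le_add ?_ ?_
        · exact hε2 (fun x y => r (x - y)) (fun x y => hrb _) (fun x y hxy => (hr0 _ hxy).1)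
        · refine hε3 (fun x y => fderiv ℝ r (x - y) (B x - B y) + r (x - y) * dvg B y) ?_ ?_
          · intro x y
            by_cases hxy : 3 * ε < ‖x - y‖
            · obtain ⟨e2, e3⟩ := hr0 _ hxy
              simp only [e2, e3, _root_.zero_apply, zero_mul, add_zero, abs_zero]
              positivity
            · have e4 : ‖B x - B y‖ ≤ L * (3 * ε) := by
                have := hL.dist_le_mul x y
                rw [dist_eq_norm, dist_eq_norm] at this
                exact this.trans (mul_le_mul_of_nonneg_left (not_lt.1 hxy) L.2)
              calc |fderiv ℝ r (x - y) (B x - B y) + r (x - y) * dvg B y|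
                  ≤ ‖fderiv ℝ r (x - y) (B x - B y)‖ + |r (x - y)| * |dvg B y| := by
                    rw [← abs_mul]; exact abs_add_le _ _
                _ ≤ (A * (ε ^ (k + 1))⁻¹ * ε⁻¹) * (L * (3 * ε)) + (A * (ε ^ (k + 1))⁻¹) * D := by
                    gcongr
                    · exact (ContinuousLinearMap.le_opNorm _ _).trans
                        (mul_le_mul (hrd _) e4 (norm_nonneg _) (by positivity))
                    · exact hrb _
                    · exact hD _
                _ = A * (3 * L + D) * (ε ^ (k + 1))⁻¹ := by field_simp
          · intro x y hxy
            obtain ⟨e2, e3⟩ := hr0 _ hxy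
            simp [e2, e3]
      · simp only [← integral_mul_translate_sub hg hr.continuous hrc hr1]
        exact ((contDiff_mollify hg hr hrc).continuous.measurable.aemeasurable.sub
          hg.1.aemeasurable).enorm
  choose w hw1 hw2 hw3 using main
  have hlim : Tendsto (fun p : ℕ => (p : ℝ≥0∞)⁻¹) atTop (𝓝 0) :=
    ENNReal.tendsto_inv_nat_nhds_zero
  refine ⟨w, hw1, tendsto_of_tendsto_of_tendsto_of_le_of_le tendsto_const_nhds hlim
    (fun _ => zero_le) hw2, tendsto_of_tendsto_of_tendsto_of_le_of_le tendsto_const_nhds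
    (by simpa using hlim.add hlim) (fun _ => zero_le) hw3⟩

end Fractured

end

/-! ### Chain rule and a weighted `L¹` trace estimate for smooth functions. -/

noncomputable section

namespace Fractured

open Filter Topology
open scoped ENNReal

/-- A smooth approximation of the absolute value. -/
def softAbs (η t : ℝ) : ℝ := √(t ^ 2 + η ^ 2) - η

lemma contDiff_softAbs {η : ℝ} (hη : 0 < η) : ContDiff ℝ 1 (softAbs η) := by
  refine ContDiff.sub (ContDiff.sqrt (by fun_prop) fun t => ?_) contDiff_const
  positivity

lemma softAbs_nonneg {η : ℝ} (t : ℝ) : 0 ≤ softAbs η t := by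
  have : η ≤ √(t ^ 2 + η ^ 2) := Real.le_sqrt_of_sq_le (by nlinarith [sq_nonneg t])
  simp only [softAbs]; linarith

lemma softAbs_le {η : ℝ} (hη : 0 < η) (t : ℝ) : softAbs η t ≤ |t| := by
  have : √(t ^ 2 + η ^ 2) ≤ |t| + η := by
    rw [Real.sqrt_le_left (by positivity)]
    nlinarith [sq_abs t, abs_nonneg t]
  simp only [softAbs]; linarith

lemma abs_le_softAbs {η : ℝ} (t : ℝ) : |t| ≤ softAbs η t + η := by
  have : |t| ≤ √(t ^ 2 + η ^ 2) := Real.abs_le_sqrt (by nlinarith [sq_nonneg η])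
  simp only [softAbs]; linarith

lemma abs_deriv_softAbs_le {η : ℝ} (hη : 0 < η) (t : ℝ) : |deriv (softAbs η) t| ≤ 1 := by
  have h0 : 0 < t ^ 2 + η ^ 2 := by positivity
  have h1 : HasDerivAt (fun t : ℝ => t ^ 2 + η ^ 2) (2 * t) t := by
    simpa using (hasDerivAt_pow 2 t).add_const (η ^ 2)
  have h2 := (h1.sqrt h0.ne').sub_const η
  have h3 : deriv (softAbs η) t = 2 * t / (2 * √(t ^ 2 + η ^ 2)) := h2.deriv
  rw [h3, mul_div_mul_left _ _ two_ne_zero, abs_div, abs_of_nonneg (Real.sqrt_nonneg _)]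
  exact div_le_one_of_le₀ (Real.abs_le_sqrt (by nlinarith [sq_nonneg η])) (Real.sqrt_nonneg _)

/-- Split `m p * a p` into `m p * b`, which converges by dominated convergence, and `m p * (a p -
b)`, which is at most `C` times the `L¹` distance of `a p` and `b`. -/
lemma tendsto_integral_bdd_mul {α : Type*} [MeasurableSpace α] {μ : Measure α} {a : ℕ → α → ℝ}
    {b : α → ℝ} {m : ℕ → α → ℝ} {m' : α → ℝ} {C : ℝ} (hb : Integrable b μ)
    (ha : ∀ p, AEStronglyMeasurable (a p) μ)
    (hm : ∀ p, AEStronglyMeasurable (m p) μ) (hC : ∀ p x, |m p x| ≤ C)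
    (hlim : ∀ᵐ x ∂μ, Tendsto (fun p => m p x) atTop (𝓝 (m' x)))
    (hab : Tendsto (fun p => ∫⁻ x, ‖a p x - b x‖ₑ ∂μ) atTop (𝓝 0)) :
    Tendsto (fun p => ∫ x, m p x * a p x ∂μ) atTop (𝓝 (∫ x, m' x * b x ∂μ)) := by
  have h1 : Tendsto (fun p => ∫ x, m p x * b x ∂μ) atTop (𝓝 (∫ x, m' x * b x ∂μ)) := by
    refine tendsto_integral_of_dominated_convergence (fun x => C * |b x|)
      (fun p => (hm p).mul hb.1) (hb.abs.const_mul C) (fun p => Eventually.of_forall fun x => ?_) ?_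
    · rw [norm_mul]
      exact mul_le_mul_of_nonneg_right (hC p x) (norm_nonneg _)
    · filter_upwards [hlim] with x hx using hx.mul_const _
  have h2 : Tendsto (fun p => ∫ x, m p x * (a p x - b x) ∂μ) atTop (𝓝 0) := by
    rw [tendsto_zero_iff_enorm_tendsto_zero]
    have h3 : Tendsto (fun p => ENNReal.ofReal C * ∫⁻ x, ‖a p x - b x‖ₑ ∂μ) atTop (𝓝 0) := by
      have := ENNReal.Tendsto.const_mul (a := ENNReal.ofReal C) hab (Or.inr ENNReal.ofReal_ne_top)
      simpa using this
    refine tendsto_of_tendsto_of_tendsto_of_le_of_le tendsto_const_nhds h3 (fun _ => zero_le)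
      fun p => ?_
    refine (enorm_integral_le_lintegral_enorm _).trans ?_
    rw [← lintegral_const_mul' _ _ ENNReal.ofReal_ne_top]
    refine lintegral_mono fun x => ?_
    rw [enorm_mul]
    gcongr
    rw [Real.enorm_eq_ofReal_abs]
    exact ENNReal.ofReal_le_ofReal (hC p x)
  -- The functions `a p` are not assumed to be integrable. They are as soon as their distance to `b`
  -- is finite.
  have h3 : ∀ᶠ p in atTop, ∫ x, m p x * a p x ∂μ
      = ∫ x, m p x * b x ∂μ + ∫ x, m p x * (a p x - b x) ∂μ := by
    have h4 : ∀ᶠ p in atTop, ∫⁻ x, ‖a p x - b x‖ₑ ∂μ < 1 :=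
      hab.eventually (gt_mem_nhds one_pos)
    filter_upwards [h4] with p hp
    have hi : Integrable (fun x => a p x - b x) μ :=
      ⟨(ha p).sub hb.1, hp.trans ENNReal.one_lt_top⟩
    rw [← integral_add (hb.bdd_mul (hm p) (Eventually.of_forall (hC p)))
      (hi.bdd_mul (hm p) (Eventually.of_forall (hC p)))]
    congr 1
    funext x
    ring
  have h5 := h1.add h2
  rw [add_zero] at h5
  exact h5.congr' (h3.mono fun p hp => hp.symm)

section Smooth

variable {k : ℕ} {B : E (k + 1) → E (k + 1)}

/-- Integration by parts for a function of a smooth function. -/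
lemma integral_upper_comp (hB : ContDiff ℝ 1 B) (hBc : HasCompactSupport B)
    {w h : E (k + 1) → ℝ} (hw : ContDiff ℝ 1 w) (hh : ContDiff ℝ 1 h) {q : ℝ → ℝ}
    (hq : ContDiff ℝ 1 q) :
    ∫ y in upper k, (deriv q (w y) * (fderiv ℝ w y (B y) * h y) +
        q (w y) * (fderiv ℝ h y (B y) + h y * dvg B y))
      = - ∫ z : E k, B (face k z) (Fin.last k) * (q (w (face k z)) * h (face k z)) := by
  have hc : HasCompactSupport fun y => (q (w y) * h y) • B y :=
    hBc.mono fun y hy h0 => hy (by simp [h0])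
  have h0 := integral_upper_by_parts (f := fun y => q (w y) * h y) ((hq.comp hw).mul hh) hB hc
  refine Eq.trans ?_ h0
  refine integral_congr_ae (Eventually.of_forall fun y => ?_)
  have h1 : HasFDerivAt (fun y => q (w y)) (deriv q (w y) • fderiv ℝ w y) y :=
    (hq.differentiable one_ne_zero (w y)).hasDerivAt.comp_hasFDerivAt y
      (hw.differentiable one_ne_zero y).hasFDerivAt
  have h2 := h1.mul (hh.differentiable one_ne_zero y).hasFDerivAt
  have h3 : fderiv ℝ (fun y => q (w y) * h y) y = _ := h2.fderiv
  simp only [h3, _root_.add_apply, _root_.smul_apply, smul_eq_mul]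
  ring

lemma continuous_fderiv_apply {m : ℕ} {w : E m → ℝ} {B : E m → E m} (hw : ContDiff ℝ 1 w)
    (hB : Continuous B) : Continuous fun y => fderiv ℝ w y (B y) :=
  (hw.continuous_fderiv one_ne_zero).clm_apply hB

lemma hasCompactSupport_fderiv_add (hBc : HasCompactSupport B) (h : E (k + 1) → ℝ) :
    HasCompactSupport fun y => fderiv ℝ h y (B y) + h y * dvg B y := by
  have h1 : HasCompactSupport fun y => fderiv ℝ h y (B y) :=
    hBc.mono fun y hy h0 => hy (by simp [h0])
  exact h1.add ((hasCompactSupport_dvg hBc).mul_left)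

lemma hasCompactSupport_face (hBc : HasCompactSupport B) :
    HasCompactSupport fun z : E k => B (face k z) (Fin.last k) := by
  have h1 : HasCompactSupport fun z : E k => B (face k z) :=
    hBc.comp_isClosedEmbedding (face k).isometry.isClosedEmbedding
  exact h1.mono fun z hz h0 => hz (by simp [h0])

/-- An `L¹` bound for the trace of smooth functions. -/
lemma lintegral_face_le (hB : ContDiff ℝ ∞ B) (hBc : HasCompactSupport B) :
    ∃ M : ℝ, ∀ w : E (k + 1) → ℝ, ContDiff ℝ 1 w →
      ∫⁻ z : E k, ‖B (face k z) (Fin.last k) ^ 2 * w (face k z)‖ₑ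
        ≤ ENNReal.ofReal M * ∫⁻ y in upper k, (‖fderiv ℝ w y (B y)‖ₑ + ‖w y‖ₑ) := by
  set b : E (k + 1) → ℝ := fun y => B y (Fin.last k) with hb
  have hbs : ContDiff ℝ ∞ b := (contDiff_euclidean.1 hB) (Fin.last k)
  have hb1 : ContDiff ℝ 1 b := hbs.of_le (by simp)
  have hB1 : ContDiff ℝ 1 B := hB.of_le (by simp)
  have hbc : HasCompactSupport b := hBc.mono fun y hy h0 => hy (by simp [hb, h0])
  obtain ⟨M₁, hM₁⟩ := hbc.exists_bound_of_continuous hb1.continuous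
  obtain ⟨M₂, hM₂⟩ := (hasCompactSupport_fderiv_add hBc b).exists_bound_of_continuous
    ((continuous_fderiv_apply hb1 hB1.continuous).add (hb1.continuous.mul (continuous_dvg hB1)))
  have hbf : HasCompactSupport fun z : E k => b (face k z) := hasCompactSupport_face hBc
  have hbfc : Continuous fun z : E k => b (face k z) :=
    hb1.continuous.comp (face k).continuous
  refine ⟨max M₁ M₂, fun w hw => ?_⟩
  have hwf : Continuous fun z : E k => w (face k z) := hw.continuous.comp (face k).continuous
  have hb2i : Integrable fun z : E k => b (face k z) ^ 2 := by
    refine (hbfc.pow 2).integrable_of_hasCompactSupport (hbf.mono fun z hz h0 => hz ?_)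
    simp [h0]
  have key : ∀ η : ℝ, 0 < η → ∫⁻ z : E k, ‖b (face k z) ^ 2 * w (face k z)‖ₑ
      ≤ ENNReal.ofReal (max M₁ M₂) * (∫⁻ y in upper k, (‖fderiv ℝ w y (B y)‖ₑ + ‖w y‖ₑ))
        + ENNReal.ofReal (η * ∫ z : E k, b (face k z) ^ 2) := by
    intro η hη
    have hs := contDiff_softAbs hη
    -- With `b` itself as the test function, the boundary integrand is `b²` times the smoothed
    -- absolute value of `w` and hence has a sign. The smoothing costs at most `η` times the
    -- integral of `b²`, which disappears as `η → 0`.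
    have hI := integral_upper_comp hB1 hBc hw hb1 hs
    have hsi : Integrable fun z : E k => b (face k z) * (softAbs η (w (face k z)) * b (face k z)) := by
      refine (hbfc.mul ((hs.continuous.comp hwf).mul hbfc)).integrable_of_hasCompactSupport
        (hbf.mono fun z hz h0 => hz ?_)
      simp [h0]
    have e1 : ∫⁻ z : E k, ‖b (face k z) ^ 2 * w (face k z)‖ₑ
        ≤ ∫⁻ z : E k, ENNReal.ofReal (b (face k z) * (softAbs η (w (face k z)) * b (face k z)) +
          η * b (face k z) ^ 2) := by
      refine lintegral_mono fun z => ?_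
      rw [Real.enorm_eq_ofReal_abs]
      refine ENNReal.ofReal_le_ofReal ?_
      rw [abs_mul, abs_of_nonneg (sq_nonneg _)]
      nlinarith [mul_le_mul_of_nonneg_left (abs_le_softAbs (η := η) (w (face k z)))
        (sq_nonneg (b (face k z)))]
    refine e1.trans ?_
    have hnn : ∀ z : E k, 0 ≤ b (face k z) * (softAbs η (w (face k z)) * b (face k z)) +
        η * b (face k z) ^ 2 := fun z => by
      have h2 := mul_nonneg (softAbs_nonneg (η := η) (w (face k z))) (sq_nonneg (b (face k z)))
      have h3 := mul_nonneg hη.le (sq_nonneg (b (face k z)))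
      nlinarith
    have e4 := ofReal_integral_eq_lintegral_ofReal (μ := volume)
      (f := fun z : E k => b (face k z) * (softAbs η (w (face k z)) * b (face k z)) +
        η * b (face k z) ^ 2) (hsi.add (hb2i.const_mul η)) (Eventually.of_forall hnn)
    rw [← e4]
    have e2 : ∫ z : E k, (b (face k z) * (softAbs η (w (face k z)) * b (face k z)) +
          η * b (face k z) ^ 2)
        = (∫ z : E k, b (face k z) * (softAbs η (w (face k z)) * b (face k z))) +
          η * ∫ z : E k, b (face k z) ^ 2 := by
      rw [integral_add hsi (hb2i.const_mul η), integral_const_mul]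
    rw [e2]
    refine ENNReal.ofReal_add_le.trans (add_le_add ?_ le_rfl)
    have e3 : ENNReal.ofReal (∫ z : E k, b (face k z) * (softAbs η (w (face k z)) * b (face k z)))
        ≤ ‖∫ y in upper k, (deriv (softAbs η) (w y) * (fderiv ℝ w y (B y) * b y) +
          softAbs η (w y) * (fderiv ℝ b y (B y) + b y * dvg B y))‖ₑ := by
      rw [hI, enorm_neg, Real.enorm_eq_ofReal_abs]
      exact ENNReal.ofReal_le_ofReal (le_abs_self _)
    refine e3.trans ((enorm_integral_le_lintegral_enorm _).trans ?_)
    rw [← lintegral_const_mul' _ _ ENNReal.ofReal_ne_top]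
    refine lintegral_mono fun y => ?_
    have hM0 : 0 ≤ max M₁ M₂ := ((norm_nonneg _).trans (hM₁ 0)).trans (le_max_left _ _)
    simp only [Real.enorm_eq_ofReal_abs]
    rw [← ENNReal.ofReal_add (abs_nonneg _) (abs_nonneg _), ← ENNReal.ofReal_mul hM0]
    refine ENNReal.ofReal_le_ofReal ((abs_add_le _ _).trans ?_)
    rw [mul_add (max M₁ M₂), abs_mul, abs_mul, abs_mul]
    have f1 := abs_deriv_softAbs_le hη (w y)
    have f2 : |b y| ≤ max M₁ M₂ := (hM₁ y).trans (le_max_left _ _)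
    have f3 : |fderiv ℝ b y (B y) + b y * dvg B y| ≤ max M₁ M₂ := (hM₂ y).trans (le_max_right _ _)
    have f4 : |softAbs η (w y)| ≤ |w y| := by
      rw [abs_of_nonneg (softAbs_nonneg _)]; exact softAbs_le hη _
    refine add_le_add ?_ ?_
    · calc |deriv (softAbs η) (w y)| * (|fderiv ℝ w y (B y)| * |b y|)
          ≤ 1 * (|fderiv ℝ w y (B y)| * max M₁ M₂) := by gcongr
        _ = _ := by ring
    · rw [mul_comm]
      gcongr
  have hlim : Tendsto (fun η : ℝ => ENNReal.ofReal (max M₁ M₂) *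
      (∫⁻ y in upper k, (‖fderiv ℝ w y (B y)‖ₑ + ‖w y‖ₑ))
        + ENNReal.ofReal (η * ∫ z : E k, b (face k z) ^ 2)) (𝓝[>] 0)
      (𝓝 (ENNReal.ofReal (max M₁ M₂) *
      (∫⁻ y in upper k, (‖fderiv ℝ w y (B y)‖ₑ + ‖w y‖ₑ)) + 0)) := by
    refine tendsto_const_nhds.add ?_
    have h1 : Tendsto (fun η : ℝ => η * ∫ z : E k, b (face k z) ^ 2) (𝓝[>] 0) (𝓝 0) := by
      have := (tendsto_id (α := ℝ) (x := 𝓝 0)).mul_const (∫ z : E k, b (face k z) ^ 2)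
      rw [zero_mul] at this
      exact this.mono_left nhdsWithin_le_nhds
    simpa using ENNReal.tendsto_ofReal h1
  rw [add_zero] at hlim
  exact ge_of_tendsto hlim (eventually_nhdsWithin_of_forall fun η hη => key η hη)

end Smooth

end Fractured

end

/-! ### Identification of the weak trace and renormalization in the half space. -/

noncomputable section

namespace Fractured

open Filter Topology
open scoped ENNReal

lemma exists_subseq_tendsto_ae {α : Type*} [MeasurableSpace α] {μ : Measure α} {f : ℕ → α → ℝ}
    {g : α → ℝ} (hf : ∀ p, AEStronglyMeasurable (f p) μ) (hg : AEStronglyMeasurable g μ)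
    (h : Tendsto (fun p => ∫⁻ x, ‖f p x - g x‖ₑ ∂μ) atTop (𝓝 0)) :
    ∃ ns : ℕ → ℕ, StrictMono ns ∧ ∀ᵐ x ∂μ, Tendsto (fun i => f (ns i) x) atTop (𝓝 (g x)) := by
  refine (tendstoInMeasure_of_tendsto_eLpNorm (p := 1) one_ne_zero hf hg ?_).exists_seq_tendsto_ae
  simpa [eLpNorm_one_eq_lintegral_enorm] using h

lemma exists_lintegral_tendsto_of_cauchy {α : Type*} [MeasurableSpace α] {μ : Measure α}
    {f : ℕ → α → ℝ} (hf : ∀ p, Integrable (f p) μ) {b : ℕ → ℝ≥0∞} (hb : Tendsto b atTop (𝓝 0))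
    (h : ∀ p q, ∫⁻ x, ‖f p x - f q x‖ₑ ∂μ ≤ b p + b q) :
    ∃ g, Integrable g μ ∧ Tendsto (fun p => ∫⁻ x, ‖f p x - g x‖ₑ ∂μ) atTop (𝓝 0) := by
  have hm : ∀ p, MemLp (f p) 1 μ := fun p => memLp_one_iff_integrable.2 (hf p)
  have hc : CauchySeq fun p => (hm p).toLp (f p) := by
    rw [EMetric.cauchySeq_iff]
    intro ε hε
    have h1 : ∀ᶠ p in atTop, b p < ε / 2 := hb.eventually (gt_mem_nhds (ENNReal.half_pos hε.ne'))
    obtain ⟨N, hN⟩ := eventually_atTop.1 h1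
    refine ⟨N, fun p hp q hq => ?_⟩
    rw [Lp.edist_toLp_toLp, eLpNorm_one_eq_lintegral_enorm]
    calc _ ≤ b p + b q := h p q
      _ < ε / 2 + ε / 2 := ENNReal.add_lt_add (hN p hp) (hN q hq)
      _ = ε := ENNReal.add_halves ε
  obtain ⟨g, hg⟩ := cauchySeq_tendsto_of_complete hc
  refine ⟨g, memLp_one_iff_integrable.1 (Lp.memLp g), ?_⟩
  rw [tendsto_iff_edist_tendsto_0] at hg
  refine hg.congr fun p => ?_
  rw [Lp.edist_def, eLpNorm_one_eq_lintegral_enorm]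
  refine lintegral_congr_ae ?_
  filter_upwards [(hm p).coeFn_toLp] with x hx
  simp [hx]

section Trace

variable {k : ℕ} {B : E (k + 1) → E (k + 1)} {v g : E (k + 1) → ℝ} {τ : E k → ℝ}

/-- Smooth approximations converge on the boundary to the trace. -/
lemma tendsto_trace (hB : ContDiff ℝ ∞ B) (hBc : HasCompactSupport B)
    (hv : IntegrableOn v (upper k)) (hg : IntegrableOn g (upper k))
    (hτ : Integrable fun z : E k => B (face k z) (Fin.last k) * τ z)
    (hid : ∀ h : E (k + 1) → ℝ, ContDiff ℝ ∞ h → HasCompactSupport h →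
      ∫ y in upper k, (g y * h y + v y * (fderiv ℝ h y (B y) + h y * dvg B y))
        = - ∫ z : E k, B (face k z) (Fin.last k) * τ z * h (face k z))
    {w : ℕ → E (k + 1) → ℝ} (hw : ∀ p, ContDiff ℝ ∞ (w p))
    (hwv : Tendsto (fun p => ∫⁻ x in upper k, ‖w p x - v x‖ₑ) atTop (𝓝 0))
    (hwg : Tendsto (fun p => ∫⁻ x in upper k, ‖fderiv ℝ (w p) x (B x) - g x‖ₑ) atTop (𝓝 0)) :
    Tendsto (fun p => ∫⁻ z : E k, ‖B (face k z) (Fin.last k) ^ 2 * w p (face k z) -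
      B (face k z) (Fin.last k) ^ 2 * τ z‖ₑ) atTop (𝓝 0) := by
  set b : E (k + 1) → ℝ := fun y => B y (Fin.last k) with hb
  have hbs : ContDiff ℝ ∞ b := (contDiff_euclidean.1 hB) (Fin.last k)
  have hb1 : ContDiff ℝ 1 b := hbs.of_le (by simp)
  have hB1 : ContDiff ℝ 1 B := hB.of_le (by simp)
  have hw1 : ∀ p, ContDiff ℝ 1 (w p) := fun p => (hw p).of_le (by simp)
  have hbf : HasCompactSupport fun z : E k => b (face k z) := hasCompactSupport_face hBc
  have hbfc : Continuous fun z : E k => b (face k z) := hb1.continuous.comp (face k).continuous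
  obtain ⟨M₁, hM₁⟩ := hbf.exists_bound_of_continuous hbfc
  have hwf : ∀ p, Continuous fun z : E k => w p (face k z) := fun p =>
    (hw p).continuous.comp (face k).continuous
  have hfi : ∀ p, Integrable fun z : E k => b (face k z) ^ 2 * w p (face k z) := fun p => by
    refine ((hbfc.pow 2).mul (hwf p)).integrable_of_hasCompactSupport (hbf.mono fun z hz h0 => hz ?_)
    simp [h0]
  obtain ⟨M, hM⟩ := lintegral_face_le (k := k) hB hBc
  -- The trace estimate, applied to differences of approximations, shows that the weighted boundary
  -- values form a Cauchy sequence in `L¹`. It remains to identify the limit.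
  set c : ℕ → ℝ≥0∞ := fun p => ENNReal.ofReal M *
    ((∫⁻ x in upper k, ‖fderiv ℝ (w p) x (B x) - g x‖ₑ) + ∫⁻ x in upper k, ‖w p x - v x‖ₑ) with hc
  have hc0 : Tendsto c atTop (𝓝 0) := by
    have := ENNReal.Tendsto.const_mul (a := ENNReal.ofReal M) (hwg.add hwv)
      (Or.inr ENNReal.ofReal_ne_top)
    simpa using this
  have hDm : ∀ p, AEStronglyMeasurable (fun x => fderiv ℝ (w p) x (B x))
      (volume.restrict (upper k)) := fun p =>
    (continuous_fderiv_apply (hw1 p) hB1.continuous).aestronglyMeasurable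
  have hcau : ∀ p q, ∫⁻ z : E k, ‖b (face k z) ^ 2 * w p (face k z) -
      b (face k z) ^ 2 * w q (face k z)‖ₑ ≤ c p + c q := by
    intro p q
    have h1 := hM (fun y => w p y - w q y) ((hw1 p).sub (hw1 q))
    simp only [mul_sub] at h1
    refine h1.trans ?_
    have e1 : ∫⁻ y in upper k, (‖fderiv ℝ (fun y => w p y - w q y) y (B y)‖ₑ + ‖w p y - w q y‖ₑ)
        ≤ ∫⁻ y in upper k, ((‖fderiv ℝ (w p) y (B y) - g y‖ₑ + ‖w p y - v y‖ₑ) +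
          (‖fderiv ℝ (w q) y (B y) - g y‖ₑ + ‖w q y - v y‖ₑ)) := by
      refine lintegral_mono fun y => ?_
      have e2 : fderiv ℝ (fun y => w p y - w q y) y = fderiv ℝ (w p) y - fderiv ℝ (w q) y :=
        fderiv_fun_sub ((hw1 p).differentiable one_ne_zero y)
          ((hw1 q).differentiable one_ne_zero y)
      rw [e2, _root_.sub_apply]
      have e3 : fderiv ℝ (w p) y (B y) - fderiv ℝ (w q) y (B y)
          = (fderiv ℝ (w p) y (B y) - g y) - (fderiv ℝ (w q) y (B y) - g y) := by ring
      have e4 : w p y - w q y = (w p y - v y) - (w q y - v y) := by ring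
      rw [e3, e4]
      refine (add_le_add enorm_sub_le enorm_sub_le).trans (le_of_eq ?_)
      ring
    refine (mul_le_mul_right e1 _).trans (le_of_eq ?_)
    have hm1 : ∀ p, AEMeasurable (fun y => ‖fderiv ℝ (w p) y (B y) - g y‖ₑ)
        (volume.restrict (upper k)) := fun p => ((hDm p).sub hg.1).enorm
    have hm2 : ∀ p, AEMeasurable (fun y => ‖w p y - v y‖ₑ)
        (volume.restrict (upper k)) := fun p =>
      ((hw p).continuous.aestronglyMeasurable.sub hv.1).enorm
    have hm3 : AEMeasurable (fun y => ‖fderiv ℝ (w p) y (B y) - g y‖ₑ + ‖w p y - v y‖ₑ)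
        (volume.restrict (upper k)) := (hm1 p).add (hm2 p)
    rw [lintegral_add_left' hm3, lintegral_add_left' (hm1 p),
      lintegral_add_left' (hm1 q), mul_add]
  obtain ⟨u, hu, hlim⟩ := exists_lintegral_tendsto_of_cauchy hfi hc0 hcau
  have hτ2 : Integrable fun z : E k => b (face k z) ^ 2 * τ z := by
    have := hτ.bdd_mul (c := M₁) hbfc.aestronglyMeasurable (Eventually.of_forall hM₁)
    refine this.congr (Eventually.of_forall fun z => ?_)
    simp only [hb]
    ring
  have huτ : ∀ᵐ z, u z = b (face k z) ^ 2 * τ z := by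
    refine ae_eq_of_integral_contDiff_smul_eq hu.locallyIntegrable hτ2.locallyIntegrable ?_
    intro ψ hψ hψc
    obtain ⟨Mψ, hMψ⟩ := hψc.exists_bound_of_continuous hψ.continuous
    -- `ψ` is extended constantly in the normal direction. The factor `b` restores the compact
    -- support and supplies the second power of `b` on the boundary.
    set H : E (k + 1) → ℝ := fun y => ψ (projl k.le_succ y) * b y with hH
    have hHs : ContDiff ℝ ∞ H := (hψ.comp (projl k.le_succ).contDiff).mul hbs
    have hHc : HasCompactSupport H := hBc.mono fun y hy h0 => hy (by simp [hH, hb, h0])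
    have hHf : ∀ z, H (face k z) = ψ z * b (face k z) := by
      intro z
      simp only [hH]
      rw [projl_incl]
    have hH1 : ContDiff ℝ 1 H := hHs.of_le (by simp)
    obtain ⟨C₁, hC₁⟩ := hHc.exists_bound_of_continuous hH1.continuous
    have hKc := (continuous_fderiv_apply hH1 hB1.continuous).add
      (hH1.continuous.mul (continuous_dvg hB1))
    obtain ⟨C₂, hC₂⟩ := (hasCompactSupport_fderiv_add hBc H).exists_bound_of_continuous hKc
    have t1 : Tendsto (fun p => ∫ y in upper k, H y * fderiv ℝ (w p) y (B y)) atTop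
        (𝓝 (∫ y in upper k, H y * g y)) :=
      tendsto_integral_bdd_mul (m := fun _ => H) hg hDm
        (fun _ => hH1.continuous.aestronglyMeasurable) (fun _ => hC₁)
        (Eventually.of_forall fun _ => tendsto_const_nhds) hwg
    have t2 : Tendsto (fun p => ∫ y in upper k, (fderiv ℝ H y (B y) + H y * dvg B y) * w p y) atTop
        (𝓝 (∫ y in upper k, (fderiv ℝ H y (B y) + H y * dvg B y) * v y)) :=
      tendsto_integral_bdd_mul (m := fun _ y => fderiv ℝ H y (B y) + H y * dvg B y) hv
        (fun p => (hw p).continuous.aestronglyMeasurable)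
        (fun _ => hKc.aestronglyMeasurable) (fun _ => hC₂)
        (Eventually.of_forall fun _ => tendsto_const_nhds) hwv
    have t3 : Tendsto (fun p => ∫ z, ψ z * (b (face k z) ^ 2 * w p (face k z))) atTop
        (𝓝 (∫ z, ψ z * u z)) :=
      tendsto_integral_bdd_mul (m := fun _ => ψ) hu (fun p => (hfi p).1)
        (fun _ => hψ.continuous.aestronglyMeasurable) (fun _ => hMψ)
        (Eventually.of_forall fun _ => tendsto_const_nhds) hlim
    have e1 : ∀ p, (∫ y in upper k, H y * fderiv ℝ (w p) y (B y)) +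
        ∫ y in upper k, (fderiv ℝ H y (B y) + H y * dvg B y) * w p y
        = - ∫ z, ψ z * (b (face k z) ^ 2 * w p (face k z)) := by
      intro p
      have h1 := integral_upper_comp hB1 hBc (hw1 p) hH1 (q := id) contDiff_id
      rw [← integral_add]
      · refine Eq.trans (integral_congr_ae (Eventually.of_forall fun y => ?_)) (h1.trans ?_)
        · simp; ring
        · congr 1
          refine integral_congr_ae (Eventually.of_forall fun z => ?_)
          simp only [hHf, id, hb]
          ring
      · refine Integrable.integrableOn ((hH1.continuous.mul (continuous_fderiv_apply (hw1 p)
          hB1.continuous)).integrable_of_hasCompactSupport hHc.mul_right)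
      · exact Integrable.integrableOn ((hKc.mul (hw p).continuous).integrable_of_hasCompactSupport
          (hasCompactSupport_fderiv_add hBc H).mul_right)
    have e2 : (∫ y in upper k, H y * g y) +
        ∫ y in upper k, (fderiv ℝ H y (B y) + H y * dvg B y) * v y
        = - ∫ z, ψ z * (b (face k z) ^ 2 * τ z) := by
      rw [← integral_add]
      · refine Eq.trans (integral_congr_ae (Eventually.of_forall fun y => ?_))
          ((hid H hHs hHc).trans ?_)
        · simp only; ring
        · congr 1
          refine integral_congr_ae (Eventually.of_forall fun z => ?_)
          simp only [hHf, hb]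
          ring
      · exact hg.bdd_mul hH1.continuous.aestronglyMeasurable (Eventually.of_forall hC₁)
      · exact hv.bdd_mul hKc.aestronglyMeasurable (Eventually.of_forall hC₂)
    have t4 := (t1.add t2)
    simp only [e1, e2] at t4
    have := tendsto_nhds_unique t4 t3.neg
    simp only [smul_eq_mul]
    linarith
  refine hlim.congr fun p => lintegral_congr_ae ?_
  filter_upwards [huτ] with z hz
  rw [hz]

/-- Renormalization in the half space. -/
theorem flat_renormalization (hB : ContDiff ℝ ∞ B) (hBc : HasCompactSupport B)
    (hv : IntegrableOn v (upper k)) (hg : IntegrableOn g (upper k))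
    (hτ : Integrable fun z : E k => B (face k z) (Fin.last k) * τ z)
    (hid : ∀ h : E (k + 1) → ℝ, ContDiff ℝ ∞ h → HasCompactSupport h →
      ∫ y in upper k, (g y * h y + v y * (fderiv ℝ h y (B y) + h y * dvg B y))
        = - ∫ z : E k, B (face k z) (Fin.last k) * τ z * h (face k z))
    {q : ℝ → ℝ} (hq : ContDiff ℝ 1 q) {C C' : ℝ} (hqC : ∀ t, |q t| ≤ C)
    (hqC' : ∀ t, |deriv q t| ≤ C') {h : E (k + 1) → ℝ} (hh : ContDiff ℝ 1 h)
    (hhc : HasCompactSupport h) :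
    ∫ y in upper k, (deriv q (v y) * g y * h y +
        q (v y) * (fderiv ℝ h y (B y) + h y * dvg B y))
      = - ∫ z : E k, B (face k z) (Fin.last k) * q (τ z) * h (face k z) := by
  have hB1 : ContDiff ℝ 1 B := hB.of_le (by simp)
  set b : E (k + 1) → ℝ := fun y => B y (Fin.last k) with hb
  have hb1 : ContDiff ℝ 1 b := (contDiff_euclidean.1 hB1) (Fin.last k)
  have hbf : HasCompactSupport fun z : E k => b (face k z) := hasCompactSupport_face hBc
  have hbfc : Continuous fun z : E k => b (face k z) := hb1.continuous.comp (face k).continuous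
  have hhf : Continuous fun z : E k => h (face k z) := hh.continuous.comp (face k).continuous
  have hq' : Continuous (deriv q) := hq.continuous_deriv le_rfl
  -- Extension by zero is harmless: for test functions supported in the open half space the boundary
  -- term is zero and nothing outside is seen.
  obtain ⟨w, hw, hwv', hwg'⟩ := exists_smooth_approx (v := (upper k).indicator v)
    (g := (upper k).indicator g) (hv.integrable_indicator (measurableSet_upper k))
    (hg.integrable_indicator (measurableSet_upper k)) hB1 hBc (by
      intro h hh hhc hhu
      have h1 := hid h hh hhc
      have h2 : ∀ z : E k, h (face k z) = 0 := by
        intro z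
        apply image_eq_zero_of_notMem_tsupport
        intro hz
        have h4 : 0 < (face k z) (Fin.last k) := hhu hz
        simp at h4
      simp only [h2, mul_zero, integral_zero, neg_zero] at h1
      rw [← h1, ← integral_indicator (measurableSet_upper k)]
      congr 1
      funext y
      by_cases hy : y ∈ upper k <;> simp [hy])
  have hw1 : ∀ p, ContDiff ℝ 1 (w p) := fun p => (hw p).of_le (by simp)
  have hwv : Tendsto (fun p => ∫⁻ x in upper k, ‖w p x - v x‖ₑ) atTop (𝓝 0) := by
    refine tendsto_of_tendsto_of_tendsto_of_le_of_le tendsto_const_nhds hwv' (fun _ => zero_le)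
      fun p => ?_
    refine le_trans (le_of_eq ?_) (lintegral_mono' (Measure.restrict_le_self (s := upper k)) le_rfl)
    refine setLIntegral_congr_fun (measurableSet_upper k) fun x hx => ?_
    simp [indicator_of_mem hx]
  have hwg : Tendsto (fun p => ∫⁻ x in upper k, ‖fderiv ℝ (w p) x (B x) - g x‖ₑ) atTop (𝓝 0) := by
    refine hwg'.congr fun p => ?_
    refine setLIntegral_congr_fun (measurableSet_upper k) fun x hx => ?_
    simp [indicator_of_mem hx]
  have hτ2 : AEStronglyMeasurable (fun z : E k => b (face k z) ^ 2 * τ z) volume := by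
    refine (hbfc.aestronglyMeasurable.mul hτ.1).congr (Eventually.of_forall fun z => ?_)
    simp only [Pi.mul_apply, hb]
    ring
  obtain ⟨ns, hns, hnv⟩ := exists_subseq_tendsto_ae
    (fun p => (hw p).continuous.aestronglyMeasurable) hv.1 hwv
  have htr := tendsto_trace hB hBc hv hg hτ hid (w := fun i => w (ns i)) (fun i => hw _)
    (hwv.comp hns.tendsto_atTop) (hwg.comp hns.tendsto_atTop)
  -- A further subsequence gives convergence almost everywhere on the boundary too, along the same
  -- approximations that converge inside.
  obtain ⟨ms, hms, hmτ⟩ := exists_subseq_tendsto_ae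
    (fun p => ((hbfc.pow 2).mul
      ((hw (ns p)).continuous.comp (face k).continuous)).aestronglyMeasurable) hτ2 htr
  set W : ℕ → E (k + 1) → ℝ := fun i => w (ns (ms i)) with hW
  have hWv : ∀ᵐ x ∂(volume.restrict (upper k)), Tendsto (fun i => W i x) atTop (𝓝 (v x)) := by
    filter_upwards [hnv] with x hx using hx.comp hms.tendsto_atTop
  have hW1 : ∀ i, ContDiff ℝ 1 (W i) := fun i => hw1 _
  -- The convergence with weight `b²` determines the limit only where `b ≠ 0`. Elsewhere the
  -- boundary integrand is zero.
  have hWτ : ∀ᵐ z : E k, b (face k z) = 0 ∨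
      Tendsto (fun i => W i (face k z)) atTop (𝓝 (τ z)) := by
    filter_upwards [hmτ] with z hz
    by_cases h0 : b (face k z) = 0
    · exact Or.inl h0
    · right
      have h2 : b (face k z) ^ 2 ≠ 0 := pow_ne_zero 2 h0
      have h3 := hz.const_mul (b (face k z) ^ 2)⁻¹
      have h5 : ∀ a : ℝ, (b (face k z) ^ 2)⁻¹ * (b (face k z) ^ 2 * a) = a := fun a =>
        inv_mul_cancel_left₀ h2 a
      refine (h5 (τ z) ▸ h3).congr fun i => ?_
      exact h5 _
  have hKc := (continuous_fderiv_apply hh hB1.continuous).add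
    (hh.continuous.mul (continuous_dvg hB1))
  have hKi : Integrable (fun y => fderiv ℝ h y (B y) + h y * dvg B y) :=
    hKc.integrable_of_hasCompactSupport (hasCompactSupport_fderiv_add hBc h)
  obtain ⟨Ch, hCh⟩ := hhc.exists_bound_of_continuous hh.continuous
  have hC0 : 0 ≤ C := (abs_nonneg _).trans (hqC 0)
  have hC'0 : 0 ≤ C' := (abs_nonneg _).trans (hqC' 0)
  have hqW : ∀ i, Continuous fun y => q (W i y) := fun i => hq.continuous.comp (hW1 i).continuous
  have hqW' : ∀ i, Continuous fun y => deriv q (W i y) := fun i => hq'.comp (hW1 i).continuous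
  have t1 : Tendsto (fun i => ∫ y in upper k, (deriv q (W i y) * h y) * fderiv ℝ (W i) y (B y)) atTop
      (𝓝 (∫ y in upper k, (deriv q (v y) * h y) * g y)) := by
    refine tendsto_integral_bdd_mul (C := C' * Ch) hg
      (fun i => (continuous_fderiv_apply (hW1 i) hB1.continuous).aestronglyMeasurable)
      (fun i => ((hqW' i).mul hh.continuous).aestronglyMeasurable) (fun i y => ?_) ?_
      (hwg.comp (hns.comp hms).tendsto_atTop)
    · rw [abs_mul]
      exact mul_le_mul (hqC' _) (hCh y) (abs_nonneg _) hC'0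
    · filter_upwards [hWv] with x hx
      exact ((hq'.tendsto _).comp hx).mul_const _
  have t2 : Tendsto (fun i => ∫ y in upper k, q (W i y) * (fderiv ℝ h y (B y) + h y * dvg B y)) atTop
      (𝓝 (∫ y in upper k, q (v y) * (fderiv ℝ h y (B y) + h y * dvg B y))) := by
    refine tendsto_integral_bdd_mul (a := fun _ y => fderiv ℝ h y (B y) + h y * dvg B y)
      hKi.integrableOn (fun i => hKc.aestronglyMeasurable)
      (fun i => (hqW i).aestronglyMeasurable) (fun i y => hqC _) ?_ (by simp)
    filter_upwards [hWv] with x hx using (hq.continuous.tendsto _).comp hx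
  have t3 : Tendsto (fun i => ∫ z : E k, b (face k z) * (q (W i (face k z)) * h (face k z))) atTop
      (𝓝 (∫ z : E k, b (face k z) * q (τ z) * h (face k z))) := by
    refine tendsto_integral_of_dominated_convergence
      (fun z => C * ‖b (face k z) * h (face k z)‖) (fun i => ?_) ?_ (fun i => ?_) ?_
    · exact (hbfc.mul (((hqW i).comp (face k).continuous).mul hhf)).aestronglyMeasurable
    · exact ((hbfc.mul hhf).integrable_of_hasCompactSupport hbf.mul_right).norm.const_mul C
    · refine Eventually.of_forall fun z => ?_
      have e : b (face k z) * (q (W i (face k z)) * h (face k z))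
        = q (W i (face k z)) * (b (face k z) * h (face k z)) := by ring
      rw [e, norm_mul]
      exact mul_le_mul_of_nonneg_right (hqC _) (norm_nonneg _)
    · filter_upwards [hWτ] with z hz
      rcases hz with hz | hz
      · simp [hz]
      · have := ((hq.continuous.tendsto _).comp hz)
        have h4 := (this.mul_const (h (face k z))).const_mul (b (face k z))
        rw [mul_assoc]
        exact h4
  have e1 : ∀ i, (∫ y in upper k, (deriv q (W i y) * h y) * fderiv ℝ (W i) y (B y)) +
      ∫ y in upper k, q (W i y) * (fderiv ℝ h y (B y) + h y * dvg B y)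
      = - ∫ z : E k, b (face k z) * (q (W i (face k z)) * h (face k z)) := by
    intro i
    rw [← integral_upper_comp hB1 hBc (hW1 i) hh hq, ← integral_add]
    · refine integral_congr_ae (Eventually.of_forall fun y => ?_)
      simp only; ring
    · refine Integrable.integrableOn (Continuous.integrable_of_hasCompactSupport
        (((hqW' i).mul hh.continuous).mul (continuous_fderiv_apply (hW1 i) hB1.continuous)) ?_)
      exact hhc.mul_left.mul_right
    · exact (hKi.bdd_mul (hqW i).aestronglyMeasurable
        (Eventually.of_forall fun y => hqC _)).integrableOn
  have hqv : AEStronglyMeasurable (fun y => q (v y)) (volume.restrict (upper k)) :=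
    hq.continuous.comp_aestronglyMeasurable hv.1
  have hqv' : AEStronglyMeasurable (fun y => deriv q (v y)) (volume.restrict (upper k)) :=
    hq'.comp_aestronglyMeasurable hv.1
  have t4 := t1.add t2
  simp only [e1] at t4
  have e2 := tendsto_nhds_unique t4 t3.neg
  rw [← integral_add] at e2
  · rw [← e2]
    refine integral_congr_ae (Eventually.of_forall fun y => ?_)
    simp only; ring
  · refine hg.bdd_mul (c := C' * Ch) (hqv'.mul hh.continuous.aestronglyMeasurable)
      (Eventually.of_forall fun y => ?_)
    rw [norm_mul]
    exact mul_le_mul (hqC' _) (hCh y) (abs_nonneg _) hC'0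
  · exact hKi.integrableOn.bdd_mul hqv (Eventually.of_forall fun y => hqC _)

end Trace

end Fractured

end

/-! ### Localization to an open subset of the half space. -/

noncomputable section

namespace Fractured

open Filter Topology
open scoped ENNReal

lemma exists_cutoff {m : ℕ} {K U : Set (E m)} (hK : IsCompact K) (hU : IsOpen U) (hKU : K ⊆ U) :
    ∃ χ : E m → ℝ, ContDiff ℝ ∞ χ ∧ HasCompactSupport χ ∧ tsupport χ ⊆ U ∧
      (∀ᶠ x in 𝓝ˢ K, χ x = 1) ∧ ∀ x, χ x ∈ Icc (0 : ℝ) 1 := by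
  obtain ⟨L, hL, hKL, hLU⟩ := exists_compact_between hK hU hKU
  obtain ⟨f, hf1, hf0, hf⟩ := exists_contMDiffMap_one_nhds_of_subset_interior
    (n := (⊤ : ℕ∞)) (modelWithCornersSelf ℝ (E m)) hK.isClosed hKL
  have hsub : tsupport f ⊆ L := closure_minimal (fun x hx => by
    by_contra h
    exact hx (hf0 x h)) hL.isClosed
  exact ⟨f, f.contMDiff.contDiff, HasCompactSupport.of_support_subset_isCompact hL
    (subset_closure.trans hsub), hsub.trans hLU, hf1, hf⟩

lemma contDiff_of_tsupport_subset {m : ℕ} {F : Type*} [NormedAddCommGroup F] [NormedSpace ℝ F]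
    {f : E m → F} {U : Set (E m)} {n : WithTop ℕ∞} (hU : IsOpen U) (hf : ContDiffOn ℝ n f U)
    (hs : tsupport f ⊆ U) : ContDiff ℝ n f := by
  rw [contDiff_iff_contDiffAt]
  intro x
  by_cases hx : x ∈ tsupport f
  · exact hf.contDiffAt (hU.mem_nhds (hs hx))
  · have : f =ᶠ[𝓝 x] fun _ => 0 := notMem_tsupport_iff_eventuallyEq.1 hx
    exact contDiffAt_const.congr_of_eventuallyEq this

lemma fderiv_eq_zero_of_notMem_tsupport {m : ℕ} {F : Type*} [NormedAddCommGroup F]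
    [NormedSpace ℝ F] {f : E m → F} {x : E m} (hx : x ∉ tsupport f) : fderiv ℝ f x = 0 := by
  by_contra h
  exact hx (support_fderiv_subset ℝ h)

lemma tsupport_smul_subset' {m : ℕ} {F : Type*} [NormedAddCommGroup F] [NormedSpace ℝ F]
    (χ : E m → ℝ) (B : E m → F) : tsupport (fun y => χ y • B y) ⊆ tsupport χ :=
  closure_mono fun y hy h0 => hy (by simp [h0])

/-- Renormalization in an open subset of the half space. -/
theorem flat_renormalization_on {k : ℕ} {U : Set (E (k + 1))} (hU : IsOpen U)
    {B : E (k + 1) → E (k + 1)} {v g : E (k + 1) → ℝ} {τ : E k → ℝ}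
    (hB : ContDiffOn ℝ ∞ B U)
    (hv : IntegrableOn v (U ∩ upper k)) (hg : IntegrableOn g (U ∩ upper k))
    (hτ : IntegrableOn (fun z : E k => B (face k z) (Fin.last k) * τ z) (face k ⁻¹' U))
    (hid : ∀ h : E (k + 1) → ℝ, ContDiff ℝ ∞ h → HasCompactSupport h → tsupport h ⊆ U →
      ∫ y in U ∩ upper k, (g y * h y + v y * (fderiv ℝ h y (B y) + h y * dvg B y))
        = - ∫ z in face k ⁻¹' U, B (face k z) (Fin.last k) * τ z * h (face k z))
    {q : ℝ → ℝ} (hq : ContDiff ℝ 1 q) {C C' : ℝ} (hqC : ∀ t, |q t| ≤ C)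
    (hqC' : ∀ t, |deriv q t| ≤ C') {h : E (k + 1) → ℝ} (hh : ContDiff ℝ 1 h)
    (hhc : HasCompactSupport h) (hhU : tsupport h ⊆ U) :
    ∫ y in U ∩ upper k, (deriv q (v y) * g y * h y +
        q (v y) * (fderiv ℝ h y (B y) + h y * dvg B y))
      = - ∫ z in face k ⁻¹' U, B (face k z) (Fin.last k) * q (τ z) * h (face k z) := by
  -- The field `χ • B` is smooth with compact support in the whole space and equals `B` near the
  -- support of `h`. The derivative of `v` along it is `χ * g`.
  obtain ⟨χ, hχ, hχc, hχU, hχ1, hχI⟩ := exists_cutoff hhc hU hhU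
  have hχ1' : ContDiff ℝ 1 χ := hχ.of_le (by simp)
  set B' : E (k + 1) → E (k + 1) := fun y => χ y • B y with hB'
  have hB's : ContDiff ℝ ∞ B' := contDiff_of_tsupport_subset hU
    (hχ.contDiffOn.smul hB) ((tsupport_smul_subset' χ B).trans hχU)
  have hB'c : HasCompactSupport B' := hχc.smul_right
  have hUm := hU.measurableSet
  have hFm : MeasurableSet (face k ⁻¹' U) := hUm.preimage (face k).continuous.measurable
  have hdB : ∀ y ∈ U, DifferentiableAt ℝ B y := fun y hy =>
    (hB.contDiffAt (hU.mem_nhds hy)).differentiableAt (by simp)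
  have hdvg : ∀ y ∈ U, dvg B' y = fderiv ℝ χ y (B y) + χ y * dvg B y := fun y hy =>
    dvg_smul (hχ.differentiable (by simp) y) (hdB y hy)
  have hχb : ∀ y, ‖χ y‖ ≤ 1 := fun y => by
    rw [Real.norm_eq_abs, abs_of_nonneg (hχI y).1]; exact (hχI y).2
  have hχ0 : ∀ y ∉ U, χ y = 0 := fun y hy =>
    image_eq_zero_of_notMem_tsupport fun h' => hy (hχU h')
  have hIU : ∀ f : E (k + 1) → ℝ, (∀ y ∉ U, f y = 0) →
      ∫ y in upper k, f y = ∫ y in U ∩ upper k, f y := by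
    intro f hf
    rw [inter_comm]
    refine (setIntegral_eq_of_subset_of_forall_sdiff_eq_zero (measurableSet_upper k)
      inter_subset_left ?_)
    rintro y ⟨hy1, hy2⟩
    exact hf y fun h' => hy2 ⟨hy1, h'⟩
  have hIF : ∀ f : E k → ℝ, (∀ z, face k z ∉ U → f z = 0) →
      ∫ z, f z = ∫ z in face k ⁻¹' U, f z := fun f hf =>
    (setIntegral_eq_integral_of_forall_compl_eq_zero fun z hz => hf z hz).symm
  have hflat := flat_renormalization (v := U.indicator v) (g := fun y => χ y * U.indicator g y)
    (τ := τ) hB's hB'c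
    (by
      have : IntegrableOn v (upper k ∩ U) := by rwa [inter_comm]
      rw [IntegrableOn, integrable_indicator_iff hUm, IntegrableOn,
        Measure.restrict_restrict hUm]
      exact hv)
    (by
      refine Integrable.bdd_mul (c := 1) ?_ hχ.continuous.aestronglyMeasurable
        (Eventually.of_forall hχb)
      rw [integrable_indicator_iff hUm, IntegrableOn, Measure.restrict_restrict hUm]
      exact hg)
    (by
      have h1 : Integrable (fun z : E k => χ (face k z) *
          (face k ⁻¹' U).indicator (fun z : E k => B (face k z) (Fin.last k) * τ z) z) := by
        refine Integrable.bdd_mul (c := 1) (hτ.integrable_indicator hFm)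
          (hχ.continuous.comp (face k).continuous).aestronglyMeasurable
          (Eventually.of_forall fun z => hχb _)
      refine h1.congr (Eventually.of_forall fun z => ?_)
      by_cases hz : face k z ∈ U
      · have hz' : z ∈ face k ⁻¹' U := hz
        simp only [indicator_of_mem hz', hB', PiLp.smul_apply, smul_eq_mul]
        ring
      · simp [hB', hχ0 _ hz])
    (by
      intro h' hh' hhc'
      have hd' : ∀ y, DifferentiableAt ℝ h' y := hh'.differentiable (by simp)
      have hts : tsupport (fun y => χ y * h' y) ⊆ tsupport χ := tsupport_smul_subset' χ h'
      -- Testing with `h'` for the field `χ • B` is testing with `χ * h'` for `B`, because `h' • (χ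
      -- • B) = (χ * h') • B`.
      have h1 := hid (fun y => χ y * h' y) (hχ.mul hh') hχc.mul_right (hts.trans hχU)
      rw [hIU _ (fun y hy => by simp [hχ0 y hy, hy]), hIF _ (fun z hz => by simp [hB', hχ0 _ hz])]
      refine Eq.trans (setIntegral_congr_fun (hUm.inter (measurableSet_upper k)) fun y hy => ?_)
        (h1.trans ?_)
      · have e : fderiv ℝ (fun y => χ y * h' y) y
            = χ y • fderiv ℝ h' y + h' y • fderiv ℝ χ y :=
          fderiv_fun_mul (hχ.differentiable (by simp) y) (hd' y)
        have e5 : B' y = χ y • B y := rfl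
        simp only [indicator_of_mem hy.1, hdvg y hy.1, e5, e, map_smul, _root_.add_apply,
          _root_.smul_apply, smul_eq_mul]
        ring
      · congr 1
        refine setIntegral_congr_fun hFm fun z hz => ?_
        simp only [hB', PiLp.smul_apply, smul_eq_mul]
        ring)
    hq hqC hqC' hh hhc
  have hh0 : ∀ y ∉ U, h y = 0 := fun y hy =>
    image_eq_zero_of_notMem_tsupport fun h' => hy (hhU h')
  have hdh0 : ∀ y ∉ U, fderiv ℝ h y = 0 := fun y hy =>
    fderiv_eq_zero_of_notMem_tsupport fun h' => hy (hhU h')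
  rw [hIU _ (fun y hy => by simp [hh0 y hy, hdh0 y hy]),
    hIF _ (fun z hz => by simp [hh0 _ hz])] at hflat
  refine Eq.trans (setIntegral_congr_fun (hUm.inter (measurableSet_upper k)) fun y hy => ?_)
        (hflat.trans ?_)
  · simp only [indicator_of_mem hy.1]
    by_cases hyh : y ∈ tsupport h
    · have e1 : χ =ᶠ[𝓝 y] fun _ => 1 := hχ1.filter_mono (nhds_le_nhdsSet hyh)
      have e2 : χ y = 1 := e1.eq_of_nhds
      have e3 : fderiv ℝ χ y = 0 := by rw [e1.fderiv_eq]; simp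
      have e5 : B' y = χ y • B y := rfl
      simp [hdvg y hy.1, e5, e2, e3]
    · simp [image_eq_zero_of_notMem_tsupport hyh, fderiv_eq_zero_of_notMem_tsupport hyh]
  · congr 1
    refine setIntegral_congr_fun hFm fun z hz => ?_
    by_cases hyh : face k z ∈ tsupport h
    · have e1 : χ =ᶠ[𝓝 (face k z)] fun _ => 1 := hχ1.filter_mono (nhds_le_nhdsSet hyh)
      have e2 : χ (face k z) = 1 := e1.eq_of_nhds
      simp [hB', e2]
    · simp [image_eq_zero_of_notMem_tsupport hyh]

end Fractured

end

/-! ### The area formula for the Hausdorff measure. -/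

noncomputable section

namespace Fractured

open Filter Topology
open scoped ENNReal NNReal

/-- The Jacobian of a map into a higher dimensional space. -/
def jac {d n : ℕ} (Ψ : E d → E n) (y : E d) : ℝ :=
  LinearMap.normDet (fderiv ℝ Ψ y : E d →ₗ[ℝ] E n)

lemma jac_nonneg {d n : ℕ} (Ψ : E d → E n) (y : E d) : 0 ≤ jac Ψ y := LinearMap.normDet_nonneg _

/-- The square is a Gram determinant and hence polynomial in the entries of `A`. The Jacobian is its
square root, which is smooth where `A` is injective. All smoothness of `jac` is derived in this way.
-/
lemma normDet_sq_eq {d n : ℕ} (A : E d →L[ℝ] E n) :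
    LinearMap.normDet (A : E d →ₗ[ℝ] E n) ^ 2 = Matrix.det (Matrix.of fun i j : Fin d =>
      inner ℝ (A (EuclideanSpace.single i 1)) (A (EuclideanSpace.single j 1))) := by
  have h := LinearMap.normDet_sq_eq_det_gram (A : E d →ₗ[ℝ] E n)
    (EuclideanSpace.basisFun (Fin d) ℝ)
  simpa [Matrix.gram] using h

lemma contDiff_matrix_det {d : ℕ} {X : Type*} [NormedAddCommGroup X] [NormedSpace ℝ X]
    {m : WithTop ℕ∞} {f : Fin d → Fin d → X → ℝ} (hf : ∀ i j, ContDiff ℝ m (f i j)) :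
    ContDiff ℝ m fun x => Matrix.det (Matrix.of fun i j => f i j x) := by
  simp only [Matrix.det_apply]
  refine ContDiff.sum fun σ _ => ?_
  refine ContDiff.const_smul _ ?_
  refine contDiff_prod fun i _ => ?_
  exact hf _ _

lemma contDiff_normDet_sq {d n : ℕ} {m : WithTop ℕ∞} :
    ContDiff ℝ m fun A : E d →L[ℝ] E n => LinearMap.normDet (A : E d →ₗ[ℝ] E n) ^ 2 := by
  simp only [normDet_sq_eq]
  refine contDiff_matrix_det fun i j => ?_
  exact ContDiff.inner ℝ (contDiff_id.clm_apply contDiff_const)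
    (contDiff_id.clm_apply contDiff_const)

lemma normDet_pos {d n : ℕ} {A : E d →L[ℝ] E n} (hA : Function.Injective A) :
    0 < LinearMap.normDet (A : E d →ₗ[ℝ] E n) :=
  (LinearMap.normDet_nonneg _).lt_of_ne'
    (((A : E d →ₗ[ℝ] E n).normDet_ne_zero_tfae.out 4 0).1 hA)

lemma contDiffOn_jac {d n : ℕ} {U : Set (E d)} (hU : IsOpen U) {Ψ : E d → E n} {m : ℕ∞}
    (hΨ : ContDiffOn ℝ (m + 1) Ψ U) (hinj : ∀ y ∈ U, Function.Injective (fderiv ℝ Ψ y)) :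
    ContDiffOn ℝ m (jac Ψ) U := by
  have h1 : ContDiffOn ℝ m (fderiv ℝ Ψ) U := hΨ.fderiv_of_isOpen hU le_rfl
  have h2 : ContDiffOn ℝ m (fun y => jac Ψ y ^ 2) U := contDiff_normDet_sq.comp_contDiffOn h1
  have h3 := h2.sqrt (fun y hy => (pow_pos (normDet_pos (hinj y hy)) 2).ne')
  refine h3.congr fun y _ => ?_
  rw [Real.sqrt_sq (jac_nonneg _ _)]

/-- The hypothesis makes `f₁` a `K`-Lipschitz function of `f₂`. No inverse needs to be given and no
measurability of `s` is needed, which allows comparing a map with its linearization. -/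
lemma muHE_image_le_of_dist_le {d m n : ℕ} {X : Type*} {f₁ : X → E n} {f₂ : X → E m} {s : Set X} {K : ℝ≥0}
    (h : ∀ x ∈ s, ∀ y ∈ s, dist (f₁ x) (f₁ y) ≤ K * dist (f₂ x) (f₂ y)) :
    (μHE[d] : Measure (E n)) (f₁ '' s) ≤ (K : ℝ≥0∞) ^ d * (μHE[d] : Measure (E m)) (f₂ '' s) := by
  classical
  rcases s.eq_empty_or_nonempty with rfl | ⟨x₀, _⟩
  · simp
  have : Nonempty X := ⟨x₀⟩
  set g : E m → E n := fun z => f₁ (Function.invFunOn f₂ s z) with hg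
  have hinv : ∀ z ∈ f₂ '' s, Function.invFunOn f₂ s z ∈ s ∧ f₂ (Function.invFunOn f₂ s z) = z :=
    fun z hz => ⟨Function.invFunOn_mem hz, Function.invFunOn_eq hz⟩
  have hL : LipschitzOnWith K g (f₂ '' s) := by
    refine LipschitzOnWith.of_dist_le_mul fun z hz z' hz' => ?_
    have h1 := h _ (hinv z hz).1 _ (hinv z' hz').1
    rwa [(hinv z hz).2, (hinv z' hz').2] at h1
  have himg : f₁ '' s ⊆ g '' (f₂ '' s) := by
    rintro _ ⟨x, hx, rfl⟩
    refine ⟨f₂ x, mem_image_of_mem _ hx, ?_⟩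
    have hz := hinv (f₂ x) (mem_image_of_mem _ hx)
    have h1 := h _ hz.1 _ hx
    rw [hz.2, dist_self, mul_zero] at h1
    exact dist_le_zero.1 h1
  refine (measure_mono himg).trans ?_
  have h1 := hL.hausdorffMeasure_image_le (d := d) (Nat.cast_nonneg d)
  rw [ENNReal.rpow_natCast] at h1
  simp only [Measure.euclideanHausdorffMeasure_def, Measure.smul_apply, ENNReal.smul_def, smul_eq_mul]
  rw [mul_left_comm]
  gcongr

lemma muHE_image_linear {d n : ℕ} (A : E d →L[ℝ] E n) (s : Set (E d)) :
    (μHE[d] : Measure (E n)) (A '' s) =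
      ENNReal.ofReal (LinearMap.normDet (A : E d →ₗ[ℝ] E n)) * volume s := by
  have := LinearMap.euclideanHausdorffMeasure_image_eq_normDet_mul_volume (A : E d →ₗ[ℝ] E n) s
  simpa using this

/-- Near `y`, the map `Ψ` changes distances by a factor between `c⁻¹` and `c` compared with its
injective linearization `A`. The measure of images therefore changes by at most `c ^ d`. -/
lemma muHE_image_near {d n : ℕ} {Ψ : E d → E n} {A : E d →L[ℝ] E n} {y : E d}
    (hΨ : HasStrictFDerivAt Ψ A y) (hA : Function.Injective A) {c : ℝ≥0} (hc : 1 < c) :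
    ∃ V ∈ 𝓝 y, ∀ s ⊆ V,
      (μHE[d] : Measure (E n)) (Ψ '' s) ≤ (c : ℝ≥0∞) ^ d *
        (ENNReal.ofReal (LinearMap.normDet (A : E d →ₗ[ℝ] E n)) * volume s) ∧
      ENNReal.ofReal (LinearMap.normDet (A : E d →ₗ[ℝ] E n)) * volume s ≤
        (c : ℝ≥0∞) ^ d * (μHE[d] : Measure (E n)) (Ψ '' s) := by
  obtain ⟨K, hK, hAK⟩ := (A : E d →ₗ[ℝ] E n).exists_antilipschitzWith (LinearMap.ker_eq_bot.2 hA)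
  have hc' : (1 : ℝ) < c := by exact_mod_cast hc
  have hc0 : (0 : ℝ) < c := by linarith
  have hK0 : (0 : ℝ) < K := by exact_mod_cast hK
  -- With this accuracy the error of the linearization is at most `(1 - c⁻¹) * ‖A (x - z)‖`. This
  -- gives the lower factor `c⁻¹` and the upper factor `2 - c⁻¹`, which is at most `c`.
  set ε : ℝ≥0 := (1 - c⁻¹) / K with hε
  have hcinv : c⁻¹ < 1 := inv_lt_one_of_one_lt₀ hc
  have hε0 : 0 < ε := div_pos (tsub_pos_of_lt hcinv) hK
  have hεK : (ε : ℝ) * K = 1 - (c : ℝ)⁻¹ := by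
    rw [hε]; push_cast [NNReal.coe_sub hcinv.le]; field_simp
  obtain ⟨V, hV, hVA⟩ := hΨ.approximates_deriv_on_nhds (c := ε) (Or.inr hε0)
  have hb : ∀ x ∈ V, ∀ z ∈ V, ‖Ψ x - Ψ z - A (x - z)‖ ≤ (1 - (c : ℝ)⁻¹) * ‖A (x - z)‖ := by
    intro x hx z hz
    have h1 := hVA x hx z hz
    have h2 : ‖x - z‖ ≤ K * ‖A (x - z)‖ := by
      have := hAK.le_mul_dist x z
      simpa [dist_eq_norm, ← map_sub] using this
    calc _ ≤ ε * ‖x - z‖ := h1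
      _ ≤ ε * (K * ‖A (x - z)‖) := by gcongr
      _ = _ := by rw [← mul_assoc, hεK]
  have hcc : 2 - (c : ℝ)⁻¹ ≤ c := by
    have : (c : ℝ) * (c : ℝ)⁻¹ = 1 := mul_inv_cancel₀ hc0.ne'
    nlinarith [sq_nonneg ((c : ℝ) - 1), inv_pos.2 hc0]
  refine ⟨V, hV, fun s hs => ?_⟩
  rw [← muHE_image_linear]
  constructor
  · refine muHE_image_le_of_dist_le fun x hx z hz => ?_
    have h1 := hb x (hs hx) z (hs hz)
    rw [dist_eq_norm, dist_eq_norm, ← map_sub]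
    have h2 := norm_add_le (Ψ x - Ψ z - A (x - z)) (A (x - z))
    rw [sub_add_cancel] at h2
    nlinarith [norm_nonneg (A (x - z))]
  · refine muHE_image_le_of_dist_le fun x hx z hz => ?_
    have h1 := hb x (hs hx) z (hs hz)
    rw [dist_eq_norm, dist_eq_norm, ← map_sub]
    have h2 := norm_sub_le (Ψ x - Ψ z) (Ψ x - Ψ z - A (x - z))
    rw [sub_sub_cancel] at h2
    have h3 : (c : ℝ)⁻¹ * ‖A (x - z)‖ ≤ ‖Ψ x - Ψ z‖ := by linarith
    rwa [inv_mul_le_iff₀ hc0] at h3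

lemma le_of_forall_one_lt_le_pow_mul {X Y : ℝ≥0∞} {d : ℕ}
    (h : ∀ c : ℝ≥0, 1 < c → X ≤ (c : ℝ≥0∞) ^ d * Y) : X ≤ Y := by
  have h1 : Tendsto (fun c : ℝ≥0 => (c : ℝ≥0∞) ^ d * Y) (𝓝[>] 1) (𝓝 ((1 : ℝ≥0∞) ^ d * Y)) := by
    refine ENNReal.Tendsto.mul_const (ENNReal.Tendsto.pow ?_) (Or.inl (by simp))
    exact (ENNReal.tendsto_coe.2 tendsto_id).mono_left nhdsWithin_le_nhds
  rw [one_pow, one_mul] at h1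
  exact ge_of_tendsto h1 (by filter_upwards [self_mem_nhdsWithin] with c hc using h c hc)

/-- The area formula for injective immersions. -/
theorem muHE_image_eq_lintegral_jac {d n : ℕ} {Ψ : E d → E n} {U : Set (E d)} (hU : IsOpen U)
    (hΨ : ContDiffOn ℝ 1 Ψ U) (hd : ∀ y ∈ U, Function.Injective (fderiv ℝ Ψ y))
    (hinj : InjOn Ψ U) {s : Set (E d)} (hs : MeasurableSet s) (hsU : s ⊆ U) :
    (μHE[d] : Measure (E n)) (Ψ '' s) = ∫⁻ y in s, ENNReal.ofReal (jac Ψ y) := by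
  have hJ : ContinuousOn (jac Ψ) U := (contDiffOn_jac (m := 0) hU (by simpa using hΨ) hd).continuousOn
  -- The exponent `d + 1` counts the distortion `c ^ d` of the measure and one more `c` for the
  -- oscillation of `jac Ψ` near a point. The limit `c → 1` is taken at the end.
  have key : ∀ c : ℝ≥0, 1 < c →
      (μHE[d] : Measure (E n)) (Ψ '' s) ≤ (c : ℝ≥0∞) ^ (d + 1) * ∫⁻ y in s, ENNReal.ofReal (jac Ψ y) ∧
      ∫⁻ y in s, ENNReal.ofReal (jac Ψ y) ≤
        (c : ℝ≥0∞) ^ (d + 1) * (μHE[d] : Measure (E n)) (Ψ '' s) := by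
    intro c hc
    have hc' : (1 : ℝ) < c := by exact_mod_cast hc
    have hc0 : (0 : ℝ) < c := by linarith
    have hloc : ∀ y ∈ U, ∃ V ∈ 𝓝 y, ∀ t ⊆ V, MeasurableSet t →
        (μHE[d] : Measure (E n)) (Ψ '' t) ≤
          (c : ℝ≥0∞) ^ (d + 1) * ∫⁻ y in t, ENNReal.ofReal (jac Ψ y) ∧
        ∫⁻ y in t, ENNReal.ofReal (jac Ψ y) ≤
          (c : ℝ≥0∞) ^ (d + 1) * (μHE[d] : Measure (E n)) (Ψ '' t) := by
      intro y hy
      obtain ⟨V, hV, hVs⟩ := muHE_image_near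
        (((hΨ.contDiffAt (hU.mem_nhds hy)).hasStrictFDerivAt one_ne_zero)) (hd y hy) hc
      have hJy : 0 < jac Ψ y := normDet_pos (hd y hy)
      have hJc : ContinuousAt (jac Ψ) y := hJ.continuousAt (hU.mem_nhds hy)
      have h1 : ∀ᶠ z in 𝓝 y, jac Ψ z < c * jac Ψ y :=
        hJc.eventually (gt_mem_nhds (by nlinarith))
      have h2 : ∀ᶠ z in 𝓝 y, jac Ψ y < c * jac Ψ z :=
        (hJc.const_mul (c : ℝ)).eventually (lt_mem_nhds (by nlinarith))
      refine ⟨_, inter_mem hV (inter_mem h1 h2), fun t ht htm => ?_⟩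
      obtain ⟨h3, h4⟩ := hVs t fun z hz => (ht hz).1
      have hco : (c : ℝ≥0∞) = ENNReal.ofReal c := by simp
      constructor
      · refine h3.trans ?_
        rw [pow_succ, mul_assoc]
        refine mul_le_mul' le_rfl ?_
        rw [← lintegral_const_mul' _ _ ENNReal.coe_ne_top, ← setLIntegral_const]
        refine setLIntegral_mono' htm fun z hz => ?_
        rw [hco, ← ENNReal.ofReal_mul hc0.le]
        exact ENNReal.ofReal_le_ofReal (ht hz).2.2.le
      · rw [pow_succ', mul_assoc]
        refine le_trans ?_ (mul_le_mul' le_rfl h4)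
        rw [← mul_assoc, hco, ← ENNReal.ofReal_mul hc0.le, ← setLIntegral_const]
        refine setLIntegral_mono' htm fun z hz => ?_
        exact ENNReal.ofReal_le_ofReal (ht hz).2.1.le
    choose! V hV hVs using hloc
    obtain ⟨T, hTU, hTc, hT⟩ := TopologicalSpace.countable_cover_nhdsWithin
      (s := U) (f := fun y => interior (V y))
      fun y hy => mem_nhdsWithin_of_mem_nhds (interior_mem_nhds.2 (hV y hy))
    rcases s.eq_empty_or_nonempty with rfl | ⟨x₀, hx₀⟩
    · simp
    have hTne : T.Nonempty := by
      obtain ⟨y, hy, -⟩ := mem_iUnion₂.1 (hT (hsU hx₀))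
      exact ⟨y, hy⟩
    obtain ⟨e, he⟩ := hTc.exists_eq_range hTne
    -- A countable subcover, made disjoint, turns the local comparison into one for `s`. Injectivity
    -- of `Ψ` keeps the images disjoint.
    set W : ℕ → Set (E d) := disjointed fun i => interior (V (e i)) with hW
    have hWm : ∀ i, MeasurableSet (W i) :=
      MeasurableSet.disjointed fun i => isOpen_interior.measurableSet
    have hWV : ∀ i, W i ⊆ V (e i) := fun i => (disjointed_subset _ i).trans interior_subset
    have heU : ∀ i, e i ∈ U := fun i => hTU (he ▸ mem_range_self i)
    have hsW : s = ⋃ i, s ∩ W i := by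
      rw [← inter_iUnion, hW, iUnion_disjointed, eq_comm, inter_eq_left]
      refine hsU.trans (hT.trans ?_)
      rw [he]
      simp
    have hdis : Pairwise (Function.onFun Disjoint fun i => s ∩ W i) := fun i j hij =>
      ((disjoint_disjointed _) hij).mono inter_subset_right inter_subset_right
    have hmeas : ∀ i, MeasurableSet (s ∩ W i) := fun i => hs.inter (hWm i)
    have hsub : ∀ i, s ∩ W i ⊆ U := fun i => inter_subset_left.trans hsU
    have e1 : (μHE[d] : Measure (E n)) (Ψ '' s) = ∑' i, (μHE[d] : Measure (E n)) (Ψ '' (s ∩ W i)) := by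
      conv_lhs => rw [hsW, image_iUnion]
      refine measure_iUnion (fun i j hij => ?_) fun i => ?_
      · exact (hdis hij).image hinj (hsub i) (hsub j)
      · exact (hmeas i).image_of_continuousOn_injOn (hΨ.continuousOn.mono (hsub i))
          (hinj.mono (hsub i))
    have e2 : ∫⁻ y in s, ENNReal.ofReal (jac Ψ y) =
        ∑' i, ∫⁻ y in s ∩ W i, ENNReal.ofReal (jac Ψ y) := by
      conv_lhs => rw [hsW]
      exact lintegral_iUnion hmeas hdis _
    rw [e1, e2, ← ENNReal.tsum_mul_left, ← ENNReal.tsum_mul_left]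
    exact ⟨ENNReal.tsum_le_tsum fun i =>
        (hVs _ (heU i) _ (inter_subset_right.trans (hWV i)) (hmeas i)).1,
      ENNReal.tsum_le_tsum fun i =>
        (hVs _ (heU i) _ (inter_subset_right.trans (hWV i)) (hmeas i)).2⟩
  exact le_antisymm (le_of_forall_one_lt_le_pow_mul fun c hc => (key c hc).1)
    (le_of_forall_one_lt_le_pow_mul fun c hc => (key c hc).2)

section ChangeOfVariables

variable {d n : ℕ} {Ψ : E d → E n} {U : Set (E d)} {s : Set (E d)}

lemma aemeasurable_jac (hU : IsOpen U) (hΨ : ContDiffOn ℝ 1 Ψ U)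
    (hd : ∀ y ∈ U, Function.Injective (fderiv ℝ Ψ y)) (hs : MeasurableSet s) (hsU : s ⊆ U) :
    AEMeasurable (jac Ψ) (volume.restrict s) :=
  (((contDiffOn_jac (m := 0) hU (by simpa using hΨ) hd).continuousOn).mono hsU).aemeasurable hs

/-- The area formula as an equality of measures, from which integrability and integrals on the image
are read off. -/
lemma map_withDensity_jac (hU : IsOpen U) (hΨ : ContDiffOn ℝ 1 Ψ U)
    (hd : ∀ y ∈ U, Function.Injective (fderiv ℝ Ψ y)) (hinj : InjOn Ψ U)
    (hs : MeasurableSet s) (hsU : s ⊆ U) :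
    Measure.map (s.domRestrict Ψ)
      (Measure.comap (↑) ((volume : Measure (E d)).withDensity fun x => ENNReal.ofReal (jac Ψ x))) =
      (μHE[d] : Measure (E n)).restrict (Ψ '' s) := by
  have hm : MeasurableEmbedding (s.domRestrict Ψ) :=
    (hΨ.continuousOn.mono hsU).measurableEmbedding hs (hinj.mono hsU)
  ext t ht
  have ht' : MeasurableSet ((↑) '' (s.domRestrict Ψ ⁻¹' t) : Set (E d)) :=
    (MeasurableEmbedding.subtype_coe hs).measurableSet_image.2 (hm.measurable ht)
  have hsub : ((↑) '' (s.domRestrict Ψ ⁻¹' t) : Set (E d)) ⊆ s := by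
    rintro _ ⟨x, -, rfl⟩; exact x.2
  rw [hm.map_apply, (MeasurableEmbedding.subtype_coe hs).comap_apply, withDensity_apply _ ht',
    Measure.restrict_apply ht,
    ← muHE_image_eq_lintegral_jac hU hΨ hd hinj ht' (hsub.trans hsU)]
  congr 1
  ext z
  constructor
  · rintro ⟨_, ⟨x, hx, rfl⟩, rfl⟩
    exact ⟨hx, x, x.2, rfl⟩
  · rintro ⟨hz, x, hx, rfl⟩
    exact ⟨x, ⟨⟨x, hx⟩, hz, rfl⟩, rfl⟩

lemma integrableOn_image_jac (hU : IsOpen U) (hΨ : ContDiffOn ℝ 1 Ψ U)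
    (hd : ∀ y ∈ U, Function.Injective (fderiv ℝ Ψ y)) (hinj : InjOn Ψ U)
    (hs : MeasurableSet s) (hsU : s ⊆ U) (f : E n → ℝ) :
    IntegrableOn f (Ψ '' s) μHE[d] ↔ IntegrableOn (fun y => jac Ψ y * f (Ψ y)) s := by
  have hm : MeasurableEmbedding (s.domRestrict Ψ) :=
    (hΨ.continuousOn.mono hsU).measurableEmbedding hs (hinj.mono hsU)
  rw [IntegrableOn, ← map_withDensity_jac hU hΨ hd hinj hs hsU, hm.integrable_map_iff]
  simp only [Set.domRestrict_eq, ← Function.comp_assoc, ENNReal.ofReal]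
  rw [← (MeasurableEmbedding.subtype_coe hs).integrable_map_iff, map_comap_subtype_coe hs,
    restrict_withDensity hs, integrable_withDensity_iff_integrable_coe_smul₀]
  · simp_rw [IntegrableOn, Real.coe_toNNReal _ (jac_nonneg _ _), Function.comp_apply, smul_eq_mul]
  · exact (aemeasurable_jac hU hΨ hd hs hsU).real_toNNReal

lemma integral_image_jac (hU : IsOpen U) (hΨ : ContDiffOn ℝ 1 Ψ U)
    (hd : ∀ y ∈ U, Function.Injective (fderiv ℝ Ψ y)) (hinj : InjOn Ψ U)
    (hs : MeasurableSet s) (hsU : s ⊆ U) (f : E n → ℝ) :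
    ∫ x in Ψ '' s, f x ∂μHE[d] = ∫ y in s, jac Ψ y * f (Ψ y) := by
  have hm : MeasurableEmbedding (s.domRestrict Ψ) :=
    (hΨ.continuousOn.mono hsU).measurableEmbedding hs (hinj.mono hsU)
  rw [← map_withDensity_jac hU hΨ hd hinj hs hsU, hm.integral_map]
  simp only [Set.domRestrict_apply, ← Function.comp_apply (f := f), ENNReal.ofReal]
  rw [← (MeasurableEmbedding.subtype_coe hs).integral_map, map_comap_subtype_coe hs,
    setIntegral_withDensity_eq_setIntegral_smul₀
      (aemeasurable_jac hU hΨ hd hs hsU).real_toNNReal _ hs]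
  congr with x
  rw [NNReal.smul_def, Real.coe_toNNReal _ (jac_nonneg _ _), smul_eq_mul, Function.comp_apply]

end ChangeOfVariables

end Fractured

end

/-! ### Derivative of the Jacobian, tangential divergence, and Jacobian of the boundary. -/

noncomputable section

namespace Fractured

open Filter Topology
open scoped ENNReal NNReal

/-- The determinant is `1 + t tr X` plus `t ^ 2` times a polynomial in `t`. -/
lemma hasDerivAt_det_id_add_smul {d : ℕ} (X : E d →ₗ[ℝ] E d) :
    HasDerivAt (fun t : ℝ => LinearMap.det (LinearMap.id + t • X)) (LinearMap.trace ℝ (E d) X) 0 := by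
  set b := (EuclideanSpace.basisFun (Fin d) ℝ).toBasis
  set M := LinearMap.toMatrix b b X with hM
  have h1 : (fun t : ℝ => LinearMap.det (LinearMap.id + t • X)) = fun t =>
      1 + Matrix.trace M * t + Polynomial.eval t
        (Matrix.det (1 + (Polynomial.X : Polynomial ℝ) • M.map Polynomial.C)).divX.divX * t ^ 2 := by
    funext t
    rw [← Matrix.det_one_add_smul, ← LinearMap.det_toMatrix b]
    simp [hM]
  rw [h1, LinearMap.trace_eq_matrix_trace ℝ b X]
  set p := (Matrix.det (1 + (Polynomial.X : Polynomial ℝ) • M.map Polynomial.C)).divX.divX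
  have h2 := (((hasDerivAt_id (0 : ℝ)).const_mul (Matrix.trace M)).const_add 1).add
    ((p.hasDerivAt 0).mul ((hasDerivAt_id (0 : ℝ)).pow 2))
  refine h2.congr_deriv ?_ |>.congr_of_eventuallyEq ?_
  · simp [hM]
  · exact Eventually.of_forall fun t => by simp

/-- `normDet` is the factor by which the measure of the unit ball changes, and a contraction does
not increase Hausdorff measure. -/
lemma normDet_comp_le_of_lipschitz {d n : ℕ} (A : E d →L[ℝ] E n) (P : E n →L[ℝ] E n)
    (hP : ∀ x, ‖P x‖ ≤ ‖x‖) :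
    LinearMap.normDet (P ∘L A : E d →L[ℝ] E n).toLinearMap ≤
      LinearMap.normDet (A : E d →ₗ[ℝ] E n) := by
  have h := muHE_image_le_of_dist_le (d := d) (f₁ := (P ∘L A)) (f₂ := A)
    (s := Metric.ball (0 : E d) 1) (K := 1) fun x _ y _ => by
      rw [dist_eq_norm, dist_eq_norm, ← map_sub, ← map_sub]
      simpa using hP (A (x - y))
  rw [muHE_image_linear, muHE_image_linear] at h
  have h0 : volume (Metric.ball (0 : E d) 1) ≠ 0 := (Metric.measure_ball_pos _ _ one_pos).ne'
  have h1 : volume (Metric.ball (0 : E d) 1) ≠ ⊤ := measure_ball_lt_top.ne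
  simp only [ENNReal.coe_one, one_pow, one_mul] at h
  rw [ENNReal.mul_le_mul_iff_left h0 h1] at h
  exact (ENNReal.ofReal_le_ofReal_iff (LinearMap.normDet_nonneg _)).1 h

lemma differentiableAt_normDet {d n : ℕ} {A : E d →L[ℝ] E n} (hA : Function.Injective A) :
    DifferentiableAt ℝ (fun A : E d →L[ℝ] E n => LinearMap.normDet (A : E d →ₗ[ℝ] E n)) A := by
  have h1 : DifferentiableAt ℝ (fun A : E d →L[ℝ] E n =>
      √(LinearMap.normDet (A : E d →ₗ[ℝ] E n) ^ 2)) A :=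
    ((contDiff_normDet_sq (m := 1)).differentiable one_ne_zero A).sqrt
      (pow_pos (normDet_pos hA) 2).ne'
  refine h1.congr_of_eventuallyEq (Eventually.of_forall fun A => ?_)
  simp only
  rw [Real.sqrt_sq (LinearMap.normDet_nonneg _)]

/-- The Gram determinant need not be differentiated. With `P = A ∘ C` the projection onto the range
of `A`, the contraction bound gives `normDet A * |det (1 + t C A')| = normDet (P (A + t A')) ≤
normDet (A + t A')`, with equality at `t = 0`. Differentiable functions that touch in this way have
equal derivatives, and the left one has the trace as its logarithmic derivative. -/
lemma fderiv_normDet {d n : ℕ} {A A' : E d →L[ℝ] E n} (hA : Function.Injective A)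
    {C : E n →L[ℝ] E d} (hC : A ∘L C = (LinearMap.range (A : E d →ₗ[ℝ] E n)).starProjection) :
    fderiv ℝ (fun A : E d →L[ℝ] E n => LinearMap.normDet (A : E d →ₗ[ℝ] E n)) A A' =
      LinearMap.normDet (A : E d →ₗ[ℝ] E n) *
        LinearMap.trace ℝ (E d) (C ∘L A' : E d →L[ℝ] E d) := by
  have hAC : ∀ x, A (C x) = (LinearMap.range (A : E d →ₗ[ℝ] E n)).starProjection x := fun x => by
    rw [← hC]; rfl
  have hCA : ∀ x, C (A x) = x := fun x => hA (by
    rw [hAC, Submodule.starProjection_eq_self_iff]; exact ⟨x, rfl⟩)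
  have h0 : A + (0 : ℝ) • A' = A := by ext1 x; simp
  have hline : HasDerivAt (fun t : ℝ => A + t • A') A' 0 := by
    simpa using ((hasDerivAt_id (0 : ℝ)).smul_const A').const_add A
  set N := fun A : E d →L[ℝ] E n => LinearMap.normDet (A : E d →ₗ[ℝ] E n) with hN
  have hf : HasDerivAt (fun t : ℝ => N (A + t • A')) (fderiv ℝ N A A') 0 := by
    have h1 : HasFDerivAt N (fderiv ℝ N A) (A + (0 : ℝ) • A') := by
      rw [h0]
      exact (differentiableAt_normDet hA).hasFDerivAt
    exact h1.comp_hasDerivAt (0 : ℝ) hline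
  have hdet := hasDerivAt_det_id_add_smul (C ∘L A' : E d →L[ℝ] E d).toLinearMap
  have hg : HasDerivAt (fun t : ℝ => N A *
      |LinearMap.det (LinearMap.id + t • (C ∘L A' : E d →L[ℝ] E d).toLinearMap)|)
      (N A * LinearMap.trace ℝ (E d) (C ∘L A' : E d →L[ℝ] E d)) 0 := by
    refine HasDerivAt.const_mul _ (hdet.congr_of_eventuallyEq ?_)
    have h0 : ∀ᶠ t in 𝓝 (0 : ℝ), 0 < LinearMap.det
        (LinearMap.id + t • (C ∘L A' : E d →L[ℝ] E d).toLinearMap) := by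
      refine hdet.continuousAt.eventually (lt_mem_nhds ?_)
      simp
    filter_upwards [h0] with t ht
    exact abs_of_pos ht
  have hle : ∀ t : ℝ, N A *
      |LinearMap.det (LinearMap.id + t • (C ∘L A' : E d →L[ℝ] E d).toLinearMap)| ≤
      N (A + t • A') := by
    intro t
    have h1 := normDet_comp_le_of_lipschitz (A + t • A')
      ((LinearMap.range (A : E d →ₗ[ℝ] E n)).starProjection) fun x =>
        Submodule.norm_starProjection_apply_le _ x
    refine le_trans (le_of_eq ?_) h1
    rw [← Real.norm_eq_abs, ← LinearMap.normDet_eq_norm_det,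
      ← LinearMap.normDet_comp_of_finrank_eq _ _ rfl]
    congr 1
    ext1 x
    have : (LinearMap.range (A : E d →ₗ[ℝ] E n)).starProjection (A x) = A x :=
      Submodule.starProjection_eq_self_iff.2 ⟨x, rfl⟩
    simp [hAC, this]
  have hmin : IsLocalMin (fun t : ℝ => N (A + t • A') - N A *
      |LinearMap.det (LinearMap.id + t • (C ∘L A' : E d →L[ℝ] E d).toLinearMap)|) 0 :=
    Eventually.of_forall fun t => by
      have := hle t
      simp only [h0, zero_smul, add_zero, LinearMap.det_id, abs_one, mul_one]
      rw [sub_self]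
      linarith
  have := hmin.hasDerivAt_eq_zero (hf.sub hg)
  linarith

lemma exists_comp_eq_starProjection {d n : ℕ} {A : E d →L[ℝ] E n} (hA : Function.Injective A) :
    ∃ C : E n →L[ℝ] E d,
      A ∘L C = (LinearMap.range (A : E d →ₗ[ℝ] E n)).starProjection := by
  obtain ⟨L, hL⟩ := (A : E d →ₗ[ℝ] E n).exists_leftInverse_of_injective (LinearMap.ker_eq_bot.2 hA)
  refine ⟨LinearMap.toContinuousLinearMap L ∘L
    (LinearMap.range (A : E d →ₗ[ℝ] E n)).starProjection, ?_⟩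
  ext1 x
  obtain ⟨z, hz⟩ : (LinearMap.range (A : E d →ₗ[ℝ] E n)).starProjection x ∈
      LinearMap.range (A : E d →ₗ[ℝ] E n) := Submodule.starProjection_apply_mem _ _
  have h1 : L (A z) = z := LinearMap.congr_fun hL z
  have hz' : A z = (LinearMap.range (A : E d →ₗ[ℝ] E n)).starProjection x := hz
  simp only [ContinuousLinearMap.comp_apply, LinearMap.coe_toContinuousLinearMap']
  rw [← hz', h1]

/-- The divergence of a tangential field in a parametrization. -/
theorem jac_mul_trace_eq {d n : ℕ} {Ψ : E d → E n} {y : E d} (hΨ : ContDiffAt ℝ 2 Ψ y)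
    (hinj : Function.Injective (fderiv ℝ Ψ y)) {b : E n → E n} {B : E d → E d}
    (hb : DifferentiableAt ℝ b (Ψ y)) (hB : DifferentiableAt ℝ B y)
    (hbB : ∀ᶠ z in 𝓝 y, b (Ψ z) = fderiv ℝ Ψ z (B z)) :
    jac Ψ y * LinearMap.trace ℝ (E n)
      ((LinearMap.range (fderiv ℝ Ψ y : E d →ₗ[ℝ] E n)).starProjection ∘L fderiv ℝ b (Ψ y) :
        E n →L[ℝ] E n) = fderiv ℝ (jac Ψ) y (B y) + jac Ψ y * dvg B y := by
  obtain ⟨C, hC⟩ := exists_comp_eq_starProjection hinj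
  have hCA : ∀ x, C (fderiv ℝ Ψ y x) = x := fun x => hinj (by
    have : fderiv ℝ Ψ y (C (fderiv ℝ Ψ y x)) = (LinearMap.range
      (fderiv ℝ Ψ y : E d →ₗ[ℝ] E n)).starProjection (fderiv ℝ Ψ y x) := by rw [← hC]; rfl
    rw [this, Submodule.starProjection_eq_self_iff]; exact ⟨x, rfl⟩)
  have hd1 : DifferentiableAt ℝ (fderiv ℝ Ψ) y :=
    (hΨ.fderiv_right (m := 1) (by norm_num)).differentiableAt one_ne_zero
  have hdΨ : DifferentiableAt ℝ Ψ y := hΨ.differentiableAt two_ne_zero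
  have e1 : fderiv ℝ (jac Ψ) y (B y) = jac Ψ y *
      LinearMap.trace ℝ (E d) (C ∘L fderiv ℝ (fderiv ℝ Ψ) y (B y) : E d →L[ℝ] E d) := by
    have h1 := ((differentiableAt_normDet hinj).hasFDerivAt.comp y hd1.hasFDerivAt).fderiv
    have h2 : fderiv ℝ (jac Ψ) y = _ := h1
    rw [h2, ContinuousLinearMap.comp_apply, fderiv_normDet hinj hC]
    rfl
  have hsymm : IsSymmSndFDerivAt ℝ Ψ y := hΨ.isSymmSndFDerivAt (by simp)
  -- Differentiating `b ∘ Ψ = DΨ B` gives a second derivative of `Ψ`. By symmetry it can be read as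
  -- the derivative of `DΨ` in direction `B`, which is the one in the derivative of the Jacobian.
  have e2 : fderiv ℝ b (Ψ y) ∘L fderiv ℝ Ψ y =
      fderiv ℝ (fderiv ℝ Ψ) y (B y) + fderiv ℝ Ψ y ∘L fderiv ℝ B y := by
    have h1 : fderiv ℝ (b ∘ Ψ) y = fderiv ℝ (fun z => fderiv ℝ Ψ z (B z)) y :=
      Filter.EventuallyEq.fderiv_eq hbB
    rw [fderiv_comp y hb hdΨ, fderiv_clm_apply hd1 hB] at h1
    rw [h1]
    ext1 w
    simp only [_root_.add_apply, ContinuousLinearMap.comp_apply, ContinuousLinearMap.flip_apply]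
    rw [hsymm w (B y), add_comm]
  rw [e1, dvg, ← mul_add, ← hC]
  congr 1
  have e3 : ((fderiv ℝ Ψ y ∘L C) ∘L fderiv ℝ b (Ψ y) : E n →L[ℝ] E n).toLinearMap =
      (fderiv ℝ Ψ y : E d →ₗ[ℝ] E n) ∘ₗ (C ∘L fderiv ℝ b (Ψ y) : E n →L[ℝ] E d).toLinearMap := rfl
  -- Cyclicity of the trace moves the computation from the ambient space to the parameter space,
  -- where `C ∘ DΨ` is the identity.
  rw [e3, LinearMap.trace_comp_comm', ← map_add]
  congr 1
  ext1 w
  have h2 := congrArg C (DFunLike.congr_fun e2 w)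
  simp only [ContinuousLinearMap.comp_apply, _root_.add_apply, map_add, hCA] at h2
  simpa using h2

/-- The Gram matrix is block diagonal, with last entry `s²`. -/
lemma normDet_eq_of_orthogonal {k n : ℕ} (A₀ : E k →L[ℝ] E n) {ν : E n} (hν : ‖ν‖ = 1)
    (horth : ∀ z, inner ℝ ν (A₀ z) = 0) (s : ℝ) :
    LinearMap.normDet (A₀ ∘L projl k.le_succ +
      (EuclideanSpace.proj (Fin.last k) : E (k + 1) →L[ℝ] ℝ).smulRight (s • ν) :
        E (k + 1) →L[ℝ] E n).toLinearMap = |s| * LinearMap.normDet (A₀ : E k →ₗ[ℝ] E n) := by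
  have hp1 : ∀ i : Fin k, projl k.le_succ (EuclideanSpace.single i.castSucc (1 : ℝ)) =
      EuclideanSpace.single i (1 : ℝ) := by
    intro i; ext j
    simp [projl_apply, PiLp.single_apply, Fin.ext_iff]
  have hp2 : projl k.le_succ (EuclideanSpace.single (Fin.last k) (1 : ℝ)) = 0 := by
    ext j
    simp only [projl_apply, PiLp.single_apply, PiLp.zero_apply]
    rw [if_neg]
    intro h
    have := congrArg Fin.val h
    simp at this
    omega
  have h : LinearMap.normDet (A₀ ∘L projl k.le_succ +
      (EuclideanSpace.proj (Fin.last k) : E (k + 1) →L[ℝ] ℝ).smulRight (s • ν) :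
        E (k + 1) →L[ℝ] E n).toLinearMap ^ 2 =
      (|s| * LinearMap.normDet (A₀ : E k →ₗ[ℝ] E n)) ^ 2 := by
    rw [mul_pow, normDet_sq_eq, normDet_sq_eq, Matrix.det_succ_row _ (Fin.last k),
      Finset.sum_eq_single (Fin.last k)]
    · simp only [Matrix.of_apply, _root_.add_apply, ContinuousLinearMap.comp_apply, hp2, map_zero]
      congr 1
      · simp [norm_smul, hν, ← two_mul, pow_mul]
      · congr 1
        ext i j
        have hij : ∀ i : Fin k, i.castSucc ≠ Fin.last k := fun i => (Fin.castSucc_lt_last i).ne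
        simp [hp1, PiLp.single_apply, Ne.symm (hij _)]
    · intro j _ hj
      obtain ⟨i, rfl⟩ : ∃ i : Fin k, j = i.castSucc := ⟨j.castPred hj, by simp⟩
      have hij : ∀ i : Fin k, i.castSucc ≠ Fin.last k := fun i => (Fin.castSucc_lt_last i).ne
      simp [hp1, hp2, PiLp.single_apply, Ne.symm (hij _), inner_smul_left, horth]
    · simp
  exact (pow_left_inj₀ (LinearMap.normDet_nonneg _)
    (mul_nonneg (abs_nonneg _) (LinearMap.normDet_nonneg _)) two_ne_zero).1 h

lemma face_projl_add {k : ℕ} (y : E (k + 1)) :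
    face k (projl k.le_succ y) + y (Fin.last k) • EuclideanSpace.single (Fin.last k) (1 : ℝ) = y := by
  ext i
  refine Fin.lastCases ?_ (fun i => ?_) i
  · simp
  · have hij : i.castSucc ≠ Fin.last k := (Fin.castSucc_lt_last i).ne
    simp [face, incl_apply, projl_apply, hij]
    rfl

/-- Volume is base times height, where the base is spanned by the first `k` directions and the
height is measured along `ν`. A shear, of determinant one, removes the part of the last column that
is tangential to the base. -/
lemma normDet_eq_inner_mul {k n : ℕ} (A : E (k + 1) →L[ℝ] E n) {ν : E n} (hν : ‖ν‖ = 1)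
    (hA : ν ∈ LinearMap.range (A : E (k + 1) →ₗ[ℝ] E n))
    (horth : ∀ z, inner ℝ ν (A (face k z)) = 0) :
    LinearMap.normDet (A : E (k + 1) →ₗ[ℝ] E n) =
      |inner ℝ ν (A (EuclideanSpace.single (Fin.last k) 1))| *
        LinearMap.normDet (A ∘L (face k).toContinuousLinearMap : E k →L[ℝ] E n).toLinearMap := by
  set e : E (k + 1) := EuclideanSpace.single (Fin.last k) 1 with he
  set s : ℝ := inner ℝ ν (A e) with hs
  obtain ⟨u, hu⟩ := hA
  have hu' : A u = ν := hu
  have hdec : ∀ y, A y = A (face k (projl k.le_succ y)) + y (Fin.last k) • A e := fun y => by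
    conv_lhs => rw [← face_projl_add y]
    simp [he]
  have h1 : u (Fin.last k) * s = 1 := by
    have h2 : inner ℝ ν (A u) = 1 := by rw [hu', real_inner_self_eq_norm_sq, hν, one_pow]
    rwa [hdec u, inner_add_right, horth, zero_add, inner_smul_right] at h2
  set z : E k := -(s • projl k.le_succ u) with hz
  have hAe : A e = s • ν + A (face k z) := by
    have h3 := hdec u
    rw [hu'] at h3
    rw [h3, hz, smul_add, smul_smul, mul_comm s, h1]
    simp
  rw [← normDet_eq_of_orthogonal (A ∘L (face k).toContinuousLinearMap) hν (fun z => horth z) s]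
  have hT := LinearMap.transvection.det
    ((EuclideanSpace.proj (Fin.last k) : E (k + 1) →L[ℝ] ℝ) : Module.Dual ℝ (E (k + 1))) (face k z)
  have hT1 : LinearMap.normDet (LinearMap.transvection
      ((EuclideanSpace.proj (Fin.last k) : E (k + 1) →L[ℝ] ℝ) : Module.Dual ℝ (E (k + 1)))
      (face k z)) = 1 := by
    rw [LinearMap.normDet_eq_norm_det, hT]
    simp
  conv_rhs => rw [← mul_one (LinearMap.normDet _), ← hT1]
  rw [← LinearMap.normDet_comp_of_finrank_eq _ _ rfl]
  congr 1
  ext1 y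
  have hpf : ∀ z : E k, projl k.le_succ (face k z) = z := fun z => by simp [face]
  simp only [ContinuousLinearMap.coe_coe, LinearMap.comp_apply, LinearMap.transvection.apply,
    _root_.add_apply, ContinuousLinearMap.comp_apply, map_add, map_smul, hpf]
  rw [hdec y, hAe]
  simp [smul_add, smul_smul]
  abel

end Fractured

end

/-! ### Parametrizations from charts, and charts adapted to a piece and its boundary. -/

noncomputable section

namespace Fractured

open Filter Topology
open scoped ENNReal NNReal

/-- One inclusion differentiates `Ψ ∘ Θ = id` along `T`, the other pushes tangent directions of `Q`
forward by `Ψ`. Only the span of the tangent cone of `Q` matters, so `Q` may be a half space and `z`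
a boundary point of it. -/
lemma tangentSpace_eq_range {d n : ℕ} {T : Set (E n)} {Ψ : E d → E n} {Θ : E n → E d} {Q : Set (E d)}
    {z : E d} (hΨ : DifferentiableAt ℝ Ψ z) (hΘ : DifferentiableAt ℝ Θ (Ψ z)) (hz : Θ (Ψ z) = z)
    (hinv : ∀ᶠ y in 𝓝[T] (Ψ z), Ψ (Θ y) = y) (hQ : ∀ᶠ y in 𝓝[Q] z, Ψ y ∈ T)
    (hspan : Submodule.span ℝ (tangentConeAt ℝ Q z) = ⊤) :
    tangentSpace T (Ψ z) = LinearMap.range (fderiv ℝ Ψ z : E d →ₗ[ℝ] E n) := by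
  refine le_antisymm (Submodule.span_le.2 fun v hv => ?_) ?_
  · have h1 : HasFDerivAt (fun y => Ψ (Θ y)) (fderiv ℝ Ψ z ∘L fderiv ℝ Θ (Ψ z)) (Ψ z) := by
      have hΨ' : HasFDerivAt Ψ (fderiv ℝ Ψ z) (Θ (Ψ z)) := by rw [hz]; exact hΨ.hasFDerivAt
      exact hΨ'.comp (Ψ z) hΘ.hasFDerivAt
    have h2 : HasFDerivWithinAt (fun y => Ψ (Θ y)) (ContinuousLinearMap.id ℝ (E n)) T (Ψ z) :=
      (hasFDerivWithinAt_id (Ψ z) T).congr_of_eventuallyEq hinv (by rw [hz]; rfl)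
    have h3 := h1.hasFDerivWithinAt.unique_on h2 hv
    exact ⟨fderiv ℝ Θ (Ψ z) v, h3⟩
  · obtain ⟨N, hN, hNQ⟩ := mem_nhdsWithin_iff_exists_mem_nhds_inter.1 hQ
    have h1 : MapsTo (fderiv ℝ Ψ z) (tangentConeAt ℝ Q z) (tangentConeAt ℝ T (Ψ z)) := by
      intro v hv
      rw [← tangentConeAt_inter_nhds hN] at hv
      have h2 := (hΨ.hasFDerivAt.hasFDerivWithinAt (s := Q ∩ N)).mapsTo_tangent_cone hv
      refine tangentConeAt_mono ?_ h2
      rintro _ ⟨y, hy, rfl⟩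
      exact hNQ ⟨hy.2, hy.1⟩
    rw [LinearMap.range_eq_map, ← hspan, Submodule.map_span]
    refine Submodule.span_mono ?_
    rintro _ ⟨v, hv, rfl⟩
    exact h1 hv

lemma mapsTo_posTangentConeAt {d n : ℕ} {T : Set (E n)} {Ψ : E d → E n} {Q : Set (E d)}
    {z : E d} (hΨ : DifferentiableAt ℝ Ψ z) (hQ : ∀ᶠ y in 𝓝[Q] z, Ψ y ∈ T) {u : E d}
    (hu : u ∈ posTangentConeAt Q z) : fderiv ℝ Ψ z u ∈ posTangentConeAt T (Ψ z) := by
  obtain ⟨ι, l, hl, c, d, hd, hs, hcd⟩ := exists_fun_of_mem_tangentConeAt hu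
  have h1 := hΨ.hasFDerivAt.hasFDerivWithinAt.lim (s := Q) (c := fun i => (c i : ℝ)) hd hs hcd
  have hd' : Tendsto (fun i => z + d i) l (𝓝[Q] z) := by
    rw [tendsto_nhdsWithin_iff]
    exact ⟨by simpa using tendsto_const_nhds.add hd, hs⟩
  refine mem_tangentConeAt_of_seq l c (fun i => Ψ (z + d i) - Ψ z) ?_ ?_ h1
  · have := (hΨ.continuousAt.tendsto.comp (hd'.mono_right nhdsWithin_le_nhds)).sub_const (Ψ z)
    simpa using this
  · filter_upwards [hd'.eventually hQ] with i hi
    simpa using hi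

lemma continuous_incl {m n : ℕ} (h : m ≤ n) : Continuous (incl h) := (incl h).continuous

/-- The parametrization of the coordinate plane given by a chart. -/
def param {n d : ℕ} (hd : d ≤ n) (Φ : OpenPartialHomeomorph (E n) (E n)) (z : E d) : E n :=
  Φ.symm (incl hd z)

/-- The first coordinates in a chart. -/
def coord {n d : ℕ} (hd : d ≤ n) (Φ : OpenPartialHomeomorph (E n) (E n)) (y : E n) : E d :=
  projl hd (Φ y)

/-- The domain of `param`. -/
def pdom {n d : ℕ} (hd : d ≤ n) (Φ : OpenPartialHomeomorph (E n) (E n)) : Set (E d) :=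
  incl hd ⁻¹' Φ.target

section Param

variable {n d : ℕ} {hd : d ≤ n} {Φ : OpenPartialHomeomorph (E n) (E n)}

lemma isOpen_pdom : IsOpen (pdom hd Φ) := Φ.open_target.preimage (continuous_incl hd)

lemma param_mem {z : E d} (hz : z ∈ pdom hd Φ) : param hd Φ z ∈ Φ.source := Φ.map_target hz

lemma apply_param {z : E d} (hz : z ∈ pdom hd Φ) : Φ (param hd Φ z) = incl hd z :=
  Φ.right_inv hz

lemma coord_param {z : E d} (hz : z ∈ pdom hd Φ) : coord hd Φ (param hd Φ z) = z := by
  rw [coord, apply_param hz, projl_incl]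

lemma param_coord {y : E n} (hy : y ∈ Φ.source) (h : ∀ i : Fin n, d ≤ (i : ℕ) → Φ y i = 0) :
    param hd Φ (coord hd Φ y) = y ∧ coord hd Φ y ∈ pdom hd Φ := by
  have h1 : incl hd (coord hd Φ y) = Φ y := incl_projl hd _ h
  refine ⟨by rw [param, h1, Φ.left_inv hy], ?_⟩
  change incl hd (coord hd Φ y) ∈ Φ.target
  rw [h1]
  exact Φ.map_source hy

lemma injOn_param : InjOn (param hd Φ) (pdom hd Φ) := fun z hz z' hz' h => by
  rw [← coord_param hz, ← coord_param hz', h]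

lemma IsSmoothChart.contDiffOn_param (hΦ : IsSmoothChart Φ) :
    ContDiffOn ℝ ∞ (param hd Φ) (pdom hd Φ) :=
  hΦ.2.comp (incl hd).contDiff.contDiffOn fun _ hz => hz

lemma IsSmoothChart.contDiffOn_coord (hΦ : IsSmoothChart Φ) :
    ContDiffOn ℝ ∞ (coord hd Φ) Φ.source :=
  (projl hd).contDiff.comp_contDiffOn hΦ.1

lemma IsSmoothChart.differentiableAt_param (hΦ : IsSmoothChart Φ) {z : E d} (hz : z ∈ pdom hd Φ) :
    DifferentiableAt ℝ (param hd Φ) z :=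
  (hΦ.contDiffOn_param.contDiffAt (isOpen_pdom.mem_nhds hz)).differentiableAt (by simp)

lemma IsSmoothChart.differentiableAt_coord (hΦ : IsSmoothChart Φ) {y : E n} (hy : y ∈ Φ.source) :
    DifferentiableAt ℝ (coord hd Φ) y :=
  (hΦ.contDiffOn_coord.contDiffAt (Φ.open_source.mem_nhds hy)).differentiableAt (by simp)

lemma IsSmoothChart.fderiv_coord_param (hΦ : IsSmoothChart Φ) {z : E d} (hz : z ∈ pdom hd Φ)
    (u : E d) : fderiv ℝ (coord hd Φ) (param hd Φ z) (fderiv ℝ (param hd Φ) z u) = u := by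
  have h1 : (fun z => coord hd Φ (param hd Φ z)) =ᶠ[𝓝 z] id := by
    filter_upwards [isOpen_pdom.mem_nhds hz] with y hy using coord_param hy
  have h2 := h1.fderiv_eq (𝕜 := ℝ)
  rw [fderiv_fun_comp z (hΦ.differentiableAt_coord (param_mem hz)) (hΦ.differentiableAt_param hz),
    fderiv_id] at h2
  exact DFunLike.congr_fun h2 u

lemma IsSmoothChart.injective_fderiv_param (hΦ : IsSmoothChart Φ) {z : E d} (hz : z ∈ pdom hd Φ) :
    Function.Injective (fderiv ℝ (param hd Φ) z) :=
  Function.LeftInverse.injective (hΦ.fderiv_coord_param hz)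

lemma IsSmoothChart.contDiffOn_jac_param (hΦ : IsSmoothChart Φ) :
    ContDiffOn ℝ ∞ (jac (param hd Φ)) (pdom hd Φ) :=
  contDiffOn_jac (m := ⊤) isOpen_pdom (by simpa using hΦ.contDiffOn_param)
    fun _ hz => hΦ.injective_fderiv_param hz

end Param

/-- The property of a chart to flatten `S` to a half space near the points of its domain. -/
def Flattens {n k : ℕ} (hk : k + 1 ≤ n) (S : Set (E n)) (Φ : OpenPartialHomeomorph (E n) (E n)) :
    Prop :=
  ∀ y ∈ Φ.source, (y ∈ S ↔ (∀ i : Fin n, k + 1 ≤ (i : ℕ) → Φ y i = 0) ∧ 0 < Φ y ⟨k, hk⟩)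

section Flattens

variable {n k : ℕ} {hk : k + 1 ≤ n} {S : Set (E n)} {Φ : OpenPartialHomeomorph (E n) (E n)}

lemma Flattens.closure_zero (h : Flattens hk S Φ) {y : E n} (hy : y ∈ Φ.source)
    (hyS : y ∈ closure S) : (∀ i : Fin n, k + 1 ≤ (i : ℕ) → Φ y i = 0) ∧ 0 ≤ Φ y ⟨k, hk⟩ := by
  have : (𝓝[S] y).NeBot := mem_closure_iff_nhdsWithin_neBot.1 hyS
  have h1 : ∀ i, Tendsto (fun z => Φ z i) (𝓝[S] y) (𝓝 (Φ y i)) := fun i =>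
    ((EuclideanSpace.proj i : E n →L[ℝ] ℝ).continuous.continuousAt.tendsto.comp
      (Φ.continuousAt hy)).mono_left nhdsWithin_le_nhds
  have h2 : ∀ᶠ z in 𝓝[S] y, (∀ i : Fin n, k + 1 ≤ (i : ℕ) → Φ z i = 0) ∧ 0 < Φ z ⟨k, hk⟩ := by
    filter_upwards [self_mem_nhdsWithin, nhdsWithin_le_nhds (Φ.open_source.mem_nhds hy)]
      with z hz hz' using (h z hz').1 hz
  refine ⟨fun i hi => tendsto_nhds_unique (h1 i) ?_, ge_of_tendsto (h1 _) (h2.mono fun z hz => hz.2.le)⟩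
  exact tendsto_const_nhds.congr' (h2.mono fun z hz => (hz.1 i hi).symm)

lemma Flattens.mem_bdry_iff (h : Flattens hk S Φ) {y : E n} (hy : y ∈ Φ.source) :
    y ∈ bdry S ↔ ∀ i : Fin n, k ≤ (i : ℕ) → Φ y i = 0 := by
  constructor
  · rintro ⟨h1, h2⟩ i hi
    obtain ⟨h3, h4⟩ := h.closure_zero hy h1
    rcases hi.eq_or_lt with hi | hi
    · have h5 : i = ⟨k, hk⟩ := Fin.ext hi.symm
      by_contra h6
      rw [h5] at h6
      exact h2 ((h y hy).2 ⟨h3, h4.lt_of_ne' h6⟩)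
    · exact h3 i hi
  · intro h1
    refine ⟨?_, fun h2 => ((h y hy).1 h2).2.ne' (h1 _ le_rfl)⟩
    -- Increasing the coordinate of index `k` moves from the boundary plane into `S`, which shows
    -- that the point lies in the closure.
    set p : ℝ → E n := fun t => Φ y + t • EuclideanSpace.single ⟨k, hk⟩ 1 with hp
    have hpc : Tendsto p (𝓝[>] 0) (𝓝 (Φ y)) := by
      have : Continuous p := by fun_prop
      have h2 := this.tendsto 0
      simp only [hp, zero_smul, add_zero] at h2
      exact h2.mono_left nhdsWithin_le_nhds
    have h3 : Tendsto (fun t => Φ.symm (p t)) (𝓝[>] 0) (𝓝 y) := by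
      have := (Φ.continuousAt_symm (Φ.map_source hy)).tendsto
      rw [Φ.left_inv hy] at this
      exact this.comp hpc
    refine mem_closure_of_tendsto h3 ?_
    filter_upwards [self_mem_nhdsWithin,
      hpc.eventually (Φ.open_target.mem_nhds (Φ.map_source hy))] with t ht htt
    rw [h _ (Φ.map_target htt), Φ.right_inv htt]
    constructor
    · intro i hi
      have h4 : i ≠ ⟨k, hk⟩ := fun h => by simp [h] at hi
      simp [hp, h4, h1 i (by omega)]
    · simpa [hp, h1 ⟨k, hk⟩ le_rfl] using ht

end Flattens

/-- A chart in which `S` is a half space, with controlled surface element. -/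
structure IsAdapted {n k : ℕ} (hk : k + 1 ≤ n) (S : Set (E n))
    (Φ : OpenPartialHomeomorph (E n) (E n)) : Prop where
  smooth : IsSmoothChart Φ
  flat : Flattens hk S Φ
  jac_lb : ∃ c > 0, ∀ z ∈ pdom hk Φ, c ≤ jac (param hk Φ) z

lemma IsSmoothChart.restr {n : ℕ} {Φ : OpenPartialHomeomorph (E n) (E n)} (hΦ : IsSmoothChart Φ)
    {O : Set (E n)} (hO : IsOpen O) : IsSmoothChart (Φ.restrOpen O hO) := by
  refine ⟨hΦ.1.mono ?_, hΦ.2.mono ?_⟩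
  · rw [Φ.restrOpen_source]
    exact inter_subset_left
  · intro y hy
    exact hy.1

lemma Flattens.restr {n k : ℕ} {hk : k + 1 ≤ n} {S : Set (E n)}
    {Φ : OpenPartialHomeomorph (E n) (E n)} (h : Flattens hk S Φ) {O : Set (E n)} (hO : IsOpen O) :
    Flattens hk S (Φ.restrOpen O hO) := fun y hy => by
  rw [Φ.restrOpen_source] at hy
  exact h y hy.1

/-- The chart is shrunk to the region where the Jacobian exceeds half its value at `x`. The
resulting lower bound will allow dividing integrable functions by the Jacobian. -/
lemma exists_isAdapted_of_flattens {n k : ℕ} {hk : k + 1 ≤ n} {S : Set (E n)}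
    {Φ : OpenPartialHomeomorph (E n) (E n)} (hΦ : IsSmoothChart Φ) (h : Flattens hk S Φ) {x : E n}
    (hx : x ∈ Φ.source) (hxS : x ∈ closure S) :
    ∃ Φ' : OpenPartialHomeomorph (E n) (E n), IsAdapted hk S Φ' ∧ x ∈ Φ'.source := by
  obtain ⟨h1, h2⟩ := param_coord (hd := hk) hx (h.closure_zero hx hxS).1
  set z := coord hk Φ x with hz
  have hJ : ContinuousAt (jac (param hk Φ)) z :=
    (hΦ.contDiffOn_jac_param.continuousOn).continuousAt (isOpen_pdom.mem_nhds h2)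
  have hJ0 : 0 < jac (param hk Φ) z := normDet_pos (hΦ.injective_fderiv_param h2)
  obtain ⟨V, hV, hVo, hzV⟩ := mem_nhds_iff.1 (hJ.eventually (lt_mem_nhds (half_lt_self hJ0)))
  have hco : ContinuousOn (coord hk Φ) Φ.source := hΦ.contDiffOn_coord.continuousOn
  set O := Φ.source ∩ coord hk Φ ⁻¹' V with hO
  have hOo : IsOpen O := hco.isOpen_inter_preimage Φ.open_source hVo
  refine ⟨Φ.restrOpen O hOo, ⟨hΦ.restr hOo, h.restr hOo, _, half_pos hJ0, ?_⟩, ?_⟩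
  · intro y hy
    have h3 : param hk (Φ.restrOpen O hOo) = param hk Φ := rfl
    rw [h3]
    have h4 : y ∈ pdom hk Φ := hy.1
    have h5 : param hk Φ y ∈ O := by
      have := param_mem hy
      rw [Φ.restrOpen_source] at this
      exact this.2
    have h6 : y ∈ V := by
      have := h5.2
      rwa [mem_preimage, coord_param h4] at this
    exact (hV h6).le
  · rw [Φ.restrOpen_source]
    exact ⟨hx, hx, hzV⟩

/-- Around each point of a submanifold there is an adapted chart. -/
lemma IsSmoothSubmanifold.exists_isAdapted {n k : ℕ} (hk : k + 1 ≤ n) {S : Set (E n)}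
    (hS : IsSmoothSubmanifold (k + 1) S) {x : E n} (hx : x ∈ S) :
    ∃ Φ : OpenPartialHomeomorph (E n) (E n), IsAdapted hk S Φ ∧ x ∈ Φ.source := by
  obtain ⟨Φ, hΦ, hxΦ, hΦS⟩ := hS x hx
  -- The shift gives the coordinate of index `k` the value `1` at `x`. After restriction to positive
  -- values, the plane looks like a half space with `x` inside, so interior and boundary points can
  -- be treated alike.
  set e : E n := EuclideanSpace.single ⟨k, hk⟩ (1 - Φ x ⟨k, hk⟩) with he
  set Φ₁ := Φ.transHomeomorph (Homeomorph.addRight e) with hΦ₁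
  have hap : ∀ y, Φ₁ y = Φ y + e := fun y => rfl
  have hs : IsSmoothChart Φ₁ := by
    refine ⟨?_, ?_⟩
    · exact hΦ.1.add contDiffOn_const
    · have h1 : ContDiffOn ℝ ∞ (fun y : E n => y - e) Φ₁.target :=
        (contDiff_id.sub contDiff_const).contDiffOn
      have h2 : ∀ y, (Homeomorph.addRight e).symm y = y - e := fun y => (sub_eq_add_neg y e).symm
      refine (hΦ.2.comp h1 fun y hy => ?_).congr fun y hy => ?_
      · simpa [hΦ₁, h2] using hy
      · simp [hΦ₁, h2]
  set O : Set (E n) := Φ₁.source ∩ Φ₁ ⁻¹' {y | 0 < y ⟨k, hk⟩} with hO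
  have hOo : IsOpen O := Φ₁.continuousOn.isOpen_inter_preimage Φ₁.open_source
    (isOpen_lt continuous_const (EuclideanSpace.proj _ : E n →L[ℝ] ℝ).continuous)
  have hflat : Flattens hk S (Φ₁.restrOpen O hOo) := by
    intro y hy
    rw [Φ₁.restrOpen_source] at hy
    have h1 : 0 < Φ₁ y ⟨k, hk⟩ := hy.2.2
    have h2 : Φ₁.restrOpen O hOo y = Φ₁ y := rfl
    rw [h2, hΦS y hy.1, and_iff_left h1]
    refine forall₂_congr fun i hi => ?_
    have h3 : i ≠ ⟨k, hk⟩ := fun h => by simp [h] at hi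
    simp [hap, he, h3]
  refine exists_isAdapted_of_flattens (hs.restr hOo) hflat ?_ (subset_closure hx)
  rw [Φ₁.restrOpen_source]
  refine ⟨hxΦ, hxΦ, ?_⟩
  simp [hap, he]

namespace FracturedDomain

/-- Around each point of a hypersurface piece in the boundary of a piece there is an adapted
chart. -/
lemma exists_isAdapted {n k : ℕ} (D : FracturedDomain n) (hk : k + 1 ≤ n) {i j : Fin D.N}
    (hi : D.dim i = k + 1) (hj : D.dim j = k) {x : E n} (hx : x ∈ D.S j) (hxi : x ∈ closure (D.S i)) :
    ∃ Φ : OpenPartialHomeomorph (E n) (E n), IsAdapted hk (D.S i) Φ ∧ x ∈ Φ.source := by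
  obtain ⟨Φ, hΦ, hxΦ, h⟩ := D.half_space i j (by omega) x ⟨hx, hxi⟩
  refine exists_isAdapted_of_flattens hΦ (fun y hy => ?_) hxΦ hxi
  rw [(h y hy).1, hi]
  refine and_congr Iff.rfl ⟨fun h => h ⟨k, hk⟩ rfl, fun h l hl => ?_⟩
  have : l = ⟨k, hk⟩ := Fin.ext (by simpa using hl)
  rwa [this]

end FracturedDomain

end Fractured

end

/-! ### Tangent spaces, normals and vector fields in adapted charts. -/

noncomputable section

namespace Fractured

open Filter Topology
open scoped ENNReal NNReal

lemma convex_upper (k : ℕ) : Convex ℝ (upper k) := by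
  intro x hx y hy a b ha hb hab
  simp only [upper, mem_ofPred_eq] at hx hy ⊢
  simp only [PiLp.add_apply, PiLp.smul_apply, smul_eq_mul]
  rcases ha.eq_or_lt with rfl | ha
  · have : b = 1 := by linarith
    subst this; linarith
  · have h1 := mul_pos ha hx
    have h2 := mul_nonneg hb hy.le
    linarith

lemma mem_closure_upper {k : ℕ} {z : E (k + 1)} (hz : 0 ≤ z (Fin.last k)) : z ∈ closure (upper k) := by
  have h1 : Tendsto (fun t : ℝ => z + t • EuclideanSpace.single (Fin.last k) (1 : ℝ)) (𝓝[>] 0) (𝓝 z) := by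
    have : Continuous fun t : ℝ => z + t • EuclideanSpace.single (Fin.last k) (1 : ℝ) := by fun_prop
    have h2 := this.tendsto 0
    simp only [zero_smul, add_zero] at h2
    exact h2.mono_left nhdsWithin_le_nhds
  refine mem_closure_of_tendsto h1 ?_
  filter_upwards [self_mem_nhdsWithin] with t ht
  have : (0 : ℝ) < t := ht
  simp only [upper, mem_ofPred_eq, PiLp.add_apply, PiLp.smul_apply, smul_eq_mul]
  simp
  linarith

lemma posTangentConeAt_upper {k : ℕ} {z u : E (k + 1)} (hz : 0 ≤ z (Fin.last k))
    (hu : 0 < u (Fin.last k)) : u ∈ posTangentConeAt (upper k) z := by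
  rw [posTangentConeAt, ← tangentConeAt_closure]
  refine mem_posTangentConeAt_of_segment_subset ?_
  rw [segment_eq_image']
  rintro _ ⟨t, ht, rfl⟩
  refine mem_closure_upper ?_
  have := mul_nonneg ht.1 hu.le
  simp
  linarith

/-- The representation of a vector field in a chart. -/
def pull {n d : ℕ} (hd : d ≤ n) (Φ : OpenPartialHomeomorph (E n) (E n)) (b : E n → E n) (z : E d) :
    E d :=
  fderiv ℝ (coord hd Φ) (param hd Φ z) (b (param hd Φ z))

lemma IsSmoothChart.contDiffOn_pull {n d : ℕ} {hd : d ≤ n} {Φ : OpenPartialHomeomorph (E n) (E n)}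
    (hΦ : IsSmoothChart Φ) {b : E n → E n} (hb : ContDiff ℝ ∞ b) :
    ContDiffOn ℝ ∞ (pull hd Φ b) (pdom hd Φ) := by
  have h1 : ContDiffOn ℝ ∞ (fderiv ℝ (coord hd Φ)) Φ.source :=
    hΦ.contDiffOn_coord.fderiv_of_isOpen Φ.open_source (by simp)
  exact (h1.comp hΦ.contDiffOn_param fun z hz => param_mem hz).clm_apply
    (hb.comp_contDiffOn hΦ.contDiffOn_param)

lemma surfDiv_eq_of_tangentSpace_eq {n : ℕ} {S : Set (E n)} {x : E n} {p : Submodule ℝ (E n)}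
    (h : tangentSpace S x = p) (b : E n → E n) : surfDiv S b x =
      LinearMap.trace ℝ (E n) (p.starProjection ∘L fderiv ℝ b x : E n →L[ℝ] E n) := by
  subst h
  rfl

namespace IsAdapted

variable {n k : ℕ} {hk : k + 1 ≤ n} {S : Set (E n)} {Φ : OpenPartialHomeomorph (E n) (E n)}

lemma param_mem_iff (h : IsAdapted hk S Φ) {z : E (k + 1)} (hz : z ∈ pdom hk Φ) :
    param hk Φ z ∈ S ↔ z ∈ upper k := by
  rw [h.flat _ (param_mem hz), apply_param hz]
  constructor
  · rintro ⟨-, h1⟩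
    rwa [incl_apply, dif_pos (Nat.lt_succ_self k)] at h1
  · intro h1
    refine ⟨fun i hi => ?_, ?_⟩
    · simp [incl_apply, not_lt.2 hi]
    · rw [incl_apply, dif_pos (Nat.lt_succ_self k)]
      exact h1

lemma param_face_mem_bdry (h : IsAdapted hk S Φ) {w : E k} (hw : face k w ∈ pdom hk Φ) :
    param hk Φ (face k w) ∈ bdry S := by
  rw [h.flat.mem_bdry_iff (param_mem hw), apply_param hw]
  intro i hi
  rw [face, incl_incl, incl_apply, dif_neg (not_lt.2 hi)]

lemma inter_source (h : IsAdapted hk S Φ) :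
    S ∩ Φ.source = param hk Φ '' (pdom hk Φ ∩ upper k) := by
  ext y
  constructor
  · rintro ⟨h1, h2⟩
    obtain ⟨h3, h4⟩ := param_coord (hd := hk) h2 ((h.flat y h2).1 h1).1
    refine ⟨_, ⟨h4, (h.param_mem_iff h4).1 ?_⟩, h3⟩
    rwa [h3]
  · rintro ⟨z, ⟨hz, hz'⟩, rfl⟩
    exact ⟨(h.param_mem_iff hz).2 hz', param_mem hz⟩

lemma bdry_inter_source (h : IsAdapted hk S Φ) :
    bdry S ∩ Φ.source = (fun w => param hk Φ (face k w)) '' (face k ⁻¹' pdom hk Φ) := by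
  ext y
  constructor
  · rintro ⟨h1, h2⟩
    have h3 := (h.flat.mem_bdry_iff h2).1 h1
    have h4 : incl hk (face k (projl k.le_succ (coord hk Φ y))) = Φ y := by
      rw [face, incl_incl]
      exact incl_projl (k.le_succ.trans hk) (Φ y) h3
    refine ⟨projl k.le_succ (coord hk Φ y), ?_, ?_⟩
    · change incl hk _ ∈ Φ.target
      rw [h4]; exact Φ.map_source h2
    · change Φ.symm (incl hk _) = y
      rw [h4, Φ.left_inv h2]
  · rintro ⟨w, hw, rfl⟩
    exact ⟨h.param_face_mem_bdry hw, param_mem hw⟩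

lemma tangentSpace_param (h : IsAdapted hk S Φ) {z : E (k + 1)} (hz : z ∈ pdom hk Φ)
    (hz0 : 0 ≤ z (Fin.last k)) :
    tangentSpace S (param hk Φ z) =
      LinearMap.range (fderiv ℝ (param hk Φ) z : E (k + 1) →ₗ[ℝ] E n) := by
  refine tangentSpace_eq_range (Q := upper k) (h.smooth.differentiableAt_param hz)
    (h.smooth.differentiableAt_coord (param_mem hz)) (coord_param hz) ?_ ?_ ?_
  · filter_upwards [self_mem_nhdsWithin, nhdsWithin_le_nhds (Φ.open_source.mem_nhds (param_mem hz))]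
      with y hy hy'
    exact (param_coord hy' ((h.flat y hy').1 hy).1).1
  · filter_upwards [self_mem_nhdsWithin, nhdsWithin_le_nhds (isOpen_pdom.mem_nhds hz)] with y hy hy'
    exact (h.param_mem_iff hy').2 hy
  · refine (convex_upper k).span_tangentConeAt ?_ (mem_closure_upper hz0)
    rw [(isOpen_upper k).interior_eq]
    exact ⟨EuclideanSpace.single (Fin.last k) 1, by simp [upper]⟩

lemma fderiv_param_face (h : IsAdapted hk S Φ) {w : E k} (hw : face k w ∈ pdom hk Φ) :
    fderiv ℝ (fun w => param hk Φ (face k w)) w =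
      fderiv ℝ (param hk Φ) (face k w) ∘L (face k).toContinuousLinearMap := by
  rw [fderiv_fun_comp w (h.smooth.differentiableAt_param hw) (face k).toContinuousLinearMap.differentiableAt]
  congr 1
  exact (face k).toContinuousLinearMap.fderiv

lemma tangentSpace_bdry_param (h : IsAdapted hk S Φ) {w : E k} (hw : face k w ∈ pdom hk Φ) :
    tangentSpace (bdry S) (param hk Φ (face k w)) = LinearMap.range
      (fderiv ℝ (param hk Φ) (face k w) ∘L (face k).toContinuousLinearMap :
        E k →L[ℝ] E n).toLinearMap := by
  rw [← h.fderiv_param_face hw]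
  have hc : face k ⁻¹' pdom hk Φ ∈ 𝓝 w :=
    (isOpen_pdom.preimage (face k).continuous).mem_nhds hw
  refine tangentSpace_eq_range (Ψ := fun w => param hk Φ (face k w)) (Q := univ)
    (Θ := fun y => projl k.le_succ (coord hk Φ y)) ?_ ?_ ?_ ?_ ?_ ?_
  · exact (h.smooth.differentiableAt_param hw).comp w (face k).toContinuousLinearMap.differentiableAt
  · exact (projl k.le_succ).differentiableAt.comp _ (h.smooth.differentiableAt_coord (param_mem hw))
  · rw [coord_param hw]; simp [face]
  · filter_upwards [self_mem_nhdsWithin, nhdsWithin_le_nhds (Φ.open_source.mem_nhds (param_mem hw))]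
      with y hy hy'
    have h3 := (h.flat.mem_bdry_iff hy').1 hy
    have h4 : incl hk (face k (projl k.le_succ (coord hk Φ y))) = Φ y := by
      rw [face, incl_incl]
      exact incl_projl (k.le_succ.trans hk) (Φ y) h3
    change Φ.symm (incl hk _) = y
    rw [h4, Φ.left_inv hy']
  · filter_upwards [nhdsWithin_le_nhds hc] with v hv using h.param_face_mem_bdry hv
  · simp

/-- `q` is the part of the image of the last coordinate vector that is orthogonal to the boundary,
and the normal is `-q / ‖q‖`. It points outward because the last coordinate is minimal on `S` at
boundary points: its derivative is nonnegative on the positive tangent cone, but is `-‖q‖⁻¹` along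
this vector. -/
lemma exists_isExteriorNormal (h : IsAdapted hk S Φ) {w : E k} (hw : face k w ∈ pdom hk Φ) :
    ∃ ν, IsExteriorNormal S (param hk Φ (face k w)) ν := by
  set A := fderiv ℝ (param hk Φ) (face k w) with hA
  have hinj : Function.Injective A := h.smooth.injective_fderiv_param hw
  set p := LinearMap.range (A ∘L (face k).toContinuousLinearMap : E k →L[ℝ] E n).toLinearMap with hp
  set e : E (k + 1) := EuclideanSpace.single (Fin.last k) 1 with he
  obtain ⟨z, hz⟩ : p.starProjection (A e) ∈ p := Submodule.starProjection_apply_mem _ _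
  have hz' : A (face k z) = p.starProjection (A e) := hz
  set q := A (e - face k z) with hq
  have hq' : q = A e - p.starProjection (A e) := by rw [hq, map_sub, hz']
  have hqp : q ∈ pᗮ := by
    rw [hq']; exact Submodule.sub_starProjection_mem_orthogonal _
  have hq0 : q ≠ 0 := by
    intro h0
    have h1 : e - face k z = 0 := hinj (by rw [map_zero]; exact h0)
    have h2 := congrArg (fun y : E (k + 1) => y (Fin.last k)) h1
    simp [he] at h2
  have hqn : 0 < ‖q‖ := norm_pos_iff.2 hq0
  have hν : -(‖q‖⁻¹ • q) = A (-(‖q‖⁻¹ • (e - face k z))) := by rw [map_neg, map_smul]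
  refine ⟨-(‖q‖⁻¹ • q), ?_, ?_, ?_, ?_⟩
  · rw [norm_neg, norm_smul, norm_inv, norm_norm, inv_mul_cancel₀ hqn.ne']
  · rw [h.tangentSpace_param hw (by simp), hν]
    exact ⟨_, rfl⟩
  · rw [h.tangentSpace_bdry_param hw]
    exact pᗮ.neg_mem (pᗮ.smul_mem _ hqp)
  · intro hcone
    set x := param hk Φ (face k w) with hx
    have hd := h.smooth.differentiableAt_coord (hd := hk) (param_mem hw)
    have hf : HasFDerivWithinAt (fun y => coord hk Φ y (Fin.last k))
        ((EuclideanSpace.proj (Fin.last k) : E (k + 1) →L[ℝ] ℝ) ∘L fderiv ℝ (coord hk Φ) x) S x :=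
      ((EuclideanSpace.proj (Fin.last k) : E (k + 1) →L[ℝ] ℝ).hasFDerivAt.comp x
        hd.hasFDerivAt).hasFDerivWithinAt
    have hmin : IsLocalMinOn (fun y => coord hk Φ y (Fin.last k)) S x := by
      have h0 : coord hk Φ x (Fin.last k) = 0 := by rw [hx, coord_param hw]; simp
      filter_upwards [self_mem_nhdsWithin,
        nhdsWithin_le_nhds (Φ.open_source.mem_nhds (param_mem hw))] with y hy hy'
      rw [h0]
      exact ((h.flat y hy').1 hy).2.le
    have h1 := hmin.hasFDerivWithinAt_nonneg hf hcone
    rw [hν] at h1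
    have h2 : fderiv ℝ (coord hk Φ) x (A (-(‖q‖⁻¹ • (e - face k z)))) = _ :=
      h.smooth.fderiv_coord_param hw _
    rw [ContinuousLinearMap.comp_apply, h2] at h1
    have h3 : (-(‖q‖⁻¹ • (e - face k z))) (Fin.last k) = - ‖q‖⁻¹ := by simp [he]
    have h4 : (0 : ℝ) ≤ (-(‖q‖⁻¹ • (e - face k z))) (Fin.last k) := h1
    rw [h3] at h4
    have := inv_pos.2 hqn
    linarith

/-- Only the defining properties of the chosen `normal` are used. Its preimage has a nonpositive
last coordinate, for otherwise it would lie in the positive tangent cone, and this fixes the sign in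
the last claim. -/
lemma normal_param (h : IsAdapted hk S Φ) {w : E k} (hw : face k w ∈ pdom hk Φ) :
    ‖normal S (param hk Φ (face k w))‖ = 1 ∧
    normal S (param hk Φ (face k w)) ∈
      LinearMap.range (fderiv ℝ (param hk Φ) (face k w) : E (k + 1) →ₗ[ℝ] E n) ∧
    (∀ z, inner ℝ (normal S (param hk Φ (face k w)))
      (fderiv ℝ (param hk Φ) (face k w) (face k z)) = 0) ∧
    inner ℝ (normal S (param hk Φ (face k w))) (fderiv ℝ (param hk Φ) (face k w)
      (EuclideanSpace.single (Fin.last k) 1)) < 0 := by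
  obtain ⟨h1, h2, h3, h4⟩ : IsExteriorNormal S (param hk Φ (face k w))
    (normal S (param hk Φ (face k w))) := Classical.epsilon_spec (h.exists_isExteriorNormal hw)
  set ν := normal S (param hk Φ (face k w))
  set A := fderiv ℝ (param hk Φ) (face k w) with hA
  rw [h.tangentSpace_param hw (by simp)] at h2
  rw [h.tangentSpace_bdry_param hw] at h3
  have h5 : ∀ z, inner ℝ ν (A (face k z)) = 0 := fun z =>
    Submodule.inner_left_of_mem_orthogonal (LinearMap.mem_range_self _ z) h3
  refine ⟨h1, h2, h5, ?_⟩
  obtain ⟨u, hu⟩ := h2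
  have hu' : A u = ν := hu
  have hu0 : u (Fin.last k) ≤ 0 := by
    by_contra! hpos
    refine h4 ?_
    rw [← hu']
    refine mapsTo_posTangentConeAt (h.smooth.differentiableAt_param hw) ?_
      (posTangentConeAt_upper (by simp) hpos)
    filter_upwards [self_mem_nhdsWithin, nhdsWithin_le_nhds (isOpen_pdom.mem_nhds hw)] with y hy hy'
    exact (h.param_mem_iff hy').2 hy
  have h6 : inner ℝ ν (A u) = 1 := by rw [hu', real_inner_self_eq_norm_sq, h1, one_pow]
  rw [← face_projl_add u, map_add, map_smul, inner_add_right, h5, zero_add, inner_smul_right] at h6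
  by_contra! hcon
  have := mul_nonpos_of_nonpos_of_nonneg hu0 hcon
  linarith

/-- Tangentiality is assumed on `S` only. It reaches the boundary points of the chart by continuity.
-/
lemma fderiv_param_pull (h : IsAdapted hk S Φ) {b : E n → E n} (hb : ContDiff ℝ ∞ b)
    (hbt : ∀ x ∈ S, b x ∈ tangentSpace S x) {z : E (k + 1)} (hz : z ∈ pdom hk Φ)
    (hz0 : 0 ≤ z (Fin.last k)) :
    fderiv ℝ (param hk Φ) z (pull hk Φ b z) = b (param hk Φ z) := by
  have h1 : ∀ y ∈ pdom hk Φ ∩ upper k,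
      fderiv ℝ (param hk Φ) y (pull hk Φ b y) = b (param hk Φ y) := by
    rintro y ⟨hy, hy'⟩
    have h2 := hbt _ ((h.param_mem_iff hy).2 hy')
    rw [h.tangentSpace_param hy (le_of_lt hy')] at h2
    obtain ⟨u, hu⟩ := h2
    have hu' : fderiv ℝ (param hk Φ) y u = b (param hk Φ y) := hu
    rw [pull, ← hu', h.smooth.fderiv_coord_param hy]
  have hc1 : ContinuousOn (fun y => fderiv ℝ (param hk Φ) y (pull hk Φ b y)) (pdom hk Φ) :=
    ((h.smooth.contDiffOn_param.continuousOn_fderiv_of_isOpen isOpen_pdom (by simp))).clm_apply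
      (h.smooth.contDiffOn_pull hb).continuousOn
  have hc2 : ContinuousOn (fun y => b (param hk Φ y)) (pdom hk Φ) :=
    hb.continuous.comp_continuousOn h.smooth.contDiffOn_param.continuousOn
  have hne : (𝓝[upper k] z).NeBot := mem_closure_iff_nhdsWithin_neBot.1 (mem_closure_upper hz0)
  have ht1 := ((hc1.continuousAt (isOpen_pdom.mem_nhds hz)).tendsto).mono_left
    (nhdsWithin_le_nhds (s := upper k))
  have ht2 := ((hc2.continuousAt (isOpen_pdom.mem_nhds hz)).tendsto).mono_left
    (nhdsWithin_le_nhds (s := upper k))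
  refine tendsto_nhds_unique (ht1.congr' ?_) ht2
  filter_upwards [self_mem_nhdsWithin, nhdsWithin_le_nhds (isOpen_pdom.mem_nhds hz)] with y hy hy'
  exact h1 y ⟨hy', hy⟩

/-- The normal component of a tangential field in an adapted chart. -/
lemma jac_mul_inner_normal (h : IsAdapted hk S Φ) {b : E n → E n} (hb : ContDiff ℝ ∞ b)
    (hbt : ∀ x ∈ S, b x ∈ tangentSpace S x) {w : E k} (hw : face k w ∈ pdom hk Φ) :
    jac (fun w => param hk Φ (face k w)) w *
      inner ℝ (normal S (param hk Φ (face k w))) (b (param hk Φ (face k w))) =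
    -(pull hk Φ b (face k w) (Fin.last k) * jac (param hk Φ) (face k w)) := by
  obtain ⟨h1, h2, h3, h4⟩ := h.normal_param hw
  rw [← h.fderiv_param_pull hb hbt hw (by simp)]
  set A := fderiv ℝ (param hk Φ) (face k w) with hA
  set ν := normal S (param hk Φ (face k w))
  have hJ : jac (param hk Φ) (face k w) = _ := normDet_eq_inner_mul A h1 h2 h3
  -- The last coordinate vector points inward, so the absolute value in the height formula produces
  -- the minus sign.
  rw [hJ, abs_of_neg h4, jac, h.fderiv_param_face hw]
  set u := pull hk Φ b (face k w)
  have h5 : inner ℝ ν (A u) = u (Fin.last k) * inner ℝ ν (A (EuclideanSpace.single (Fin.last k) 1)) := by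
    conv_lhs => rw [← face_projl_add u, map_add, map_smul, inner_add_right, h3, zero_add,
      inner_smul_right]
  rw [h5]
  ring

/-- The right side is the Euclidean divergence of `(jac * φ) • pull`. A test function `φ` on the
piece thus corresponds to `f = jac * φ` in the chart, where the balance law becomes the flat one. -/
lemma jac_mul_surfDiv (h : IsAdapted hk S Φ) {b : E n → E n} (hb : ContDiff ℝ ∞ b)
    (hbt : ∀ x ∈ S, b x ∈ tangentSpace S x) {z : E (k + 1)} (hz : z ∈ pdom hk Φ)
    (hz0 : z ∈ upper k) {φ : E n → ℝ} (hφ : ContDiff ℝ 1 φ) :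
    jac (param hk Φ) z * surfDiv S (fun y => φ y • b y) (param hk Φ z) =
      fderiv ℝ (fun z => jac (param hk Φ) z * φ (param hk Φ z)) z (pull hk Φ b z) +
        jac (param hk Φ) z * φ (param hk Φ z) * dvg (pull hk Φ b) z := by
  have hB : DifferentiableAt ℝ (pull hk Φ b) z :=
    ((h.smooth.contDiffOn_pull hb).contDiffAt (isOpen_pdom.mem_nhds hz)).differentiableAt (by simp)
  have hP := h.smooth.differentiableAt_param hz
  have hφP : DifferentiableAt ℝ (fun z => φ (param hk Φ z)) z :=
    (hφ.differentiable one_ne_zero _).comp z hP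
  have hJ : DifferentiableAt ℝ (jac (param hk Φ)) z :=
    (h.smooth.contDiffOn_jac_param.contDiffAt (isOpen_pdom.mem_nhds hz)).differentiableAt (by simp)
  have key := jac_mul_trace_eq (Ψ := param hk Φ) (y := z) (b := fun y => φ y • b y)
    (B := fun y => φ (param hk Φ y) • pull hk Φ b y)
    ((h.smooth.contDiffOn_param.contDiffAt (isOpen_pdom.mem_nhds hz)).of_le (by norm_cast))
    (h.smooth.injective_fderiv_param hz)
    ((hφ.differentiable one_ne_zero _).smul (hb.differentiable (by simp) _)) (hφP.smul hB) ?_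
  · rw [surfDiv_eq_of_tangentSpace_eq (h.tangentSpace_param hz (le_of_lt hz0)), key, dvg_smul hφP hB, map_smul,
      fderiv_fun_mul hJ hφP]
    simp only [_root_.add_apply, _root_.smul_apply, smul_eq_mul]
    ring
  · filter_upwards [isOpen_pdom.mem_nhds hz, (isOpen_upper k).mem_nhds hz0] with y hy hy0
    rw [map_smul, h.fderiv_param_pull hb hbt hy (le_of_lt hy0)]

end IsAdapted

end Fractured

end

/-! ### Transfer of the trace identity to the chart, and renormalization there. -/

noncomputable section

namespace Fractured

open Filter Topology
open scoped ENNReal NNReal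

lemma surfDiv_eq_zero_of_notMem_tsupport {n : ℕ} {S : Set (E n)} {b : E n → E n} {φ : E n → ℝ}
    {x : E n} (hx : x ∉ tsupport φ) : surfDiv S (fun y => φ y • b y) x = 0 := by
  have h1 : fderiv ℝ (fun y => φ y • b y) x = 0 :=
    fderiv_eq_zero_of_notMem_tsupport fun h => hx (tsupport_smul_subset' φ b h)
  rw [surfDiv, h1]
  simp

namespace IsAdapted

variable {n k : ℕ} {hk : k + 1 ≤ n} {S : Set (E n)} {Φ : OpenPartialHomeomorph (E n) (E n)}

lemma contDiffOn_param_one (h : IsAdapted hk S Φ) :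
    ContDiffOn ℝ 1 (param hk Φ) (pdom hk Φ) :=
  h.smooth.contDiffOn_param.of_le (by norm_cast)

lemma measurableSet_pdom_upper : MeasurableSet (pdom hk Φ ∩ upper k) :=
  isOpen_pdom.measurableSet.inter (measurableSet_upper k)

lemma isOpen_face_pdom : IsOpen (face k ⁻¹' pdom hk Φ) :=
  isOpen_pdom.preimage (face k).continuous

lemma contDiffOn_param_face (h : IsAdapted hk S Φ) :
    ContDiffOn ℝ 1 (fun w => param hk Φ (face k w)) (face k ⁻¹' pdom hk Φ) :=
  h.contDiffOn_param_one.comp (face k).contDiff.contDiffOn fun _ hw => hw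

lemma injective_fderiv_param_face (h : IsAdapted hk S Φ) {w : E k} (hw : face k w ∈ pdom hk Φ) :
    Function.Injective (fderiv ℝ (fun w => param hk Φ (face k w)) w) := by
  rw [h.fderiv_param_face hw]
  exact (h.smooth.injective_fderiv_param hw).comp (face k).injective

lemma injOn_param_face :
    InjOn (fun w => param hk Φ (face k w)) (face k ⁻¹' pdom hk Φ) := fun _ hw _ hw' hww =>
  (face k).injective (injOn_param hw hw' hww)

lemma setIntegral_eq (h : IsAdapted hk S Φ) (hS : MeasurableSet S) {f : E n → ℝ}
    (hf : ∀ x ∉ Φ.source, f x = 0) :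
    ∫ x in S, f x ∂μHE[k + 1] = ∫ z in pdom hk Φ ∩ upper k, jac (param hk Φ) z * f (param hk Φ z) := by
  rw [setIntegral_eq_of_subset_of_forall_sdiff_eq_zero hS (inter_subset_left (t := Φ.source))
    (fun x hx => hf x fun h' => hx.2 ⟨hx.1, h'⟩), h.inter_source]
  exact integral_image_jac isOpen_pdom h.contDiffOn_param_one
    (fun y hy => h.smooth.injective_fderiv_param hy) injOn_param measurableSet_pdom_upper
    inter_subset_left f

lemma setIntegral_bdry_eq (h : IsAdapted hk S Φ) (hS : MeasurableSet (bdry S)) {f : E n → ℝ}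
    (hf : ∀ x ∉ Φ.source, f x = 0) :
    ∫ x in bdry S, f x ∂μHE[k] = ∫ w in face k ⁻¹' pdom hk Φ,
      jac (fun w => param hk Φ (face k w)) w * f (param hk Φ (face k w)) := by
  rw [setIntegral_eq_of_subset_of_forall_sdiff_eq_zero hS (inter_subset_left (t := Φ.source))
    (fun x hx => hf x fun h' => hx.2 ⟨hx.1, h'⟩), h.bdry_inter_source]
  exact integral_image_jac isOpen_face_pdom h.contDiffOn_param_face
    (fun y hy => h.injective_fderiv_param_face hy) injOn_param_face isOpen_face_pdom.measurableSet
    Subset.rfl f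

/-- This is where the lower bound of the Jacobian is needed. The map `ι` will be the identity or the
inclusion of the boundary plane. -/
lemma integrableOn_of_jac_mul (h : IsAdapted hk S Φ) {X : Type*} [TopologicalSpace X]
    [MeasurableSpace X] [OpensMeasurableSpace X] {μ : Measure X} {ι : X → E (k + 1)} {T : Set X}
    (hT : MeasurableSet T) (hι : ContinuousOn ι T) (hTι : MapsTo ι T (pdom hk Φ)) {f : X → ℝ}
    (hf : IntegrableOn (fun x => jac (param hk Φ) (ι x) * f x) T μ) : IntegrableOn f T μ := by
  obtain ⟨c, hc, hcJ⟩ := h.jac_lb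
  have hJc : ContinuousOn (fun x => (jac (param hk Φ) (ι x))⁻¹) T :=
    ((h.smooth.contDiffOn_jac_param.continuousOn).comp hι hTι).inv₀ fun x hx =>
      (hc.trans_le (hcJ _ (hTι hx))).ne'
  have h1 := Integrable.bdd_mul (c := c⁻¹) hf (hJc.aestronglyMeasurable hT) (by
    filter_upwards [ae_restrict_mem hT] with x hx
    have h2 := hcJ _ (hTι hx)
    rw [norm_inv, Real.norm_eq_abs, abs_of_pos (hc.trans_le h2)]
    exact inv_anti₀ hc h2)
  refine (integrable_congr ?_).1 h1
  filter_upwards [ae_restrict_mem hT] with x hx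
  have h2 := (hc.trans_le (hcJ _ (hTι hx))).ne'
  field_simp

lemma integrableOn_param (h : IsAdapted hk S Φ) {f : E n → ℝ} (hf : IntegrableOn f S μHE[k + 1]) :
    IntegrableOn (fun z => f (param hk Φ z)) (pdom hk Φ ∩ upper k) := by
  have h1 := hf.mono_set (inter_subset_left (t := Φ.source))
  rw [h.inter_source, integrableOn_image_jac isOpen_pdom h.contDiffOn_param_one
    (fun y hy => h.smooth.injective_fderiv_param hy) injOn_param measurableSet_pdom_upper
    inter_subset_left f] at h1
  exact h.integrableOn_of_jac_mul measurableSet_pdom_upper continuousOn_id (fun z hz => hz.1) h1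

lemma integrableOn_param_face (h : IsAdapted hk S Φ) {b : E n → E n} (hb : ContDiff ℝ ∞ b)
    (hbt : ∀ x ∈ S, b x ∈ tangentSpace S x) {τ : E n → ℝ}
    (hτ : IntegrableOn (fun x => inner ℝ (normal S x) (b x) * τ x) (bdry S) μHE[k]) :
    IntegrableOn (fun w => pull hk Φ b (face k w) (Fin.last k) * τ (param hk Φ (face k w)))
      (face k ⁻¹' pdom hk Φ) := by
  have h1 := hτ.mono_set (inter_subset_left (t := Φ.source))
  rw [h.bdry_inter_source, integrableOn_image_jac isOpen_face_pdom h.contDiffOn_param_face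
    (fun y hy => h.injective_fderiv_param_face hy) injOn_param_face isOpen_face_pdom.measurableSet
    Subset.rfl] at h1
  refine h.integrableOn_of_jac_mul (ι := face k) isOpen_face_pdom.measurableSet
    (face k).continuous.continuousOn (fun z hz => hz) ?_
  refine h1.neg.congr_fun (fun w hw => ?_) isOpen_face_pdom.measurableSet
  have h2 := h.jac_mul_inner_normal hb hbt hw
  simp only [Pi.neg_apply]
  rw [← mul_assoc, h2]
  ring

/-- The trace functional in an adapted chart. -/
lemma transfer (h : IsAdapted hk S Φ) (hS : MeasurableSet S)
    {b : E n → E n} (hb : ContDiff ℝ ∞ b)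
    (hbt : ∀ x ∈ S, b x ∈ tangentSpace S x) {v g : E n → ℝ} {φ : E n → ℝ} (hφ : ContDiff ℝ 1 φ)
    (hφs : tsupport φ ⊆ Φ.source) {f : E (k + 1) → ℝ}
    (hfφ : ∀ z ∈ pdom hk Φ, f z = jac (param hk Φ) z * φ (param hk Φ z))
    (hgi : IntegrableOn (fun z => g (param hk Φ z) * f z) (pdom hk Φ ∩ upper k))
    (hvi : IntegrableOn (fun z => v (param hk Φ z) *
      (fderiv ℝ f z (pull hk Φ b z) + f z * dvg (pull hk Φ b) z)) (pdom hk Φ ∩ upper k)) :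
    ∫ x in S, g x * φ x ∂μHE[k + 1] + ∫ x in S, v x * surfDiv S (fun y => φ y • b y) x ∂μHE[k + 1] =
      ∫ z in pdom hk Φ ∩ upper k, (g (param hk Φ z) * f z + v (param hk Φ z) *
        (fderiv ℝ f z (pull hk Φ b z) + f z * dvg (pull hk Φ b) z)) := by
  have hφ0 : ∀ x ∉ Φ.source, φ x = 0 := fun x hx =>
    image_eq_zero_of_notMem_tsupport (f := φ) fun h' => hx (hφs h')
  rw [h.setIntegral_eq hS (fun x hx => by rw [hφ0 x hx, mul_zero]),
    h.setIntegral_eq hS (fun x hx => by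
      rw [surfDiv_eq_zero_of_notMem_tsupport fun h' => hx (hφs h'), mul_zero]),
    integral_add hgi hvi]
  congr 1
  · refine setIntegral_congr_fun measurableSet_pdom_upper fun z hz => ?_
    rw [hfφ z hz.1]; ring
  · refine setIntegral_congr_fun measurableSet_pdom_upper fun z hz => ?_
    have h1 := h.jac_mul_surfDiv hb hbt hz.1 hz.2 hφ
    have h2 : f =ᶠ[𝓝 z] fun z => jac (param hk Φ) z * φ (param hk Φ z) := by
      filter_upwards [isOpen_pdom.mem_nhds hz.1] with y hy using hfφ y hy
    rw [h2.fderiv_eq, hfφ z hz.1, ← h1]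
    ring

lemma transfer_bdry (h : IsAdapted hk S Φ) (hS : MeasurableSet (bdry S))
    {b : E n → E n} (hb : ContDiff ℝ ∞ b)
    (hbt : ∀ x ∈ S, b x ∈ tangentSpace S x) {τ φ : E n → ℝ}
    (hφs : tsupport φ ⊆ Φ.source) {f : E (k + 1) → ℝ}
    (hfφ : ∀ z ∈ pdom hk Φ, f z = jac (param hk Φ) z * φ (param hk Φ z)) :
    ∫ x in bdry S, inner ℝ (normal S x) (b x) * τ x * φ x ∂μHE[k] =
      - ∫ w in face k ⁻¹' pdom hk Φ, pull hk Φ b (face k w) (Fin.last k) *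
        τ (param hk Φ (face k w)) * f (face k w) := by
  have hφ0 : ∀ x ∉ Φ.source, φ x = 0 := fun x hx =>
    image_eq_zero_of_notMem_tsupport (f := φ) fun h' => hx (hφs h')
  rw [h.setIntegral_bdry_eq hS (fun x hx => by rw [hφ0 x hx, mul_zero]), ← integral_neg]
  refine setIntegral_congr_fun isOpen_face_pdom.measurableSet fun w hw => ?_
  have h2 := h.jac_mul_inner_normal hb hbt hw
  simp only
  rw [hfφ _ hw, ← mul_assoc, ← mul_assoc, h2]
  ring

/-- The trace is defined through smooth test functions of the ambient space. A test function of the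
chart is divided by the Jacobian, extended constantly in the transverse coordinates, and cut off
inside the chart. -/
lemma exists_test_function (h : IsAdapted hk S Φ) {f : E (k + 1) → ℝ} (hf : ContDiff ℝ ∞ f)
    (hfc : HasCompactSupport f) (hfs : tsupport f ⊆ pdom hk Φ) :
    ∃ φ : E n → ℝ, ContDiff ℝ ∞ φ ∧ HasCompactSupport φ ∧ tsupport φ ⊆ Φ.source ∧
      ∀ z ∈ pdom hk Φ, f z = jac (param hk Φ) z * φ (param hk Φ z) := by
  classical
  obtain ⟨c, hc, hcJ⟩ := h.jac_lb
  set f₁ : E (k + 1) → ℝ := fun z => f z / jac (param hk Φ) z with hf₁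
  have hf₁s : ContDiff ℝ ∞ f₁ := by
    refine contDiff_of_tsupport_subset isOpen_pdom
      (hf.contDiffOn.div h.smooth.contDiffOn_jac_param fun z hz =>
        (hc.trans_le (hcJ z hz)).ne') ((closure_mono (show Function.support f₁ ⊆ Function.support f
        from fun z hz h0 => hz (by simp [hf₁, h0]))).trans hfs)
  obtain ⟨χ, hχ, hχc, hχs, hχ1, -⟩ := exists_cutoff (hfc.isCompact.image (continuous_incl hk))
    Φ.open_target (by rintro _ ⟨z, hz, rfl⟩; exact hfs hz)
  set F : E n → ℝ := fun w => χ w * f₁ (projl hk w) with hF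
  have hFs : ContDiff ℝ ∞ F := hχ.mul (hf₁s.comp (projl hk).contDiff)
  have hFc : HasCompactSupport F := hχc.mul_right
  have hFt : tsupport F ⊆ Φ.target := (tsupport_mul_subset_left).trans hχs
  set L := Φ.symm '' tsupport F with hL
  have hLc : IsCompact L := hFc.isCompact.image_of_continuousOn (Φ.continuousOn_symm.mono hFt)
  have hLs : L ⊆ Φ.source := by
    rintro _ ⟨w, hw, rfl⟩; exact Φ.map_target (hFt hw)
  set φ : E n → ℝ := Φ.source.indicator fun x => F (Φ x) with hφ
  have hφL : tsupport φ ⊆ L := by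
    refine closure_minimal (fun x hx => ?_) hLc.isClosed
    have h1 : x ∈ Φ.source := by
      by_contra h1; exact hx (indicator_of_notMem h1 _)
    refine ⟨Φ x, ?_, Φ.left_inv h1⟩
    have h2 : φ x = F (Φ x) := indicator_of_mem h1 _
    refine subset_closure (fun h0 => hx ?_)
    rw [h2]; exact h0
  refine ⟨φ, ?_, HasCompactSupport.of_support_subset_isCompact hLc (subset_closure.trans hφL),
    hφL.trans hLs, fun z hz => ?_⟩
  · refine contDiff_of_tsupport_subset Φ.open_source ?_ (hφL.trans hLs)
    refine (hFs.comp_contDiffOn h.smooth.1).congr fun x hx => ?_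
    exact indicator_of_mem hx _
  · have h1 : φ (param hk Φ z) = F (Φ (param hk Φ z)) := indicator_of_mem (param_mem hz) _
    have h2 := (hc.trans_le (hcJ z hz)).ne'
    rw [h1, apply_param hz, hF]
    simp only [projl_incl, hf₁]
    by_cases hz' : z ∈ tsupport f
    · have h3 : χ (incl hk z) = 1 := (hχ1.self_of_nhdsSet) _ ⟨z, hz', rfl⟩
      rw [h3]
      field_simp
    · rw [image_eq_zero_of_notMem_tsupport (f := f) hz']
      simp

/-- The converse passage, for `C¹` functions, since the cutoffs around singular sets are used only
as `C¹` functions. -/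
lemma exists_pullback_function (h : IsAdapted hk S Φ) {φ : E n → ℝ} (hφ : ContDiff ℝ 1 φ)
    (hφc : HasCompactSupport φ) (hφs : tsupport φ ⊆ Φ.source) :
    ∃ f : E (k + 1) → ℝ, ContDiff ℝ 1 f ∧ HasCompactSupport f ∧ tsupport f ⊆ pdom hk Φ ∧
      ∀ z ∈ pdom hk Φ, f z = jac (param hk Φ) z * φ (param hk Φ z) := by
  classical
  set L : Set (E (k + 1)) := incl hk ⁻¹' (Φ '' tsupport φ) with hL
  have hLc : IsCompact L := (incl hk).isometry.isClosedEmbedding.isCompact_preimage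
    (hφc.isCompact.image_of_continuousOn (Φ.continuousOn.mono hφs))
  have hLs : L ⊆ pdom hk Φ := by
    rintro z ⟨x, hx, hxz⟩
    change incl hk z ∈ Φ.target
    rw [← hxz]; exact Φ.map_source (hφs hx)
  set f : E (k + 1) → ℝ := (pdom hk Φ).indicator fun z => jac (param hk Φ) z * φ (param hk Φ z)
    with hf
  have hfe : ∀ z ∈ pdom hk Φ, f z = jac (param hk Φ) z * φ (param hk Φ z) := fun z hz =>
    indicator_of_mem hz _
  have hfL : tsupport f ⊆ L := by
    refine closure_minimal (fun z hz => ?_) hLc.isClosed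
    have h1 : z ∈ pdom hk Φ := by
      by_contra h1; exact hz (indicator_of_notMem h1 _)
    refine ⟨param hk Φ z, subset_closure fun h0 => hz ?_, apply_param h1⟩
    rw [hfe z h1, h0, mul_zero]
  refine ⟨f, ?_, HasCompactSupport.of_support_subset_isCompact hLc (subset_closure.trans hfL),
    hfL.trans hLs, hfe⟩
  refine contDiff_of_tsupport_subset isOpen_pdom ?_ (hfL.trans hLs)
  exact ((h.smooth.contDiffOn_jac_param.of_le (by norm_cast)).mul
    (hφ.comp_contDiffOn h.contDiffOn_param_one)).congr hfe

lemma continuousOn_dvg_pull (h : IsAdapted hk S Φ) {b : E n → E n} (hb : ContDiff ℝ ∞ b) :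
    ContinuousOn (fun z => dvg (pull hk Φ b) z) (pdom hk Φ) := by
  have h1 : ContinuousOn (fderiv ℝ (pull hk Φ b)) (pdom hk Φ) :=
    (h.smooth.contDiffOn_pull hb).continuousOn_fderiv_of_isOpen isOpen_pdom (by simp)
  have h2 : Continuous fun A : E (k + 1) →L[ℝ] E (k + 1) =>
      LinearMap.trace ℝ (E (k + 1)) (A : E (k + 1) →ₗ[ℝ] E (k + 1)) :=
    ((LinearMap.trace ℝ (E (k + 1))) ∘ₗ
      (ContinuousLinearMap.coeLM ℝ : (E (k + 1) →L[ℝ] E (k + 1)) →ₗ[ℝ] _)).continuous_of_finiteDimensional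
  exact h2.comp_continuousOn h1

lemma exists_bound_flatDiv (h : IsAdapted hk S Φ) {b : E n → E n} (hb : ContDiff ℝ ∞ b)
    {f : E (k + 1) → ℝ} (hf : ContDiff ℝ 1 f) (hfc : HasCompactSupport f)
    (hfs : tsupport f ⊆ pdom hk Φ) :
    Continuous (fun z => fderiv ℝ f z (pull hk Φ b z) + f z * dvg (pull hk Φ b) z) ∧
      HasCompactSupport (fun z => fderiv ℝ f z (pull hk Φ b z) + f z * dvg (pull hk Φ b) z) := by
  set F := fun z => fderiv ℝ f z (pull hk Φ b z) + f z * dvg (pull hk Φ b) z with hF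
  have hsub : tsupport F ⊆ tsupport f := by
    refine closure_minimal (fun z hz => ?_) (isClosed_tsupport f)
    by_contra h1
    refine hz ?_
    simp [hF, fderiv_eq_zero_of_notMem_tsupport h1, image_eq_zero_of_notMem_tsupport (f := f) h1]
  have hB := h.smooth.contDiffOn_pull (hd := hk) hb
  have hdB := h.continuousOn_dvg_pull hb
  have hFc : ContinuousOn F (pdom hk Φ) :=
    ((hf.continuous_fderiv one_ne_zero).continuousOn.clm_apply hB.continuousOn).add
      (hf.continuous.continuousOn.mul hdB)
  refine ⟨?_, hfc.mono' (subset_closure.trans hsub)⟩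
  exact (contDiff_of_tsupport_subset (n := 0) isOpen_pdom (contDiffOn_zero.2 hFc)
    (hsub.trans hfs)).continuous

/-- Renormalization in an adapted chart. -/
theorem renormalization (h : IsAdapted hk S Φ) (hS : MeasurableSet S) (hS' : MeasurableSet (bdry S))
    {b : E n → E n} (hb : ContDiff ℝ ∞ b) (hbt : ∀ x ∈ S, b x ∈ tangentSpace S x)
    {v g τ : E n → ℝ} (hv : IntegrableOn v S μHE[k + 1]) (hg : IntegrableOn g S μHE[k + 1])
    (hτ : IntegrableOn (fun x => inner ℝ (normal S x) (b x) * τ x) (bdry S) μHE[k])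
    (htr : HasTrace (k + 1) S b v g τ) {q : ℝ → ℝ} (hq : ContDiff ℝ 1 q) {C C' : ℝ}
    (hqC : ∀ t, |q t| ≤ C) (hqC' : ∀ t, |deriv q t| ≤ C') {φ : E n → ℝ} (hφ : ContDiff ℝ 1 φ)
    (hφc : HasCompactSupport φ) (hφs : tsupport φ ⊆ Φ.source) :
    ∫ x in S, deriv q (v x) * g x * φ x ∂μHE[k + 1] +
        ∫ x in S, q (v x) * surfDiv S (fun y => φ y • b y) x ∂μHE[k + 1] =
      ∫ x in bdry S, inner ℝ (normal S x) (b x) * q (τ x) * φ x ∂μHE[k] := by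
  have hv' := h.integrableOn_param hv
  have hg' := h.integrableOn_param hg
  have hbd : ∀ {f : E (k + 1) → ℝ}, Continuous f → HasCompactSupport f → ∃ M, ∀ z, ‖f z‖ ≤ M :=
    fun hf hfc => hfc.exists_bound_of_continuous hf
  -- The weak trace identity in flat form: each smooth test function of the chart is lifted to the
  -- ambient space, where the hypothesis applies.
  have hid : ∀ f : E (k + 1) → ℝ, ContDiff ℝ ∞ f → HasCompactSupport f → tsupport f ⊆ pdom hk Φ →
      ∫ z in pdom hk Φ ∩ upper k, (g (param hk Φ z) * f z + v (param hk Φ z) *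
        (fderiv ℝ f z (pull hk Φ b z) + f z * dvg (pull hk Φ b) z)) =
      - ∫ w in face k ⁻¹' pdom hk Φ, pull hk Φ b (face k w) (Fin.last k) *
        τ (param hk Φ (face k w)) * f (face k w) := by
    intro f hf hfc hfs
    obtain ⟨φ, hφ, hφc, hφs, hfφ⟩ := h.exists_test_function hf hfc hfs
    obtain ⟨M, hM⟩ := hbd hf.continuous hfc
    obtain ⟨hFc, hFs⟩ := h.exists_bound_flatDiv hb (hf.of_le (by norm_cast)) hfc hfs
    obtain ⟨M', hM'⟩ := hbd hFc hFs
    rw [← h.transfer hS hb hbt (hφ.of_le (by norm_cast)) hφs hfφ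
      (hg'.mul_bdd (c := M) hf.continuous.aestronglyMeasurable (Eventually.of_forall hM))
      (hv'.mul_bdd (c := M') hFc.aestronglyMeasurable (Eventually.of_forall hM')),
      ← h.transfer_bdry hS' hb hbt hφs hfφ]
    exact htr φ hφ hφc
  obtain ⟨f, hf, hfc, hfs, hfφ⟩ := h.exists_pullback_function hφ hφc hφs
  obtain ⟨M, hM⟩ := hbd hf.continuous hfc
  obtain ⟨hFc, hFs⟩ := h.exists_bound_flatDiv hb hf hfc hfs
  have hqm : AEStronglyMeasurable (fun z => q (v (param hk Φ z)))
      (volume.restrict (pdom hk Φ ∩ upper k)) :=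
    hq.continuous.comp_aestronglyMeasurable hv'.aestronglyMeasurable
  have hqm' : AEStronglyMeasurable (fun z => deriv q (v (param hk Φ z)))
      (volume.restrict (pdom hk Φ ∩ upper k)) :=
    (hq.continuous_deriv le_rfl).comp_aestronglyMeasurable hv'.aestronglyMeasurable
  have i1 : IntegrableOn (fun z => deriv q (v (param hk Φ z)) * g (param hk Φ z))
      (pdom hk Φ ∩ upper k) :=
    Integrable.bdd_mul (c := C') hg' hqm' (Eventually.of_forall fun z => hqC' _)
  have i2 : IntegrableOn (fun z => q (v (param hk Φ z)) *
      (fderiv ℝ f z (pull hk Φ b z) + f z * dvg (pull hk Φ b) z)) (pdom hk Φ ∩ upper k) :=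
    Integrable.bdd_mul (c := C) (hFc.integrable_of_hasCompactSupport hFs).integrableOn hqm
      (Eventually.of_forall fun z => hqC _)
  rw [h.transfer (v := fun x => q (v x)) (g := fun x => deriv q (v x) * g x) hS hb hbt hφ hφs hfφ
      (i1.mul_bdd (c := M) hf.continuous.aestronglyMeasurable (Eventually.of_forall hM)) i2,
    h.transfer_bdry (τ := fun x => q (τ x)) hS' hb hbt hφs hfφ]
  exact flat_renormalization_on isOpen_pdom (h.smooth.contDiffOn_pull hb) hv' hg'
    (h.integrableOn_param_face hb hbt hτ) hid hq hqC hqC' hf hfc hfs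

end IsAdapted

end Fractured

end

/-! ### Cutoff functions around sets of Hausdorff measure zero. -/

noncomputable section

namespace Fractured

open Filter Topology
open scoped ENNReal NNReal

/-- Measure zero gives countable covers with small sums of powers of diameters. Each set that meets
`K` is replaced by a ball centred in `K` of slightly larger radius, and compactness leaves finitely
many of them. -/
lemma exists_ball_cover {n d : ℕ} {K : Set (E n)} (hK : IsCompact K) (h0 : μH[(d : ℝ)] K = 0)
    {ε : ℝ} (hε : 0 < ε) : ∃ (ι : Finset ℕ) (x : ℕ → E n) (r : ℕ → ℝ),
      (∀ i ∈ ι, x i ∈ K ∧ 0 < r i ∧ r i < ε) ∧ K ⊆ ⋃ i ∈ ι, Metric.ball (x i) (r i) ∧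
      ∑ i ∈ ι, r i ^ d < ε := by
  classical
  rcases K.eq_empty_or_nonempty with rfl | ⟨x₀, hx₀⟩
  · exact ⟨∅, fun _ => 0, fun _ => 0, by simp, by simp, by simpa using hε⟩
  have hε2 : 0 < ENNReal.ofReal (ε / 2) := ENNReal.ofReal_pos.2 (half_pos hε)
  rw [Measure.hausdorffMeasure_apply] at h0
  have h1 := (le_iSup₂ (f := fun (r : ℝ≥0∞) (_ : 0 < r) =>
    ⨅ (t : ℕ → Set (E n)) (_ : K ⊆ ⋃ n, t n) (_ : ∀ n, Metric.ediam (t n) ≤ r),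
      ∑' n, ⨆ _ : (t n).Nonempty, Metric.ediam (t n) ^ (d : ℝ)) _ hε2).trans h0.le
  have h2 := h1.trans_lt hε2
  simp only [iInf_lt_iff] at h2
  obtain ⟨t, htK, htd, hts⟩ := h2
  have hdt : ∀ i, Metric.ediam (t i) ≠ ⊤ := fun i => ((htd i).trans_lt ENNReal.ofReal_lt_top).ne
  set δ : ℕ → ℝ := fun i => (Metric.ediam (t i)).toReal with hδ
  have hδ0 : ∀ i, 0 ≤ δ i := fun i => ENNReal.toReal_nonneg
  have hδε : ∀ i, δ i < ε := fun i => by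
    have := ENNReal.toReal_mono ENNReal.ofReal_ne_top (htd i)
    rw [ENNReal.toReal_ofReal (half_pos hε).le] at this
    exact this.trans_lt (half_lt_self hε)
  -- A radius strictly above the diameter makes the ball open and nonempty. The geometric weights
  -- keep the total increase at most `ε / 2`.
  have hr : ∀ i, ∃ r, δ i < r ∧ r < ε ∧ r ^ d ≤ δ i ^ d + ε / 4 * (1 / 2) ^ i := by
    intro i
    have h3 : ∀ᶠ r in 𝓝[>] (δ i), r ^ d < δ i ^ d + ε / 4 * (1 / 2) ^ i :=
      nhdsWithin_le_nhds (((continuous_pow d).tendsto (δ i)).eventually (gt_mem_nhds (by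
        have : 0 < ε / 4 * (1 / 2) ^ i := by positivity
        linarith)))
    have h4 : ∀ᶠ r in 𝓝[>] (δ i), r < ε := nhdsWithin_le_nhds (gt_mem_nhds (hδε i))
    obtain ⟨r, ⟨hr1, hr2⟩, hr3⟩ := ((h3.and h4).and self_mem_nhdsWithin).exists
    exact ⟨r, hr3, hr2, hr1.le⟩
  choose r hr1 hr2 hr3 using hr
  set x : ℕ → E n := fun i => if h : (t i ∩ K).Nonempty then h.some else x₀ with hx
  have hxi : ∀ i, (t i ∩ K).Nonempty → x i ∈ t i ∩ K := fun i hi => by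
    simp only [hx, hi, dite_true]; exact hi.some_mem
  obtain ⟨T, hT⟩ := hK.elim_finite_subcover
    (fun i => if (t i ∩ K).Nonempty then Metric.ball (x i) (r i) else ∅)
    (fun i => by split_ifs; exacts [Metric.isOpen_ball, isOpen_empty]) (fun y hy => by
      obtain ⟨i, hi⟩ := mem_iUnion.1 (htK hy)
      have hne : (t i ∩ K).Nonempty := ⟨y, hi, hy⟩
      refine mem_iUnion.2 ⟨i, ?_⟩
      rw [if_pos hne, Metric.mem_ball]
      refine lt_of_le_of_lt ?_ (hr1 i)
      rw [dist_edist]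
      exact ENNReal.toReal_mono (hdt i) (Metric.edist_le_ediam_of_mem hi (hxi i hne).1))
  refine ⟨T.filter fun i => (t i ∩ K).Nonempty, x, r, fun i hi => ?_, fun y hy => ?_, ?_⟩
  · have hi' := (Finset.mem_filter.1 hi).2
    exact ⟨(hxi i hi').2, (hδ0 i).trans_lt (hr1 i), hr2 i⟩
  · obtain ⟨i, hi, hyi⟩ := mem_iUnion₂.1 (hT hy)
    split_ifs at hyi with hne
    · exact mem_iUnion₂.2 ⟨i, Finset.mem_filter.2 ⟨hi, hne⟩, hyi⟩
    · exact absurd hyi (notMem_empty y)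
  · set ι := T.filter fun i => (t i ∩ K).Nonempty
    have h5 : ∑ i ∈ ι, δ i ^ d < ε / 2 := by
      have h6 : ENNReal.ofReal (∑ i ∈ ι, δ i ^ d) < ENNReal.ofReal (ε / 2) := by
        refine lt_of_le_of_lt ?_ hts
        rw [ENNReal.ofReal_sum_of_nonneg fun i _ => pow_nonneg (hδ0 i) d]
        refine le_trans (Finset.sum_le_sum fun i hi => ?_) (ENNReal.sum_le_tsum ι)
        have hne : (t i).Nonempty := (Finset.mem_filter.1 hi).2.mono inter_subset_left
        rw [iSup_pos hne, ENNReal.rpow_natCast, ENNReal.ofReal_pow (hδ0 i),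
          ENNReal.ofReal_toReal (hdt i)]
      exact (ENNReal.ofReal_lt_ofReal_iff (half_pos hε)).1 h6
    have h7 : ∑ i ∈ ι, ε / 4 * (1 / 2 : ℝ) ^ i ≤ ε / 2 := by
      rw [← Finset.mul_sum]
      have h8 : ∑ i ∈ ι, (1 / 2 : ℝ) ^ i ≤ 2 :=
        (summable_geometric_two.sum_le_tsum ι fun i _ => by positivity).trans tsum_geometric_two.le
      nlinarith
    calc ∑ i ∈ ι, r i ^ d ≤ ∑ i ∈ ι, (δ i ^ d + ε / 4 * (1 / 2) ^ i) :=
          Finset.sum_le_sum fun i _ => hr3 i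
      _ < ε := by rw [Finset.sum_add_distrib]; linarith

/-- Cutoff functions around a null set of codimension at least two. -/
lemma exists_cutoff_null {n d : ℕ} {K : Set (E n)} (hK : IsCompact K) (h0 : μH[(d : ℝ)] K = 0)
    {μ : Measure (E n)} {A : ℝ} (hA : 0 ≤ A)
    (hμ : ∀ z r, 0 < r → μ (Metric.ball z r) ≤ ENNReal.ofReal (A * r ^ (d + 1)))
    {ε : ℝ} (hε : 0 < ε) :
    ∃ ψ : E n → ℝ, ContDiff ℝ 1 ψ ∧ (∀ x, ψ x ∈ Icc (0 : ℝ) 1) ∧ Disjoint (tsupport ψ) K ∧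
      (∀ x, (∀ y ∈ K, ε ≤ dist x y) → ψ x = 1) ∧ ∫⁻ x, ‖fderiv ℝ ψ x‖ₑ ∂μ ≤ ENNReal.ofReal ε := by
  classical
  let f : ContDiffBump (0 : E n) := ⟨1, 2, one_pos, one_lt_two⟩
  have hfs : ContDiff ℝ 1 f := f.contDiff
  obtain ⟨L, hL⟩ := (f.hasCompactSupport.fderiv ℝ).exists_bound_of_continuous
    (hfs.continuous_fderiv one_ne_zero)
  have hL0 : 0 ≤ L := (norm_nonneg _).trans (hL 0)
  -- The first bound keeps the doubled balls within distance `ε` of `K`. The second absorbs the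
  -- constant `L * A * 3 ^ (d + 1)` of the gradient estimate.
  set ε' : ℝ := min (ε / 2) (ε / (L * A * 3 ^ (d + 1) + 1)) with hε'
  have hden : 0 < L * A * 3 ^ (d + 1) + 1 := by positivity
  have hε'0 : 0 < ε' := lt_min (half_pos hε) (div_pos hε hden)
  obtain ⟨ι, x, r, hι, hcov, hsum⟩ := exists_ball_cover hK h0 hε'0
  set χ : ℕ → E n → ℝ := fun i y => f ((r i)⁻¹ • (y - x i)) with hχ
  have hχs : ∀ i, ContDiff ℝ 1 (χ i) := fun i =>
    hfs.comp ((contDiff_id.sub contDiff_const).const_smul _)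
  have hχd : ∀ i y, fderiv ℝ (χ i) y = (r i)⁻¹ • fderiv ℝ f ((r i)⁻¹ • (y - x i)) := by
    intro i y
    have h1 : HasFDerivAt (fun y => (r i)⁻¹ • (y - x i))
        ((r i)⁻¹ • ContinuousLinearMap.id ℝ (E n)) y :=
      ((hasFDerivAt_id y).sub_const (x i)).fun_const_smul _
    have h2 := ((hfs.differentiable one_ne_zero _).hasFDerivAt.comp y h1).fderiv
    have h3 : fderiv ℝ (χ i) y = _ := h2
    rw [h3]
    ext1 u
    simp
  have hχ1 : ∀ i ∈ ι, ∀ y ∈ Metric.ball (x i) (r i), χ i y = 1 := by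
    intro i hi y hy
    refine f.one_of_mem_closedBall ?_
    have hri := (hι i hi).2.1
    rw [mem_closedBall_zero_iff, norm_smul, norm_inv, Real.norm_eq_abs, abs_of_pos hri,
      inv_mul_le_iff₀ hri]
    change ‖y - x i‖ ≤ r i * 1
    rw [← dist_eq_norm, mul_one]
    exact (Metric.mem_ball.1 hy).le
  have hout : ∀ i ∈ ι, ∀ y, y ∉ Metric.ball (x i) (2 * r i) → 2 ≤ ‖(r i)⁻¹ • (y - x i)‖ := by
    intro i hi y hy
    have hri := (hι i hi).2.1
    rw [norm_smul, norm_inv, Real.norm_eq_abs, abs_of_pos hri, le_inv_mul_iff₀ hri, ← dist_eq_norm,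
      mul_comm]
    exact not_lt.1 hy
  have hχ0 : ∀ i ∈ ι, ∀ y, y ∉ Metric.ball (x i) (2 * r i) → χ i y = 0 := fun i hi y hy =>
    f.zero_of_le_dist (by rw [dist_zero_right]; exact hout i hi y hy)
  -- The gradient is supported in the closed ball of radius `2 * r i`. The factor `3` leaves room
  -- for an open ball, as in the growth condition.
  have hχd0 : ∀ i ∈ ι, ∀ y, y ∉ Metric.ball (x i) (3 * r i) → fderiv ℝ (χ i) y = 0 := by
    intro i hi y hy
    have hri := (hι i hi).2.1
    refine fderiv_eq_zero_of_notMem_tsupport fun h => hy ?_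
    have h1 : tsupport (χ i) ⊆ Metric.closedBall (x i) (2 * r i) :=
      closure_minimal (fun z hz => by
        by_contra h2
        exact hz (hχ0 i hi z fun h3 => h2 (Metric.ball_subset_closedBall h3)))
        Metric.isClosed_closedBall
    have h4 := Metric.mem_closedBall.1 (h1 h)
    rw [Metric.mem_ball]
    linarith
  -- All factors lie between `0` and `1`, so the gradient of the product is at most the sum of the
  -- gradients.
  set ψ : E n → ℝ := fun y => ∏ i ∈ ι, (1 - χ i y) with hψ
  have hχI : ∀ i y, χ i y ∈ Icc (0 : ℝ) 1 := fun i y => ⟨f.nonneg, f.le_one⟩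
  have hψd : ∀ y, ‖fderiv ℝ ψ y‖ ≤ ∑ i ∈ ι, ‖fderiv ℝ (χ i) y‖ := by
    intro y
    have h1 : HasFDerivAt ψ (∑ i ∈ ι, (∏ j ∈ ι.erase i, (1 - χ j y)) • -fderiv ℝ (χ i) y) y :=
      HasFDerivAt.finsetProd fun i _ =>
        ((hχs i).differentiable one_ne_zero y).hasFDerivAt.const_sub 1
    rw [h1.fderiv]
    refine (norm_sum_le _ _).trans (Finset.sum_le_sum fun i _ => ?_)
    rw [norm_smul, norm_neg]
    refine mul_le_of_le_one_left (norm_nonneg _) ?_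
    rw [Real.norm_eq_abs, abs_of_nonneg (Finset.prod_nonneg fun j _ => by linarith [(hχI j y).2])]
    exact Finset.prod_le_one (fun j _ => by linarith [(hχI j y).2])
      fun j _ => by linarith [(hχI j y).1]
  refine ⟨ψ, ?_, fun y => ⟨Finset.prod_nonneg fun j _ => by linarith [(hχI j y).2],
    Finset.prod_le_one (fun j _ => by linarith [(hχI j y).2])
      fun j _ => by linarith [(hχI j y).1]⟩, ?_, fun y hy => ?_, ?_⟩
  · exact contDiff_prod fun i _ => contDiff_const.sub (hχs i)
  · have hop : IsOpen (⋃ i ∈ ι, Metric.ball (x i) (r i)) :=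
      isOpen_biUnion fun i _ => Metric.isOpen_ball
    have hz : tsupport ψ ⊆ (⋃ i ∈ ι, Metric.ball (x i) (r i))ᶜ := by
      refine closure_minimal (fun y hy hyb => hy ?_) hop.isClosed_compl
      obtain ⟨i, hi, hyi⟩ := mem_iUnion₂.1 hyb
      exact Finset.prod_eq_zero hi (by rw [hχ1 i hi y hyi, sub_self])
    exact disjoint_left.2 fun y hy hyK => hz hy (hcov hyK)
  · refine Finset.prod_eq_one fun i hi => ?_
    rw [hχ0 i hi y, sub_zero]
    have h1 := hy _ (hι i hi).1
    have h2 := (hι i hi).2.2.trans_le (min_le_left _ _)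
    rw [Metric.mem_ball]
    linarith
  · have hb : ∀ y, ‖fderiv ℝ ψ y‖ₑ ≤ ∑ i ∈ ι, ‖fderiv ℝ (χ i) y‖ₑ := by
      intro y
      simp only [← ofReal_norm]
      rw [← ENNReal.ofReal_sum_of_nonneg fun i _ => norm_nonneg _]
      exact ENNReal.ofReal_le_ofReal (hψd y)
    have hci : ∀ i, Continuous fun y => fderiv ℝ (χ i) y := fun i =>
      (hχs i).continuous_fderiv one_ne_zero
    -- A gradient of size `L / r i` on a ball of measure of order `r i ^ (d + 1)` contributes `r i ^
    -- d`, and these sum to little because `K` is null in dimension `d`.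
    have hone : ∀ i ∈ ι, ∫⁻ y, ‖fderiv ℝ (χ i) y‖ₑ ∂μ ≤
        ENNReal.ofReal (L * A * 3 ^ (d + 1) * r i ^ d) := by
      intro i hi
      have hri := (hι i hi).2.1
      have h1 : ∀ y, ‖fderiv ℝ (χ i) y‖ₑ ≤
          (Metric.ball (x i) (3 * r i)).indicator (fun _ => ENNReal.ofReal ((r i)⁻¹ * L)) y := by
        intro y
        by_cases hy : y ∈ Metric.ball (x i) (3 * r i)
        · rw [indicator_of_mem hy, ← ofReal_norm, hχd, norm_smul, norm_inv,
            Real.norm_eq_abs, abs_of_pos hri]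
          exact ENNReal.ofReal_le_ofReal (mul_le_mul_of_nonneg_left (hL _) (inv_nonneg.2 hri.le))
        · rw [indicator_of_notMem hy, hχd0 i hi y hy, ← ofReal_norm, norm_zero, ENNReal.ofReal_zero]
      refine (lintegral_mono h1).trans ?_
      rw [lintegral_indicator_const Metric.isOpen_ball.measurableSet]
      refine (mul_le_mul' le_rfl (hμ _ _ (by positivity))).trans (le_of_eq ?_)
      rw [← ENNReal.ofReal_mul (by positivity)]
      congr 1
      field_simp
      ring
    calc ∫⁻ y, ‖fderiv ℝ ψ y‖ₑ ∂μ ≤ ∫⁻ y, ∑ i ∈ ι, ‖fderiv ℝ (χ i) y‖ₑ ∂μ := lintegral_mono hb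
      _ = ∑ i ∈ ι, ∫⁻ y, ‖fderiv ℝ (χ i) y‖ₑ ∂μ :=
          lintegral_finsetSum _ fun i _ => (hci i).enorm.measurable
      _ ≤ ∑ i ∈ ι, ENNReal.ofReal (L * A * 3 ^ (d + 1) * r i ^ d) := Finset.sum_le_sum hone
      _ = ENNReal.ofReal (L * A * 3 ^ (d + 1) * ∑ i ∈ ι, r i ^ d) := by
          rw [Finset.mul_sum, ENNReal.ofReal_sum_of_nonneg fun i hi => by
            have := (hι i hi).2.1; positivity]
      _ ≤ ENNReal.ofReal ε := by
          refine ENNReal.ofReal_le_ofReal ?_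
          have h1 : ∑ i ∈ ι, r i ^ d ≤ ε / (L * A * 3 ^ (d + 1) + 1) :=
            hsum.le.trans (min_le_right _ _)
          have h2 : 0 ≤ L * A * 3 ^ (d + 1) := by positivity
          calc _ ≤ L * A * 3 ^ (d + 1) * (ε / (L * A * 3 ^ (d + 1) + 1)) := by gcongr
            _ ≤ (L * A * 3 ^ (d + 1) + 1) * (ε / (L * A * 3 ^ (d + 1) + 1)) := by
                gcongr; linarith
            _ = ε := by field_simp

end Fractured

end

/-! ### From local balance laws to a global one. -/

noncomputable section

namespace Fractured

open Filter Topology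
open scoped ENNReal NNReal

section Globalization

variable {n : ℕ} {μ ν : Measure (E n)} {C K : Set (E n)} {G₁ G₂ N : E n → ℝ} {b : E n → E n} {M : ℝ}

lemma integrable_test [IsFiniteMeasure μ] (hG₁ : Integrable G₁ μ) (hG₂ : AEStronglyMeasurable G₂ μ)
    (hM : ∀ x, |G₂ x| ≤ M) (hb : Continuous b) {φ : E n → ℝ} (hφ : ContDiff ℝ 1 φ)
    (hφc : HasCompactSupport φ) :
    Integrable (fun x => G₁ x * φ x) μ ∧ Integrable (fun x => G₂ x * fderiv ℝ φ x (b x)) μ := by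
  obtain ⟨M₁, hM₁⟩ := hφc.exists_bound_of_continuous hφ.continuous
  have hc : Continuous fun x => fderiv ℝ φ x (b x) := (hφ.continuous_fderiv one_ne_zero).clm_apply hb
  have hcs : HasCompactSupport fun x => fderiv ℝ φ x (b x) :=
    (hφc.fderiv ℝ).mono fun x hx h0 => hx (by simp [h0])
  exact ⟨hG₁.mul_bdd (c := M₁) hφ.continuous.aestronglyMeasurable (Eventually.of_forall hM₁),
    (hc.integrable_of_hasCompactSupport hcs).bdd_mul hG₂ (Eventually.of_forall hM)⟩

/-- Both sides are linear in `φ`, so a partition of unity reduces the claim to the local laws. The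
pieces need to add up to `φ` only near points of `C`, which carries both measures. -/
lemma integral_test_eq_of_local [IsFiniteMeasure μ] (hC : IsCompact C) (hμC : μ Cᶜ = 0)
    (hνC : ν Cᶜ = 0) (hG₁ : Integrable G₁ μ) (hG₂ : AEStronglyMeasurable G₂ μ)
    (hM : ∀ x, |G₂ x| ≤ M) (hN : Integrable N ν) (hb : Continuous b)
    (hloc : ∀ x ∈ C \ K, ∃ O, IsOpen O ∧ x ∈ O ∧ ∀ φ : E n → ℝ, ContDiff ℝ 1 φ →
      HasCompactSupport φ → tsupport φ ⊆ O →
      ∫ x, (G₁ x * φ x + G₂ x * fderiv ℝ φ x (b x)) ∂μ = ∫ x, N x * φ x ∂ν)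
    {φ : E n → ℝ} (hφ : ContDiff ℝ 1 φ) (hφc : HasCompactSupport φ)
    (hφK : Disjoint (tsupport φ) K) :
    ∫ x, (G₁ x * φ x + G₂ x * fderiv ℝ φ x (b x)) ∂μ = ∫ x, N x * φ x ∂ν := by
  classical
  set C₁ := C ∩ tsupport φ with hC₁
  have hC₁c : IsCompact C₁ := hC.inter_right (isClosed_tsupport φ)
  have hC₁K : ∀ x ∈ C₁, x ∈ C \ K := fun x hx => ⟨hx.1, disjoint_left.1 hφK hx.2⟩
  choose! O hO hxO hOφ using hloc
  obtain ⟨t, ht⟩ := hC₁c.elim_nhds_subcover' (fun x _ => O x) fun x hx =>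
    (hO x (hC₁K x hx)).mem_nhds (hxO x (hC₁K x hx))
  have hU : C₁ ⊆ ⋃ i : t, O i.1.1 := by
    intro x hx
    obtain ⟨i, hi, hxi⟩ := mem_iUnion₂.1 (ht hx)
    exact mem_iUnion.2 ⟨⟨i, hi⟩, hxi⟩
  have hUo : ∀ i : t, IsOpen (O i.1.1) := fun i => hO _ (hC₁K _ i.1.2)
  obtain ⟨L, hL, hC₁L, hLU⟩ := exists_compact_between hC₁c (isOpen_iUnion hUo) hU
  obtain ⟨ρ, hρ⟩ := SmoothPartitionOfUnity.exists_isSubordinate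
    (modelWithCornersSelf ℝ (E n)) hL.isClosed (fun i : t => O i.1.1) hUo hLU
  have hρs : ∀ i, ContDiff ℝ 1 (ρ i) := fun i => ((ρ i).contMDiff.contDiff).of_le (by norm_cast)
  set f : t → E n → ℝ := fun i x => φ x * ρ i x with hf
  have hfs : ∀ i, ContDiff ℝ 1 (f i) := fun i => hφ.mul (hρs i)
  have hfc : ∀ i, HasCompactSupport (f i) := fun i => hφc.mul_right
  have hft : ∀ i, tsupport (f i) ⊆ O i.1.1 := fun i => tsupport_mul_subset_right.trans (hρ i)
  have hsum : ∀ x ∈ C, (fun y => ∑ i, f i y) =ᶠ[𝓝 x] φ := by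
    intro x hx
    by_cases hx' : x ∈ tsupport φ
    · filter_upwards [isOpen_interior.mem_nhds (hC₁L ⟨hx, hx'⟩)] with y hy
      have h1 := ρ.sum_eq_one (interior_subset hy)
      rw [finsum_eq_sum_of_fintype] at h1
      simp only [hf]
      rw [← Finset.mul_sum, h1, mul_one]
    · filter_upwards [(isClosed_tsupport φ).isOpen_compl.mem_nhds hx'] with y hy
      have h1 : φ y = 0 := image_eq_zero_of_notMem_tsupport (f := φ) hy
      simp [hf, h1]
  have hae : ∀ᵐ x ∂μ, x ∈ C := mem_ae_iff.2 hμC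
  have hae' : ∀ᵐ x ∂ν, x ∈ C := mem_ae_iff.2 hνC
  have e1 : ∫ x, (G₁ x * φ x + G₂ x * fderiv ℝ φ x (b x)) ∂μ =
      ∑ i, ∫ x, (G₁ x * f i x + G₂ x * fderiv ℝ (f i) x (b x)) ∂μ := by
    rw [← integral_finsetSum]
    · refine integral_congr_ae ?_
      filter_upwards [hae] with x hx
      have h1 : fderiv ℝ φ x = ∑ i, fderiv ℝ (f i) x := by
        rw [← (hsum x hx).fderiv_eq, fderiv_fun_sum fun i _ => (hfs i).differentiable one_ne_zero x]
      rw [h1, ← (hsum x hx).eq_of_nhds, Finset.sum_add_distrib, Finset.mul_sum,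
        _root_.sum_apply, Finset.mul_sum]
    · intro i _
      obtain ⟨h1, h2⟩ := integrable_test hG₁ hG₂ hM hb (hfs i) (hfc i)
      exact h1.add h2
  have e2 : ∫ x, N x * φ x ∂ν = ∑ i, ∫ x, N x * f i x ∂ν := by
    rw [← integral_finsetSum]
    · refine integral_congr_ae ?_
      filter_upwards [hae'] with x hx
      rw [← (hsum x hx).eq_of_nhds, Finset.mul_sum]
    · intro i _
      obtain ⟨M₁, hM₁⟩ := (hfc i).exists_bound_of_continuous (hfs i).continuous
      exact hN.mul_bdd (c := M₁) (hfs i).continuous.aestronglyMeasurable (Eventually.of_forall hM₁)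
  rw [e1, e2]
  exact Finset.sum_congr rfl fun i _ => hOφ _ (hC₁K _ i.1.2) _ (hfs i) (hfc i) (hft i)

/-- A balance law that holds locally off a null set of codimension two holds globally. -/
theorem integral_eq_of_local [IsFiniteMeasure μ] {d : ℕ} (hC : IsCompact C) (hK : IsCompact K)
    (hμC : μ Cᶜ = 0) (hνC : ν Cᶜ = 0) (hμK : μ K = 0) (hνK : ν K = 0) (h0 : μH[(d : ℝ)] K = 0)
    {A : ℝ} (hA : 0 ≤ A)
    (hμ : ∀ z r, 0 < r → μ (Metric.ball z r) ≤ ENNReal.ofReal (A * r ^ (d + 1)))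
    (hG₁ : Integrable G₁ μ) (hG₂ : AEStronglyMeasurable G₂ μ)
    (hM : ∀ x, |G₂ x| ≤ M) (hN : Integrable N ν) (hb : Continuous b)
    (hloc : ∀ x ∈ C \ K, ∃ O, IsOpen O ∧ x ∈ O ∧ ∀ φ : E n → ℝ, ContDiff ℝ 1 φ →
      HasCompactSupport φ → tsupport φ ⊆ O →
      ∫ x, (G₁ x * φ x + G₂ x * fderiv ℝ φ x (b x)) ∂μ = ∫ x, N x * φ x ∂ν) :
    ∫ x, G₁ x ∂μ = ∫ x, N x ∂ν := by
  obtain ⟨χ, hχ, hχc, -, hχ1, hχI⟩ := exists_cutoff hC isOpen_univ (subset_univ _)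
  have hχ1' : ∀ x ∈ C, χ =ᶠ[𝓝 x] fun _ => 1 := fun x hx => hχ1.filter_mono (nhds_le_nhdsSet hx)
  obtain ⟨R, hR⟩ := hC.exists_bound_of_continuousOn hb.continuousOn
  set ε : ℕ → ℝ := fun m => 1 / ((m : ℝ) + 1) with hε
  have hε0 : ∀ m, 0 < ε m := fun m => Nat.one_div_pos_of_nat
  have hεt : Tendsto ε atTop (𝓝 0) := tendsto_one_div_add_atTop_nhds_zero_nat
  choose ψ hψs hψI hψK hψ1 hψd using fun m => exists_cutoff_null hK h0 hA hμ (hε0 m)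
  set φ : ℕ → E n → ℝ := fun m x => ψ m x * χ x with hφ
  have hφs : ∀ m, ContDiff ℝ 1 (φ m) := fun m => (hψs m).mul (hχ.of_le (by norm_cast))
  have hφc : ∀ m, HasCompactSupport (φ m) := fun m => hχc.mul_left
  have hφK : ∀ m, Disjoint (tsupport (φ m)) K := fun m =>
    (hψK m).mono_left tsupport_mul_subset_left
  have hφb : ∀ m x, ‖φ m x‖ ≤ 1 := fun m x => by
    rw [Real.norm_eq_abs, abs_of_nonneg (mul_nonneg (hψI m x).1 (hχI x).1)]
    exact mul_le_one₀ (hψI m x).2 (hχI x).1 (hχI x).2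
  have hid : ∀ m, _ = _ := fun m =>
    integral_test_eq_of_local hC hμC hνC hG₁ hG₂ hM hN hb hloc (hφs m) (hφc m) (hφK m)
  have hlim : ∀ x, x ∈ C → x ∉ K → Tendsto (fun m => φ m x) atTop (𝓝 1) := by
    intro x hxC hxK
    obtain ⟨δ, hδ, hδK⟩ := Metric.isOpen_iff.1 hK.isClosed.isOpen_compl x hxK
    refine tendsto_const_nhds.congr' ?_
    filter_upwards [hεt.eventually (gt_mem_nhds hδ)] with m hm
    rw [hφ]
    simp only
    rw [(hχ1' x hxC).eq_of_nhds, mul_one, hψ1 m x]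
    intro y hy
    by_contra! hlt
    exact hδK (Metric.mem_ball'.2 (hlt.trans hm)) hy
  have hlimi : ∀ {η : Measure (E n)} {F : E n → ℝ}, η Cᶜ = 0 → η K = 0 → Integrable F η →
      Tendsto (fun m => ∫ x, F x * φ m x ∂η) atTop (𝓝 (∫ x, F x ∂η)) := by
    intro η F hη hηK hF
    refine tendsto_integral_of_dominated_convergence (fun x => ‖F x‖) (fun m => ?_) hF.norm
      (fun m => ?_) ?_
    · exact hF.aestronglyMeasurable.mul (hφs m).continuous.aestronglyMeasurable
    · filter_upwards with x
      rw [norm_mul]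
      exact mul_le_of_le_one_right (norm_nonneg _) (hφb m x)
    · have h1 : ∀ᵐ x ∂η, x ∈ C := mem_ae_iff.2 hη
      have h2 : ∀ᵐ x ∂η, x ∉ K := measure_eq_zero_iff_ae_notMem.1 hηK
      filter_upwards [h1, h2] with x hx hx'
      simpa using (hlim x hx hx').const_mul (F x)
  have hM0 : 0 ≤ M := (abs_nonneg _).trans (hM 0)
  -- On `C`, where `χ` is locally one, the derivative is that of the cutoff `ψ m`, whose `L¹` norm
  -- is at most `ε m`. Boundedness of `G₂` is essential here.
  have hsmall : Tendsto (fun m => ∫ x, G₂ x * fderiv ℝ (φ m) x (b x) ∂μ) atTop (𝓝 0) := by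
    have hR' : ∀ x ∈ C, ‖b x‖ ≤ max R 0 := fun x hx => (hR x hx).trans (le_max_left _ _)
    have hbd : ∀ m, ‖∫ x, G₂ x * fderiv ℝ (φ m) x (b x) ∂μ‖ ≤ M * max R 0 * ε m := by
      intro m
      have h1 : ‖∫ x, G₂ x * fderiv ℝ (φ m) x (b x) ∂μ‖ₑ ≤ ENNReal.ofReal (M * max R 0 * ε m) := by
        refine (enorm_integral_le_lintegral_enorm _).trans ?_
        rw [ENNReal.ofReal_mul (by positivity)]
        refine le_trans ?_ (mul_le_mul' le_rfl (hψd m))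
        rw [← lintegral_const_mul' _ _ ENNReal.ofReal_ne_top]
        refine lintegral_mono_ae ?_
        filter_upwards [mem_ae_iff.2 hμC] with x hx
        have h2 : fderiv ℝ (φ m) x = fderiv ℝ (ψ m) x := by
          refine Filter.EventuallyEq.fderiv_eq ?_
          filter_upwards [hχ1' x hx] with y hy
          simp [hφ, hy]
        rw [h2, ← ofReal_norm, ← ofReal_norm, ← ENNReal.ofReal_mul (by positivity)]
        refine ENNReal.ofReal_le_ofReal ?_
        rw [norm_mul]
        calc ‖G₂ x‖ * ‖fderiv ℝ (ψ m) x (b x)‖ ≤ M * (‖fderiv ℝ (ψ m) x‖ * max R 0) :=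
              mul_le_mul (hM x) (((fderiv ℝ (ψ m) x).le_opNorm _).trans
                (mul_le_mul_of_nonneg_left (hR' x hx) (norm_nonneg _))) (norm_nonneg _) hM0
          _ = _ := by ring
      rw [← ofReal_norm] at h1
      exact (ENNReal.ofReal_le_ofReal_iff (by have := (hε0 m).le; positivity)).1 h1
    refine squeeze_zero_norm hbd ?_
    simpa using hεt.const_mul (M * max R 0)
  have hL : Tendsto (fun m => ∫ x, (G₁ x * φ m x + G₂ x * fderiv ℝ (φ m) x (b x)) ∂μ) atTop
      (𝓝 (∫ x, G₁ x ∂μ)) := by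
    have h1 := (hlimi hμC hμK hG₁).add hsmall
    rw [add_zero] at h1
    refine h1.congr fun m => ?_
    obtain ⟨h2, h3⟩ := integrable_test hG₁ hG₂ hM hb (hφs m) (hφc m)
    exact (integral_add h2 h3).symm
  refine tendsto_nhds_unique hL ((hlimi hνC hνK hN).congr fun m => (hid m).symm)

end Globalization

end Fractured

end

/-! ### Measure growth of pieces, the singular set, and regularity of divergence and normal. -/

noncomputable section

namespace Fractured

open Filter Topology
open scoped ENNReal NNReal

/-- A submanifold is locally closed, being cut out in each chart by closed conditions. This yields
measurability of the pieces and closedness of their boundaries. -/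
lemma IsSmoothSubmanifold.exists_isOpen {n d : ℕ} {S : Set (E n)} (hS : IsSmoothSubmanifold d S) :
    ∃ O, IsOpen O ∧ S = O ∩ closure S := by
  have : Nonempty (OpenPartialHomeomorph (E n) (E n)) := ⟨OpenPartialHomeomorph.refl _⟩
  choose! Φ hΦ hx hΦS using hS
  refine ⟨⋃ x ∈ S, (Φ x).source, isOpen_biUnion fun x _ => (Φ x).open_source,
    Subset.antisymm (fun x h => ⟨mem_iUnion₂.2 ⟨x, h, hx x h⟩, subset_closure h⟩) ?_⟩
  rintro y ⟨hy, hyS⟩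
  obtain ⟨x, hxS, hyx⟩ := mem_iUnion₂.1 hy
  rw [hΦS x hxS y hyx]
  intro i hi
  have : (𝓝[S] y).NeBot := mem_closure_iff_nhdsWithin_neBot.1 hyS
  have h1 : Tendsto (fun z => Φ x z i) (𝓝[S] y) (𝓝 (Φ x y i)) :=
    ((EuclideanSpace.proj i : E n →L[ℝ] ℝ).continuous.continuousAt.tendsto.comp
      ((Φ x).continuousAt hyx)).mono_left nhdsWithin_le_nhds
  refine tendsto_nhds_unique h1 (tendsto_const_nhds.congr' ?_)
  filter_upwards [self_mem_nhdsWithin, nhdsWithin_le_nhds ((Φ x).open_source.mem_nhds hyx)]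
    with z hz hz'
  exact ((hΦS x hxS z hz').1 hz i hi).symm

lemma IsSmoothSubmanifold.measurableSet {n d : ℕ} {S : Set (E n)} (hS : IsSmoothSubmanifold d S) :
    MeasurableSet S := by
  obtain ⟨O, hO, h⟩ := hS.exists_isOpen
  rw [h]
  exact hO.measurableSet.inter isClosed_closure.measurableSet

lemma IsSmoothSubmanifold.isClosed_bdry {n d : ℕ} {S : Set (E n)} (hS : IsSmoothSubmanifold d S) :
    IsClosed (bdry S) := by
  obtain ⟨O, hO, h⟩ := hS.exists_isOpen
  have : bdry S = closure S ∩ Oᶜ := by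
    ext x
    constructor
    · rintro ⟨h1, h2⟩
      exact ⟨h1, fun h3 => h2 (by rw [h]; exact ⟨h3, h1⟩)⟩
    · rintro ⟨h1, h2⟩
      exact ⟨h1, fun h3 => h2 (by rw [h] at h3; exact h3.1)⟩
  rw [this]
  exact isClosed_closure.inter hO.isClosed_compl

/-- Coordinates and parametrization are Lipschitz nearby. The centre `z` may lie off `M`, so
distances are taken from some point `y₀` of the intersection, which doubles the radius. -/
lemma IsSmoothSubmanifold.exists_nhds_measure_ball_le {n d : ℕ} (hd : d ≤ n) {M : Set (E n)}
    (hM : IsSmoothSubmanifold d M) {x : E n} (hx : x ∈ M) :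
    ∃ V ∈ 𝓝 x, ∃ A : ℝ, 0 ≤ A ∧ ∀ z r, 0 < r →
      (μHE[d] : Measure (E n)) (M ∩ V ∩ Metric.ball z r) ≤ ENNReal.ofReal (A * r ^ d) := by
  obtain ⟨Φ, hΦ, hxΦ, hΦM⟩ := hM x hx
  obtain ⟨h1, h2⟩ := param_coord (hd := hd) hxΦ ((hΦM x hxΦ).1 hx)
  obtain ⟨K₁, V₁, hV₁, hL₁⟩ := ((hΦ.contDiffOn_coord (hd := hd)).contDiffAt
    (Φ.open_source.mem_nhds hxΦ) |>.of_le (by norm_cast) :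
      ContDiffAt ℝ 1 (coord hd Φ) x).exists_lipschitzOnWith
  obtain ⟨K₂, V₂, hV₂, hL₂⟩ := ((hΦ.contDiffOn_param (hd := hd)).contDiffAt
    (isOpen_pdom.mem_nhds h2) |>.of_le (by norm_cast) :
      ContDiffAt ℝ 1 (param hd Φ) (coord hd Φ x)).exists_lipschitzOnWith
  have hco : ContinuousAt (coord hd Φ) x := (hΦ.differentiableAt_coord hxΦ).continuousAt
  set c := (volume (Metric.closedBall (0 : E d) 1)).toReal with hc
  refine ⟨_, inter_mem (Φ.open_source.mem_nhds hxΦ) (inter_mem hV₁ (hco hV₂)),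
    K₂ ^ d * ((2 * K₁) ^ d * c), by positivity, fun z r hr => ?_⟩
  set T := M ∩ (Φ.source ∩ (V₁ ∩ coord hd Φ ⁻¹' V₂)) ∩ Metric.ball z r with hT
  rcases T.eq_empty_or_nonempty with hTe | ⟨y₀, hy₀⟩
  · rw [hTe]; simp
  have hpc : ∀ y ∈ T, param hd Φ (coord hd Φ y) = y := fun y hy =>
    (param_coord hy.1.2.1 ((hΦM y hy.1.2.1).1 hy.1.1)).1
  have e1 : (μHE[d] : Measure (E n)) (id '' T) ≤ (K₂ : ℝ≥0∞) ^ d *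
      (μHE[d] : Measure (E d)) (coord hd Φ '' T) := by
    refine muHE_image_le_of_dist_le fun y hy y' hy' => ?_
    have := hL₂.dist_le_mul _ hy.1.2.2.2 _ hy'.1.2.2.2
    rwa [hpc y hy, hpc y' hy'] at this
  have e2 : coord hd Φ '' T ⊆ Metric.closedBall (coord hd Φ y₀) (2 * K₁ * r) := by
    rintro _ ⟨y, hy, rfl⟩
    refine (hL₁.dist_le_mul _ hy.1.2.2.1 _ hy₀.1.2.2.1).trans ?_
    have h3 := dist_triangle_right y y₀ z
    have h4 := Metric.mem_ball.1 hy.2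
    have h5 := Metric.mem_ball.1 hy₀.2
    have h6 : dist y y₀ ≤ 2 * r := by linarith
    calc (K₁ : ℝ) * dist y y₀ ≤ K₁ * (2 * r) := by gcongr
      _ = _ := by ring
  rw [image_id, EuclideanSpace.euclideanHausdorffMeasure_eq_volume] at e1
  refine e1.trans ((mul_le_mul' le_rfl (measure_mono e2)).trans (le_of_eq ?_))
  rw [Measure.addHaar_closedBall' _ _ (by positivity), finrank_euclideanSpace, Fintype.card_fin]
  have hcf : volume (Metric.closedBall (0 : E d) 1) = ENNReal.ofReal c := by
    rw [hc, ENNReal.ofReal_toReal measure_closedBall_lt_top.ne]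
  rw [hcf, ← ENNReal.ofReal_coe_nnreal, ← ENNReal.ofReal_pow (by positivity),
    ← ENNReal.ofReal_mul (by positivity), ← ENNReal.ofReal_mul (by positivity)]
  congr 1
  ring

lemma IsSmoothSubmanifold.exists_measure_ball_le {n d : ℕ} (hd : d ≤ n) {M C : Set (E n)}
    (hM : IsSmoothSubmanifold d M) (hC : IsCompact C) (hCM : C ⊆ M) :
    ∃ A : ℝ, 0 ≤ A ∧ ∀ z r, 0 < r →
      (μHE[d] : Measure (E n)) (C ∩ Metric.ball z r) ≤ ENNReal.ofReal (A * r ^ d) := by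
  have hloc := fun x (hx : x ∈ C) => hM.exists_nhds_measure_ball_le hd (hCM hx)
  choose! V hV A hA hAV using hloc
  obtain ⟨t, htC, ht⟩ := hC.elim_nhds_subcover V hV
  refine ⟨∑ x ∈ t, A x, Finset.sum_nonneg fun x hx => hA x (htC x hx), fun z r hr => ?_⟩
  have h1 : C ∩ Metric.ball z r ⊆ ⋃ x ∈ t, (M ∩ V x ∩ Metric.ball z r) := by
    rintro y ⟨hy, hyz⟩
    obtain ⟨x, hx, hyx⟩ := mem_iUnion₂.1 (ht hy)
    exact mem_iUnion₂.2 ⟨x, hx, ⟨hCM hy, hyx⟩, hyz⟩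
  refine (measure_mono h1).trans ((measure_biUnion_finset_le t _).trans ?_)
  rw [Finset.sum_mul, ENNReal.ofReal_sum_of_nonneg fun x hx =>
    mul_nonneg (hA x (htC x hx)) (by positivity)]
  exact Finset.sum_le_sum fun x hx => hAV x (htC x hx) z r hr

namespace FracturedDomain

variable {n : ℕ} (D : FracturedDomain n)

lemma isCompact_closure (i : Fin D.N) : IsCompact (closure (D.S i)) := (D.bounded i).isCompact_closure

lemma measurableSet_S (i : Fin D.N) : MeasurableSet (D.S i) := (D.smooth i).measurableSet

lemma isClosed_bdry (i : Fin D.N) : IsClosed (bdry (D.S i)) := (D.smooth i).isClosed_bdry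

lemma exists_measure_ball_le (i : Fin D.N) : ∃ A : ℝ, 0 ≤ A ∧ ∀ z r, 0 < r →
    (μHE[D.dim i] : Measure (E n)) (closure (D.S i) ∩ Metric.ball z r) ≤
      ENNReal.ofReal (A * r ^ D.dim i) := by
  obtain ⟨M, hM, hSM⟩ := D.smooth_closure i
  exact hM.exists_measure_ball_le (D.dim_le i) (D.isCompact_closure i) hSM

lemma measure_closure_lt_top (i : Fin D.N) :
    (μHE[D.dim i] : Measure (E n)) (closure (D.S i)) < ⊤ := by
  obtain ⟨A, hA, h⟩ := D.exists_measure_ball_le i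
  obtain ⟨R, hR0, hR⟩ := (D.isCompact_closure i).isBounded.subset_ball_lt 0 0
  have h1 := h 0 R hR0
  rw [inter_eq_left.2 hR] at h1
  exact h1.trans_lt ENNReal.ofReal_lt_top

/-- In any dimension above that of the piece the Hausdorff measure is zero or infinite, according to
the finite measure in its own dimension. -/
lemma measure_closure_eq_zero {i : Fin D.N} {k : ℕ} (hk : D.dim i < k) :
    (μHE[k] : Measure (E n)) (closure (D.S i)) = 0 :=
  (Measure.euclideanHausdorffMeasure_zero_or_top hk _).resolve_right (D.measure_closure_lt_top i).ne

lemma measure_bdry_lt_top {i : Fin D.N} {k : ℕ} (hi : D.dim i = k + 1) :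
    (μHE[k] : Measure (E n)) (bdry (D.S i)) < ⊤ := by
  refine (measure_mono (D.bdry_subset i)).trans_lt ?_
  refine (measure_biUnion_lt_top (toFinite _) fun j hj => ?_)
  have hj' : D.dim j < D.dim i := hj
  rcases (show D.dim j ≤ k by omega).eq_or_lt with h | h
  · rw [← h]
    exact (measure_mono subset_closure).trans_lt (D.measure_closure_lt_top j)
  · exact (measure_mono subset_closure).trans_lt (by rw [D.measure_closure_eq_zero h]; simp)

/-- The points of the closure of a piece where it is not a manifold with boundary form a null set
of codimension two. -/
lemma exists_singular_set {k : ℕ} (hk : k + 1 ≤ n) {i : Fin D.N} (hi : D.dim i = k + 1) :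
    ∃ K, IsCompact K ∧ (μHE[k] : Measure (E n)) K = 0 ∧ Disjoint (D.S i) K ∧
      ∀ x ∈ closure (D.S i) \ K, ∃ Φ : OpenPartialHomeomorph (E n) (E n),
        IsAdapted hk (D.S i) Φ ∧ x ∈ Φ.source := by
  set O : Set (E n) := ⋃ (Φ : OpenPartialHomeomorph (E n) (E n)) (_ : IsAdapted hk (D.S i) Φ),
    Φ.source with hO
  have hOo : IsOpen O := isOpen_iUnion fun Φ => isOpen_iUnion fun _ => Φ.open_source
  have hmem : ∀ x, x ∈ O ↔ ∃ Φ : OpenPartialHomeomorph (E n) (E n),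
      IsAdapted hk (D.S i) Φ ∧ x ∈ Φ.source := fun x => by simp [hO]
  have hSO : D.S i ⊆ O := fun x hx => by
    have h1 := D.smooth i
    rw [hi] at h1
    exact (hmem x).2 (h1.exists_isAdapted hk hx)
  refine ⟨closure (D.S i) \ O, (D.isCompact_closure i).diff hOo, ?_,
    disjoint_left.2 fun x hx hx' => hx'.2 (hSO hx), fun x hx => ?_⟩
  -- Boundary points in pieces of dimension `k` have adapted charts by the half space condition, so
  -- the remaining ones lie in pieces of dimension less than `k`.
  · have hsub : closure (D.S i) \ O ⊆ ⋃ j ∈ {j | D.dim j < k}, closure (D.S j) := by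
      rintro x ⟨hx, hxO⟩
      have hxb : x ∈ bdry (D.S i) := ⟨hx, fun h => hxO (hSO h)⟩
      obtain ⟨j, hj, hxj⟩ := mem_iUnion₂.1 (D.bdry_subset i hxb)
      have hj' : D.dim j < D.dim i := hj
      refine mem_iUnion₂.2 ⟨j, ?_, subset_closure hxj⟩
      rcases (show D.dim j ≤ k by omega).eq_or_lt with h | h
      · exact absurd ((hmem x).2 (D.exists_isAdapted hk hi h hxj hx)) hxO
      · exact h
    refine measure_mono_null hsub ?_
    rw [measure_biUnion_null_iff (to_countable _)]
    exact fun j hj => D.measure_closure_eq_zero hj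
  · rw [← hmem]
    by_contra h
    exact hx.2 ⟨hx.1, h⟩

end FracturedDomain

lemma hausdorffMeasure_eq_zero_of_muHE {n k : ℕ} {K : Set (E n)}
    (h : (μHE[k] : Measure (E n)) K = 0) : μH[(k : ℝ)] K = 0 := by
  rw [Measure.euclideanHausdorffMeasure_def, Measure.smul_apply, ENNReal.smul_def, smul_eq_mul,
    mul_eq_zero] at h
  refine h.resolve_left ?_
  simpa using Measure.addHaarScalarFactor_volume_hausdorffMeasure_ne_zero k

lemma abs_trace_le {n : ℕ} (L : E n →L[ℝ] E n) :
    |LinearMap.trace ℝ (E n) (L : E n →ₗ[ℝ] E n)| ≤ n * ‖L‖ := by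
  rw [trace_eq_sum]
  refine (Finset.abs_sum_le_sum_abs _ _).trans ?_
  have h1 : ∀ i ∈ (Finset.univ : Finset (Fin n)), |L (EuclideanSpace.single i 1) i| ≤ ‖L‖ := by
    intro i _
    have h2 := PiLp.norm_apply_le (L (EuclideanSpace.single i (1 : ℝ))) i
    have h3 := L.le_opNorm (EuclideanSpace.single i (1 : ℝ))
    simp only [PiLp.norm_single, norm_one, mul_one] at h3
    exact h2.trans h3
  exact (Finset.sum_le_sum h1).trans (by simp)

lemma abs_surfDiv_le {n : ℕ} (S : Set (E n)) (b : E n → E n) (x : E n) :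
    |surfDiv S b x| ≤ n * ‖fderiv ℝ b x‖ := by
  refine (abs_trace_le _).trans (mul_le_mul_of_nonneg_left ?_ (Nat.cast_nonneg n))
  refine (ContinuousLinearMap.opNorm_comp_le _ _).trans ?_
  exact mul_le_of_le_one_left (norm_nonneg _) (Submodule.starProjection_norm_le _)

lemma surfDiv_smul {n : ℕ} {S : Set (E n)} {b : E n → E n} {φ : E n → ℝ} {x : E n}
    (hφ : DifferentiableAt ℝ φ x) (hb : DifferentiableAt ℝ b x) (hbx : b x ∈ tangentSpace S x) :
    surfDiv S (fun y => φ y • b y) x = φ x * surfDiv S b x + fderiv ℝ φ x (b x) := by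
  have h1 : fderiv ℝ (fun y => φ y • b y) x
      = φ x • fderiv ℝ b x + (fderiv ℝ φ x).smulRight (b x) := fderiv_fun_smul hφ hb
  have h2 : (tangentSpace S x).starProjection (b x) = b x :=
    Submodule.starProjection_eq_self_iff.2 hbx
  rw [surfDiv, surfDiv, h1, trace_eq_sum, trace_eq_sum, Finset.mul_sum]
  simp only [ContinuousLinearMap.comp_apply, _root_.add_apply, _root_.smul_apply, map_add, map_smul,
    PiLp.add_apply, PiLp.smul_apply, smul_eq_mul, ContinuousLinearMap.smulRight_apply,
    Finset.sum_add_distrib, h2]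
  congr 1
  conv_rhs => rw [← (EuclideanSpace.basisFun (Fin n) ℝ).sum_repr (b x)]
  simp [map_sum, mul_comm]

namespace IsAdapted

variable {n k : ℕ} {hk : k + 1 ≤ n} {S : Set (E n)} {Φ : OpenPartialHomeomorph (E n) (E n)}

/-- The definition goes through a tangent space that depends on the point in no evident way. In a
chart it becomes the divergence of the field times the Jacobian, divided by the Jacobian, which is
visibly continuous. -/
lemma continuousOn_surfDiv (h : IsAdapted hk S Φ) {b : E n → E n} (hb : ContDiff ℝ ∞ b)
    (hbt : ∀ x ∈ S, b x ∈ tangentSpace S x) : ContinuousOn (surfDiv S b) (S ∩ Φ.source) := by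
  have hJ := (h.smooth.contDiffOn_jac_param (hd := hk))
  have hcont : ContinuousOn (fun z => (fderiv ℝ (jac (param hk Φ)) z (pull hk Φ b z) +
      jac (param hk Φ) z * dvg (pull hk Φ b) z) / jac (param hk Φ) z) (pdom hk Φ) :=
    (((hJ.continuousOn_fderiv_of_isOpen isOpen_pdom (by simp)).clm_apply
      (h.smooth.contDiffOn_pull hb).continuousOn).add
      (hJ.continuousOn.mul (h.continuousOn_dvg_pull hb))).div hJ.continuousOn
      fun z hz => (normDet_pos (h.smooth.injective_fderiv_param hz)).ne'
  have hpc : ∀ y ∈ S ∩ Φ.source, param hk Φ (coord hk Φ y) = y ∧ coord hk Φ y ∈ pdom hk Φ :=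
    fun y hy => param_coord hy.2 ((h.flat y hy.2).1 hy.1).1
  refine ContinuousOn.congr (hcont.comp (h.smooth.contDiffOn_coord.continuousOn.mono
    inter_subset_right) fun y hy => (hpc y hy).2) fun y hy => ?_
  obtain ⟨h1, h2⟩ := hpc y hy
  have h3 : coord hk Φ y ∈ upper k := (h.param_mem_iff h2).1 (by rw [h1]; exact hy.1)
  have h4 := h.jac_mul_surfDiv hb hbt h2 h3 (φ := fun _ => 1) contDiff_const
  simp only [one_smul, mul_one, h1] at h4
  have h5 := (normDet_pos (h.smooth.injective_fderiv_param h2)).ne'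
  simp only [Function.comp_apply]
  rw [← h4]
  exact (mul_div_cancel_left₀ _ h5).symm

/-- The normal is obtained by choice at each point, but the chart formula for its product with `b`
does not depend on the choice and is continuous. -/
lemma continuousOn_inner_normal (h : IsAdapted hk S Φ) {b : E n → E n} (hb : ContDiff ℝ ∞ b)
    (hbt : ∀ x ∈ S, b x ∈ tangentSpace S x) :
    ContinuousOn (fun x => inner ℝ (normal S x) (b x)) (bdry S ∩ Φ.source) := by
  have hJ₀ : ContinuousOn (jac fun w => param hk Φ (face k w)) (face k ⁻¹' pdom hk Φ) :=
    (contDiffOn_jac (m := 0) isOpen_face_pdom (by simpa using h.contDiffOn_param_face)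
      fun w hw => h.injective_fderiv_param_face hw).continuousOn
  have hJ := (h.smooth.contDiffOn_jac_param (hd := hk)).continuousOn
  have hB := (h.smooth.contDiffOn_pull (hd := hk) hb).continuousOn
  have hf : MapsTo (face k) (face k ⁻¹' pdom hk Φ) (pdom hk Φ) := fun w hw => hw
  have hcont : ContinuousOn (fun w => -(pull hk Φ b (face k w) (Fin.last k) *
      jac (param hk Φ) (face k w)) / jac (fun w => param hk Φ (face k w)) w)
      (face k ⁻¹' pdom hk Φ) :=
    (((continuous_last k).comp_continuousOn
      (hB.comp (face k).continuous.continuousOn hf)).mul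
      (hJ.comp (face k).continuous.continuousOn hf)).neg.div hJ₀
      fun w hw => (normDet_pos (h.injective_fderiv_param_face hw)).ne'
  have hpc : ∀ y ∈ bdry S ∩ Φ.source, ∃ w, face k w ∈ pdom hk Φ ∧ param hk Φ (face k w) = y ∧
      projl k.le_succ (coord hk Φ y) = w := by
    intro y hy
    rw [h.bdry_inter_source] at hy
    obtain ⟨w, hw, rfl⟩ := hy
    refine ⟨w, hw, rfl, ?_⟩
    simp only
    rw [coord_param hw, projl_incl]
  refine ContinuousOn.congr (hcont.comp ((projl k.le_succ).continuous.comp_continuousOn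
    ((h.smooth.contDiffOn_coord (hd := hk)).continuousOn.mono inter_subset_right)) fun y hy => ?_)
      fun y hy => ?_
  · obtain ⟨w, hw, -, h2⟩ := hpc y hy
    simp only [Function.comp_apply]
    rw [h2]; exact hw
  · obtain ⟨w, hw, h1, h2⟩ := hpc y hy
    have h4 := h.jac_mul_inner_normal hb hbt hw
    have h5 := (normDet_pos (h.injective_fderiv_param_face hw)).ne'
    simp only [Function.comp_apply]
    rw [h2, ← h4, h1]
    exact (mul_div_cancel_left₀ _ h5).symm

end IsAdapted

end Fractured

end

/-! ### Renormalization and the energy identity on a piece. -/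

noncomputable section

namespace Fractured

open Filter Topology
open scoped ENNReal NNReal

/-- A bounded approximation of `t ^ 2`. -/
def softSq (δ t : ℝ) : ℝ := t ^ 2 / (1 + δ * t ^ 2)

section SoftSq

variable {δ : ℝ}

lemma softSq_den_pos (hδ : 0 < δ) (t : ℝ) : 0 < 1 + δ * t ^ 2 := by positivity

lemma contDiff_softSq (hδ : 0 < δ) : ContDiff ℝ 1 (softSq δ) := by
  unfold softSq
  exact (contDiff_id.pow 2).div (contDiff_const.add (contDiff_const.mul (contDiff_id.pow 2)))
    fun t => (softSq_den_pos hδ t).ne'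

lemma deriv_softSq (hδ : 0 < δ) (t : ℝ) : deriv (softSq δ) t = 2 * t / (1 + δ * t ^ 2) ^ 2 := by
  have h1 : HasDerivAt (fun t : ℝ => t ^ 2) (2 * t) t := by simpa using hasDerivAt_pow 2 t
  have h2 := (h1.fun_div ((h1.const_mul δ).const_add 1) (softSq_den_pos hδ t).ne').deriv
  change deriv (fun t => t ^ 2 / (1 + δ * t ^ 2)) t = _
  rw [h2]
  congr 1
  ring

lemma softSq_nonneg (hδ : 0 < δ) (t : ℝ) : 0 ≤ softSq δ t :=
  div_nonneg (sq_nonneg t) (softSq_den_pos hδ t).le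

lemma softSq_le (hδ : 0 < δ) (t : ℝ) : softSq δ t ≤ t ^ 2 :=
  div_le_self (sq_nonneg t) (by nlinarith [mul_nonneg hδ.le (sq_nonneg t)])

lemma abs_softSq_le (hδ : 0 < δ) (t : ℝ) : |softSq δ t| ≤ 1 / δ := by
  rw [abs_of_nonneg (softSq_nonneg hδ t), softSq, div_le_div_iff₀ (softSq_den_pos hδ t) hδ]
  linarith

/-- This bound does not depend on `δ` and serves for domination as `δ → 0`. The next one is uniform
in `t`, as renormalization requires for fixed `δ`. -/
lemma abs_deriv_softSq_le' (hδ : 0 < δ) (t : ℝ) : |deriv (softSq δ) t| ≤ 2 * |t| := by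
  have h1 : 1 ≤ 1 + δ * t ^ 2 := by nlinarith [mul_nonneg hδ.le (sq_nonneg t)]
  rw [deriv_softSq hδ, abs_div, abs_mul, abs_two, abs_of_pos (pow_pos (softSq_den_pos hδ t) 2)]
  exact div_le_self (by positivity) (one_le_pow₀ h1)

lemma abs_deriv_softSq_le (hδ : 0 < δ) (hδ1 : δ ≤ 1) (t : ℝ) : |deriv (softSq δ) t| ≤ 1 / δ := by
  have h1 : 1 ≤ 1 + δ * t ^ 2 := by nlinarith [mul_nonneg hδ.le (sq_nonneg t)]
  rw [deriv_softSq hδ, abs_div, abs_mul, abs_two, abs_of_pos (pow_pos (softSq_den_pos hδ t) 2),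
    div_le_div_iff₀ (pow_pos (softSq_den_pos hδ t) 2) hδ]
  have h2 : 2 * |t| ≤ 1 + t ^ 2 := by nlinarith [sq_nonneg (|t| - 1), sq_abs t]
  have h3 : 2 * |t| * δ ≤ 1 + δ * t ^ 2 := by nlinarith
  nlinarith

lemma tendsto_softSq {δ : ℕ → ℝ} (hδ : Tendsto δ atTop (𝓝 0)) (t : ℝ) :
    Tendsto (fun m => softSq (δ m) t) atTop (𝓝 (t ^ 2)) := by
  have h1 : Tendsto (fun m => 1 + δ m * t ^ 2) atTop (𝓝 (1 + 0 * t ^ 2)) :=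
    (hδ.mul_const _).const_add 1
  have h2 : Tendsto (fun m => t ^ 2 / (1 + δ m * t ^ 2)) atTop (𝓝 (t ^ 2 / (1 + 0 * t ^ 2))) :=
    tendsto_const_nhds.div h1 (by simp)
  simpa [softSq] using h2

lemma tendsto_deriv_softSq {δ : ℕ → ℝ} (hδ0 : ∀ m, 0 < δ m) (hδ : Tendsto δ atTop (𝓝 0)) (t : ℝ) :
    Tendsto (fun m => deriv (softSq (δ m)) t) atTop (𝓝 (2 * t)) := by
  have h1 : Tendsto (fun m => (1 + δ m * t ^ 2) ^ 2) atTop (𝓝 ((1 + 0 * t ^ 2) ^ 2)) :=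
    ((hδ.mul_const _).const_add 1).pow 2
  have h2 : Tendsto (fun m => 2 * t / (1 + δ m * t ^ 2) ^ 2) atTop
      (𝓝 (2 * t / (1 + 0 * t ^ 2) ^ 2)) := tendsto_const_nhds.div h1 (by simp)
  simpa [deriv_softSq (hδ0 _)] using h2

end SoftSq

namespace FracturedDomain

variable {n : ℕ} (D : FracturedDomain n) {k : ℕ} {i : Fin D.N} {b : E n → E n}

lemma exists_bound_surfDiv (hb : ContDiff ℝ ∞ b) : ∃ M, ∀ x ∈ D.S i, |surfDiv (D.S i) b x| ≤ M := by
  obtain ⟨M, hM⟩ := (D.isCompact_closure i).exists_bound_of_continuousOn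
    (hb.continuous_fderiv (by simp)).continuousOn
  exact ⟨n * M, fun x hx => (abs_surfDiv_le _ _ _).trans
    (mul_le_mul_of_nonneg_left (hM x (subset_closure hx)) (Nat.cast_nonneg n))⟩

lemma continuousOn_surfDiv (hi : D.dim i = k + 1) (hb : ContDiff ℝ ∞ b)
    (hbt : ∀ x ∈ D.S i, b x ∈ tangentSpace (D.S i) x) :
    ContinuousOn (surfDiv (D.S i) b) (D.S i) := by
  have hk : k + 1 ≤ n := hi ▸ D.dim_le i
  intro x hx
  have h1 := D.smooth i
  rw [hi] at h1
  obtain ⟨Φ, hΦ, hxΦ⟩ := h1.exists_isAdapted hk hx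
  exact (hΦ.continuousOn_surfDiv hb hbt x ⟨hx, hxΦ⟩).mono_of_mem_nhdsWithin
    (inter_mem_nhdsWithin _ (Φ.open_source.mem_nhds hxΦ))

/-- Continuity of the normal component holds off the singular set, which is null for the boundary
measure. -/
lemma aestronglyMeasurable_normal (hi : D.dim i = k + 1) (hb : ContDiff ℝ ∞ b)
    (hbt : ∀ x ∈ D.S i, b x ∈ tangentSpace (D.S i) x) :
    AEStronglyMeasurable (fun x => inner ℝ (normal (D.S i) x) (b x))
      ((μHE[k] : Measure (E n)).restrict (bdry (D.S i))) ∧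
    ∃ M, ∀ᵐ x ∂((μHE[k] : Measure (E n)).restrict (bdry (D.S i))),
      |inner ℝ (normal (D.S i) x) (b x)| ≤ M := by
  have hk : k + 1 ≤ n := hi ▸ D.dim_le i
  obtain ⟨K, hK, hK0, -, hreg⟩ := D.exists_singular_set hk hi
  have hm : MeasurableSet (bdry (D.S i)) := (D.isClosed_bdry i).measurableSet
  have he : (μHE[k] : Measure (E n)).restrict (bdry (D.S i)) =
      (μHE[k] : Measure (E n)).restrict (bdry (D.S i) \ K) :=
    Measure.restrict_congr_set (sdiff_null_ae_eq_self hK0).symm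
  have hm' : MeasurableSet (bdry (D.S i) \ K) := hm.diff hK.measurableSet
  rw [he]
  constructor
  · refine ContinuousOn.aestronglyMeasurable (fun x hx => ?_) hm'
    obtain ⟨Φ, hΦ, hxΦ⟩ := hreg x ⟨hx.1.1, hx.2⟩
    exact ((hΦ.continuousOn_inner_normal hb hbt x ⟨hx.1, hxΦ⟩).mono_of_mem_nhdsWithin
      (inter_mem_nhdsWithin _ (Φ.open_source.mem_nhds hxΦ))).mono sdiff_subset
  · obtain ⟨M, hM⟩ := (D.isCompact_closure i).exists_bound_of_continuousOn hb.continuous.continuousOn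
    refine ⟨M, ?_⟩
    filter_upwards [ae_restrict_mem hm'] with x hx
    obtain ⟨Φ, hΦ, hxΦ⟩ := hreg x ⟨hx.1.1, hx.2⟩
    have hx' : x ∈ bdry (D.S i) ∩ Φ.source := ⟨hx.1, hxΦ⟩
    rw [hΦ.bdry_inter_source] at hx'
    obtain ⟨w, hw, hwx⟩ := hx'
    have hwx' : param hk Φ (face k w) = x := hwx
    have h1 := (hΦ.normal_param hw).1
    rw [hwx'] at h1
    have h2 := abs_real_inner_le_norm (normal (D.S i) x) (b x)
    rw [h1, one_mul] at h2
    exact h2.trans (hM x hx.1.1)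

variable {v g τ : E n → ℝ}

section Weights

variable {ν : Measure (E n)} {κ : E n → ℝ}

/-- Measurability is known for the weighted trace only. Dividing by the weight recovers `τ` where `κ
≠ 0`, and elsewhere the product vanishes. -/
lemma aestronglyMeasurable_mul_comp (hκ : AEStronglyMeasurable κ ν)
    (hτ : AEStronglyMeasurable (fun x => √|κ x| * τ x) ν) {q : ℝ → ℝ} (hq : Continuous q) :
    AEStronglyMeasurable (fun x => κ x * q (τ x)) ν := by
  have hs : AEStronglyMeasurable (fun x => √|κ x|) ν :=
    (Real.continuous_sqrt.comp continuous_abs).comp_aestronglyMeasurable hκ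
  have h1 : AEStronglyMeasurable (fun x => κ x * q ((√|κ x| * τ x) / √|κ x|)) ν :=
    hκ.mul (hq.comp_aestronglyMeasurable (hτ.aemeasurable.div hs.aemeasurable).aestronglyMeasurable)
  refine h1.congr (Eventually.of_forall fun x => ?_)
  simp only
  by_cases h0 : κ x = 0
  · simp [h0]
  · have : √|κ x| ≠ 0 := (Real.sqrt_pos.2 (abs_pos.2 h0)).ne'
    rw [mul_div_cancel_left₀ _ this]

lemma integrable_weight_mul [IsFiniteMeasure ν] (hκ : AEStronglyMeasurable κ ν)
    (hτ : MemLp (fun x => √|κ x| * τ x) 2 ν) {M : ℝ} (hM : ∀ᵐ x ∂ν, |κ x| ≤ M) :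
    Integrable (fun x => κ x * τ x) ν := by
  refine Integrable.mono' ((hτ.integrable one_le_two).norm.const_mul √M)
    (aestronglyMeasurable_mul_comp hκ hτ.1 continuous_id) ?_
  filter_upwards [hM] with x hx
  have h1 : ‖κ x * τ x‖ = √|κ x| * ‖√|κ x| * τ x‖ := by
    rw [norm_mul, norm_mul, ← mul_assoc, Real.norm_eq_abs (√|κ x|),
      abs_of_nonneg (Real.sqrt_nonneg _), Real.mul_self_sqrt (abs_nonneg _), Real.norm_eq_abs]
  rw [h1]
  exact mul_le_mul_of_nonneg_right (Real.sqrt_le_sqrt hx) (norm_nonneg _)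

lemma integrable_weight_mul_sq (hκ : AEStronglyMeasurable κ ν)
    (hτ : MemLp (fun x => √|κ x| * τ x) 2 ν) : Integrable (fun x => κ x * τ x ^ 2) ν := by
  refine Integrable.mono' hτ.integrable_sq
    (aestronglyMeasurable_mul_comp hκ hτ.1 (continuous_pow 2)) (Eventually.of_forall fun x => ?_)
  rw [mul_pow, Real.sq_sqrt (abs_nonneg _), norm_mul, Real.norm_eq_abs, Real.norm_eq_abs,
    abs_of_nonneg (sq_nonneg (τ x))]

end Weights

/-- The renormalized balance law on a piece. -/
theorem renormalization (hi : D.dim i = k + 1) (hb : ContDiff ℝ ∞ b)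
    (hbt : ∀ x ∈ D.S i, b x ∈ tangentSpace (D.S i) x)
    (hv : IntegrableOn v (D.S i) μHE[k + 1]) (hg : IntegrableOn g (D.S i) μHE[k + 1])
    (hτ : MemLp (fun x => √|inner ℝ (normal (D.S i) x) (b x)| * τ x) 2
      ((μHE[k] : Measure (E n)).restrict (bdry (D.S i))))
    (htr : HasTrace (k + 1) (D.S i) b v g τ) {q : ℝ → ℝ} (hq : ContDiff ℝ 1 q) {C C' : ℝ}
    (hqC : ∀ t, |q t| ≤ C) (hqC' : ∀ t, |deriv q t| ≤ C') :
    ∫ x in D.S i, (deriv q (v x) * g x + q (v x) * surfDiv (D.S i) b x) ∂μHE[k + 1] =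
      ∫ x in bdry (D.S i), inner ℝ (normal (D.S i) x) (b x) * q (τ x) ∂μHE[k] := by
  have hk : k + 1 ≤ n := hi ▸ D.dim_le i
  obtain ⟨K, hK, hK0, hSK, hreg⟩ := D.exists_singular_set hk hi
  obtain ⟨A, hA, hAS⟩ := D.exists_measure_ball_le i
  rw [hi] at hAS
  have hSm := D.measurableSet_S i
  have hbm : MeasurableSet (bdry (D.S i)) := (D.isClosed_bdry i).measurableSet
  set μ := (μHE[k + 1] : Measure (E n)).restrict (D.S i) with hμ
  set ν := (μHE[k] : Measure (E n)).restrict (bdry (D.S i)) with hν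
  have hμf : IsFiniteMeasure μ := ⟨by
    rw [hμ, Measure.restrict_apply_univ]
    have := D.measure_closure_lt_top i
    rw [hi] at this
    exact (measure_mono subset_closure).trans_lt this⟩
  have hνf : IsFiniteMeasure ν := ⟨by
    rw [hν, Measure.restrict_apply_univ]
    exact D.measure_bdry_lt_top hi⟩
  obtain ⟨hκm, M, hM⟩ := D.aestronglyMeasurable_normal hi hb hbt
  obtain ⟨M', hM'⟩ := D.exists_bound_surfDiv (i := i) hb
  have hdm : AEStronglyMeasurable (surfDiv (D.S i) b) μ :=
    (D.continuousOn_surfDiv hi hb hbt).aestronglyMeasurable hSm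
  have hdb : ∀ᵐ x ∂μ, ‖surfDiv (D.S i) b x‖ ≤ M' := by
    filter_upwards [ae_restrict_mem hSm] with x hx using hM' x hx
  have hqm : AEStronglyMeasurable (fun x => q (v x)) μ :=
    hq.continuous.comp_aestronglyMeasurable hv.aestronglyMeasurable
  have hqm' : AEStronglyMeasurable (fun x => deriv q (v x)) μ :=
    (hq.continuous_deriv le_rfl).comp_aestronglyMeasurable hv.aestronglyMeasurable
  have i1 : Integrable (fun x => deriv q (v x) * g x) μ :=
    Integrable.bdd_mul (c := C') hg hqm' (Eventually.of_forall fun z => hqC' _)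
  have i0 : Integrable (fun x => q (v x)) μ :=
    Integrable.of_bound hqm C (Eventually.of_forall fun x => hqC _)
  have i2 : Integrable (fun x => q (v x) * surfDiv (D.S i) b x) μ := i0.mul_bdd (c := M') hdm hdb
  have i3 : Integrable (fun x => inner ℝ (normal (D.S i) x) (b x) * q (τ x)) ν := by
    refine Integrable.of_bound (aestronglyMeasurable_mul_comp hκm hτ.1 hq.continuous) (M * C) ?_
    filter_upwards [hM] with x hx
    rw [norm_mul]
    exact mul_le_mul hx (hqC _) (norm_nonneg _) ((abs_nonneg _).trans hx)
  -- The product rule splits the divergence of `φ • b`. The part with `φ` joins `q'(v) g` in `G₁`,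
  -- and the part with the gradient of `φ` has the bounded coefficient `G₂ = q(v)`.
  refine integral_eq_of_local (d := k) (G₂ := fun x => q (v x)) (b := b) (D.isCompact_closure i) hK
    ?_ ?_ ?_ ?_ (hausdorffMeasure_eq_zero_of_muHE hK0) hA ?_ (i1.add i2) hqm
    (fun x => hqC (v x)) i3 hb.continuous ?_
  · rw [hμ, Measure.restrict_apply isClosed_closure.measurableSet.compl]
    rw [(disjoint_compl_left_iff_subset.2 subset_closure).inter_eq, measure_empty]
  · rw [hν, Measure.restrict_apply isClosed_closure.measurableSet.compl]
    rw [(disjoint_compl_left_iff_subset.2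
      (show bdry (D.S i) ⊆ closure (D.S i) from sdiff_subset)).inter_eq, measure_empty]
  · rw [hμ, Measure.restrict_apply hK.measurableSet, inter_comm, hSK.inter_eq, measure_empty]
  · rw [hν]
    exact Measure.absolutelyContinuous_of_le Measure.restrict_le_self hK0
  · intro z r hr
    rw [hμ, Measure.restrict_apply Metric.isOpen_ball.measurableSet, inter_comm]
    exact (measure_mono (inter_subset_inter_left _ subset_closure)).trans (hAS z r hr)
  · intro x hx
    obtain ⟨Φ, hΦ, hxΦ⟩ := hreg x hx
    refine ⟨Φ.source, Φ.open_source, hxΦ, fun φ hφ hφc hφs => ?_⟩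
    rw [← hΦ.renormalization hSm hbm hb hbt hv hg (integrable_weight_mul hκm hτ hM) htr hq hqC hqC'
      hφ hφc hφs]
    obtain ⟨Mφ, hMφ⟩ := hφc.exists_bound_of_continuous hφ.continuous
    have j1 : Integrable (fun x => deriv q (v x) * g x * φ x) μ :=
      i1.mul_bdd (c := Mφ) hφ.continuous.aestronglyMeasurable (Eventually.of_forall hMφ)
    have hsd : ∀ x ∈ D.S i, surfDiv (D.S i) (fun y => φ y • b y) x =
        φ x * surfDiv (D.S i) b x + fderiv ℝ φ x (b x) := fun x hx =>
      surfDiv_smul (hφ.differentiable one_ne_zero x) (hb.differentiable (by simp) x) (hbt x hx)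
    obtain ⟨j3, j4⟩ := integrable_test i2 hqm (fun x => hqC (v x)) hb.continuous hφ hφc
    have j2 : Integrable (fun x => q (v x) * surfDiv (D.S i) (fun y => φ y • b y) x) μ := by
      refine (integrable_congr ?_).1 (j3.add j4)
      filter_upwards [ae_restrict_mem hSm] with x hx
      simp only [Pi.add_apply]
      rw [hsd x hx]
      ring
    rw [← integral_add j1 j2]
    refine integral_congr_ae ?_
    filter_upwards [ae_restrict_mem hSm] with x hx
    rw [hsd x hx]
    ring

/-- The energy identity on a piece. -/
theorem energy_identity (hi : D.dim i = k + 1) (hb : ContDiff ℝ ∞ b)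
    (hbt : ∀ x ∈ D.S i, b x ∈ tangentSpace (D.S i) x)
    (hv : MemLp v 2 ((μHE[k + 1] : Measure (E n)).restrict (D.S i)))
    (hg : MemLp g 2 ((μHE[k + 1] : Measure (E n)).restrict (D.S i)))
    (hτ : MemLp (fun x => √|inner ℝ (normal (D.S i) x) (b x)| * τ x) 2
      ((μHE[k] : Measure (E n)).restrict (bdry (D.S i))))
    (htr : HasTrace (k + 1) (D.S i) b v g τ) :
    ∫ x in D.S i, (2 * v x * g x + v x ^ 2 * surfDiv (D.S i) b x) ∂μHE[k + 1] =
      ∫ x in bdry (D.S i), inner ℝ (normal (D.S i) x) (b x) * τ x ^ 2 ∂μHE[k] := by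
  have hSm := D.measurableSet_S i
  set μ := (μHE[k + 1] : Measure (E n)).restrict (D.S i) with hμ
  set ν := (μHE[k] : Measure (E n)).restrict (bdry (D.S i)) with hν
  have hμf : IsFiniteMeasure μ := ⟨by
    rw [hμ, Measure.restrict_apply_univ]
    have := D.measure_closure_lt_top i
    rw [hi] at this
    exact (measure_mono subset_closure).trans_lt this⟩
  have hv1 : Integrable v μ := hv.integrable one_le_two
  have hg1 : Integrable g μ := hg.integrable one_le_two
  obtain ⟨hκm, -⟩ := D.aestronglyMeasurable_normal hi hb hbt
  obtain ⟨M', hM'⟩ := D.exists_bound_surfDiv (i := i) hb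
  have hdm : AEStronglyMeasurable (surfDiv (D.S i) b) μ :=
    (D.continuousOn_surfDiv hi hb hbt).aestronglyMeasurable hSm
  have hdb : ∀ᵐ x ∂μ, ‖surfDiv (D.S i) b x‖ ≤ M' := by
    filter_upwards [ae_restrict_mem hSm] with x hx using hM' x hx
  set δ : ℕ → ℝ := fun m => 1 / ((m : ℝ) + 1) with hδ
  have hδ0 : ∀ m, 0 < δ m := fun m => Nat.one_div_pos_of_nat
  have hδ1 : ∀ m, δ m ≤ 1 := fun m => by
    rw [hδ]; simp only
    rw [div_le_one (by positivity)]
    have : (0 : ℝ) ≤ m := Nat.cast_nonneg m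
    linarith
  have hδt : Tendsto δ atTop (𝓝 0) := tendsto_one_div_add_atTop_nhds_zero_nat
  have hid := fun m => D.renormalization hi hb hbt hv1 hg1 hτ htr (contDiff_softSq (hδ0 m))
    (abs_softSq_le (hδ0 m)) (abs_deriv_softSq_le (hδ0 m) (hδ1 m))
  have hL : Tendsto (fun m => ∫ x, (deriv (softSq (δ m)) (v x) * g x +
      softSq (δ m) (v x) * surfDiv (D.S i) b x) ∂μ) atTop
      (𝓝 (∫ x, (2 * v x * g x + v x ^ 2 * surfDiv (D.S i) b x) ∂μ)) := by
    -- Domination uses only `v` and `g` in `L²` and the bound of the divergence, since `softSq` is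
    -- at most `t²` and its derivative at most `2 |t|`, for every `δ`.
    refine tendsto_integral_of_dominated_convergence
      (fun x => 2 * ‖v x * g x‖ + v x ^ 2 * M') (fun m => ?_) ?_ (fun m => ?_) ?_
    · exact ((((contDiff_softSq (hδ0 m)).continuous_deriv le_rfl).comp_aestronglyMeasurable
        hv1.aestronglyMeasurable).mul hg1.aestronglyMeasurable).add
        (((contDiff_softSq (hδ0 m)).continuous.comp_aestronglyMeasurable
          hv1.aestronglyMeasurable).mul hdm)
    · exact ((hv.integrable_mul hg).norm.const_mul 2).add (hv.integrable_sq.mul_const M')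
    · filter_upwards [hdb] with x hx
      refine (norm_add_le _ _).trans (add_le_add ?_ ?_)
      · rw [norm_mul, norm_mul, ← mul_assoc]
        exact mul_le_mul_of_nonneg_right (abs_deriv_softSq_le' (hδ0 m) _) (norm_nonneg _)
      · rw [norm_mul, Real.norm_eq_abs, abs_of_nonneg (softSq_nonneg (hδ0 m) _)]
        exact mul_le_mul (softSq_le (hδ0 m) _) hx (norm_nonneg _) (sq_nonneg _)
    · refine Eventually.of_forall fun x => ?_
      exact ((tendsto_deriv_softSq hδ0 hδt (v x)).mul_const _).add
        ((tendsto_softSq hδt (v x)).mul_const _)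
  have hR : Tendsto (fun m => ∫ x, inner ℝ (normal (D.S i) x) (b x) * softSq (δ m) (τ x) ∂ν) atTop
      (𝓝 (∫ x, inner ℝ (normal (D.S i) x) (b x) * τ x ^ 2 ∂ν)) := by
    refine tendsto_integral_of_dominated_convergence
      (fun x => ‖inner ℝ (normal (D.S i) x) (b x) * τ x ^ 2‖) (fun m => ?_)
      (integrable_weight_mul_sq hκm hτ).norm (fun m => Eventually.of_forall fun x => ?_)
      (Eventually.of_forall fun x => (tendsto_softSq hδt (τ x)).const_mul _)
    · exact aestronglyMeasurable_mul_comp hκm hτ.1 (contDiff_softSq (hδ0 m)).continuous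
    · rw [norm_mul, norm_mul]
      refine mul_le_mul_of_nonneg_left ?_ (norm_nonneg _)
      rw [Real.norm_eq_abs, Real.norm_eq_abs, abs_of_nonneg (softSq_nonneg (hδ0 m) _),
        abs_of_nonneg (sq_nonneg _)]
      exact softSq_le (hδ0 m) _
  exact tendsto_nhds_unique hL (hR.congr fun m => (hid m).symm)

end FracturedDomain

end Fractured

end

/-! ### Points, traces of functions in `V_β`, and decomposition of the interior boundary. -/

noncomputable section

namespace Fractured

open Filter Topology
open scoped ENNReal NNReal

/-- In a chart all points of `S` are sent to zero, so `x` is isolated in `S` and has no tangent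
directions. -/
lemma IsSmoothSubmanifold.tangentSpace_eq_bot {n : ℕ} {S : Set (E n)}
    (hS : IsSmoothSubmanifold 0 S) {x : E n} (hx : x ∈ S) : tangentSpace S x = ⊥ := by
  obtain ⟨Φ, -, hxΦ, h⟩ := hS x hx
  have hzero : ∀ y ∈ Φ.source, y ∈ S → Φ y = 0 := fun y hy hyS => by
    ext k
    exact (h y hy).1 hyS k (Nat.zero_le _)
  have hacc : ¬AccPt x (𝓟 S) := by
    rw [accPt_iff_frequently, not_frequently]
    filter_upwards [Φ.open_source.mem_nhds hxΦ] with y hy hyx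
    exact hyx.1 (Φ.injOn hy hxΦ ((hzero y hy hyx.2).trans (hzero x hxΦ hx).symm))
  rw [tangentSpace, Submodule.span_eq_bot]
  intro y hy
  exact tangentConeAt_subset_zero hacc hy

lemma surfDiv_eq_zero {n : ℕ} {S : Set (E n)} {x : E n} (h : tangentSpace S x = ⊥)
    (b : E n → E n) : surfDiv S b x = 0 := by
  have h1 : ((tangentSpace S x).starProjection ∘L fderiv ℝ b x : E n →L[ℝ] E n) = 0 := by
    rw [h]
    ext1 y
    simp
  rw [surfDiv, h1]
  simp

lemma restrict_biUnion_finset_eq_sum {X ι : Type*} [MeasurableSpace X] (μ : Measure X)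
    (s : Finset ι) {t : ι → Set X} (ht : ∀ j ∈ s, MeasurableSet (t j))
    (hd : (s : Set ι).PairwiseDisjoint t) :
    μ.restrict (⋃ j ∈ s, t j) = ∑ j ∈ s, μ.restrict (t j) := by
  classical
  induction s using Finset.induction_on with
  | empty => simp
  | insert a s ha ih =>
    rw [Finset.sum_insert ha, Finset.set_biUnion_insert, Measure.restrict_union,
      ih (fun j hj => ht j (Finset.mem_insert_of_mem hj))
        (hd.subset (by simp [subset_insert]))]
    · refine disjoint_iUnion₂_right.2 fun j hj => hd (by simp) (by simp [hj]) ?_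
      rintro rfl
      exact ha hj
    · exact Finset.measurableSet_biUnion s fun j hj => ht j (Finset.mem_insert_of_mem hj)

namespace FracturedDomain

variable {n : ℕ} (D : FracturedDomain n)

lemma bdry_eq_empty {i : Fin D.N} (hi : D.dim i = 0) : bdry (D.S i) = ∅ := by
  refine subset_empty_iff.1 ((D.bdry_subset i).trans fun x hx => ?_)
  obtain ⟨j, hj, -⟩ := mem_iUnion₂.1 hx
  have : D.dim j < D.dim i := hj
  omega

instance isFiniteMeasure_vol (i : Fin D.N) : IsFiniteMeasure (D.vol i) := ⟨by
  rw [vol, Measure.restrict_apply_univ]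
  exact (measure_mono subset_closure).trans_lt (D.measure_closure_lt_top i)⟩

variable {β : Fin D.N → E n → E n} {D} in
lemma IsSmoothTangential.surfDiv (hβ : D.IsSmoothTangential β) {i : Fin D.N} (hi : i ∈ D.comps) :
    AEStronglyMeasurable (surfDiv (D.S i) (β i)) (D.vol i) ∧
      ∃ M, ∀ᵐ x ∂D.vol i, ‖Fractured.surfDiv (D.S i) (β i) x‖ ≤ M := by
  have hSm := D.measurableSet_S i
  rcases Nat.eq_zero_or_eq_succ_pred (D.dim i) with h | h
  · have h0 : ∀ᵐ x ∂D.vol i, Fractured.surfDiv (D.S i) (β i) x = 0 := by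
      filter_upwards [ae_restrict_mem hSm] with x hx
      exact surfDiv_eq_zero ((h ▸ D.smooth i : IsSmoothSubmanifold 0 (D.S i)).tangentSpace_eq_bot hx)
        _
    refine ⟨(aestronglyMeasurable_const (b := (0 : ℝ))).congr
      (h0.mono fun x hx => hx.symm), 0, h0.mono fun x hx => by rw [hx, norm_zero]⟩
  · have h' : D.dim i = (D.dim i - 1) + 1 := h
    obtain ⟨M, hM⟩ := D.exists_bound_surfDiv (i := i) (hβ i hi).1
    refine ⟨(D.continuousOn_surfDiv h' (hβ i hi).1 (hβ i hi).2).aestronglyMeasurable hSm, M, ?_⟩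
    filter_upwards [ae_restrict_mem hSm] with x hx using hM x hx

variable {β : Fin D.N → E n → E n} {D} in
lemma IsSmoothTangential.nuBeta (hβ : D.IsSmoothTangential β) {i : Fin D.N} (hi : i ∈ D.comps) :
    AEStronglyMeasurable (D.nuBeta β i) (D.bvol i) ∧
      ∃ M, ∀ᵐ x ∂D.bvol i, |D.nuBeta β i x| ≤ M := by
  rcases Nat.eq_zero_or_eq_succ_pred (D.dim i) with h | h
  · have h0 : D.bvol i = 0 := by
      rw [bvol, D.bdry_eq_empty h, Measure.restrict_empty]
    rw [h0]
    exact ⟨aestronglyMeasurable_zero_measure _, 0, by simp⟩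
  · have h' : D.dim i = (D.dim i - 1) + 1 := h
    exact D.aestronglyMeasurable_normal h' (hβ i hi).1 (hβ i hi).2

section Traces

variable {D} {β : Fin D.N → E n → E n} {v : D.Fun} {i : Fin D.N}

lemma memLp_betaGrad (hv : v ∈ D.V β) (hi : i ∈ D.comps) : MemLp (D.betaGrad β v i) 2 (D.vol i) :=
  (Classical.epsilon_spec (hv i hi).2.1).1

lemma isTrace_trace (hv : v ∈ D.V β) (hi : i ∈ D.comps) : D.IsTrace β v i (D.trace β v i) :=
  Classical.epsilon_spec (hv i hi).2.2

/-- The energy identity on a component. -/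
theorem energy_identity_comp (hβ : D.IsSmoothTangential β) (hv : v ∈ D.V β) (hi : i ∈ D.comps) :
    ∫ x, (2 * v i x * D.betaGrad β v i x + v i x ^ 2 * surfDiv (D.S i) (β i) x) ∂D.vol i =
      ∫ x, D.nuBeta β i x * D.trace β v i x ^ 2 ∂D.bvol i := by
  have hvi := (hv i hi).1
  have hg := memLp_betaGrad hv hi
  obtain ⟨hτ, htr⟩ := isTrace_trace hv hi
  rcases Nat.eq_zero_or_eq_succ_pred (D.dim i) with h | h
  -- In dimension zero the truncated `dim - 1` is again zero, but the boundary is empty. The surface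
  -- divergence vanishes as well, so the trace identity forces the derivative to be zero.
  · have h0 : D.bvol i = 0 := by
      rw [bvol, D.bdry_eq_empty h, Measure.restrict_empty]
    have htan : ∀ x ∈ D.S i, tangentSpace (D.S i) x = ⊥ := fun x hx =>
      (h ▸ D.smooth i : IsSmoothSubmanifold 0 (D.S i)).tangentSpace_eq_bot hx
    have hg0 : ∀ᵐ x ∂D.vol i, D.betaGrad β v i x = 0 := by
      refine ae_eq_zero_of_integral_contDiff_smul_eq_zero
        (hg.integrable one_le_two).locallyIntegrable fun φ hφ hφc => ?_
      have h1 := htr φ hφ hφc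
      have h2 : ∫ x in D.S i, v i x * surfDiv (D.S i) (fun y => φ y • β i y) x ∂μHE[D.dim i] = 0 := by
        refine setIntegral_eq_zero_of_forall_eq_zero fun x hx => ?_
        rw [surfDiv_eq_zero (htan x hx), mul_zero]
      rw [D.bdry_eq_empty h, h2, Measure.restrict_empty, integral_zero_measure, add_zero] at h1
      rw [← h1, vol]
      exact integral_congr_ae (Eventually.of_forall fun x => mul_comm _ _)
    rw [h0, integral_zero_measure]
    refine integral_eq_zero_of_ae ?_
    filter_upwards [hg0, ae_restrict_mem (D.measurableSet_S i)] with x hx hxS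
    rw [hx, surfDiv_eq_zero (htan x hxS)]
    simp
  · obtain ⟨k, hk⟩ : ∃ k, D.dim i = k + 1 := ⟨_, h⟩
    have hd : D.dim i - 1 = k := by omega
    unfold vol at hvi hg ⊢
    unfold bvol at hτ ⊢
    rw [hd] at hτ ⊢
    rw [hk] at hvi hg htr ⊢
    exact D.energy_identity hk (hβ i hi).1 (hβ i hi).2 hvi hg hτ htr

end Traces

open Classical in
/-- The interior boundary of a component is made up of components of one dimension less. -/
lemma bvol_restrict_compl_frontier (i : Fin D.N) :
    (D.bvol i).restrict (frontier D.Ω)ᶜ =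
      ∑ j ∈ D.comps with D.dim j + 1 = D.dim i, (D.vol j).restrict (bdry (D.S i)) := by
  have hbm : MeasurableSet (bdry (D.S i)) := (D.isClosed_bdry i).measurableSet
  rcases Nat.eq_zero_or_eq_succ_pred (D.dim i) with h | h
  · rw [bvol, D.bdry_eq_empty h]
    simp
  obtain ⟨k, hk⟩ : ∃ k, D.dim i = k + 1 := ⟨_, h⟩
  have hd : D.dim i - 1 = k := by omega
  set L := D.comps.filter fun j => D.dim j + 1 = D.dim i with hL
  have hLk : ∀ j ∈ L, D.dim j = k := fun j hj => by
    have := (Finset.mem_filter.1 hj).2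
    omega
  have hcomp : ∀ j, D.S j ⊆ interior D.Ω → j ∈ D.comps := fun j hj => by
    simp [comps, hj]
  have hsub : ∀ j ∈ L, D.S j ⊆ interior D.Ω := fun j hj => by
    have := (Finset.mem_filter.1 hj).1
    simpa [comps] using this
  rw [bvol, hd, Measure.restrict_restrict isClosed_frontier.measurableSet.compl]
  have hae : ((frontier D.Ω)ᶜ ∩ bdry (D.S i) : Set (E n)) =ᵐ[μHE[k]]
      (⋃ j ∈ L, bdry (D.S i) ∩ D.S j : Set (E n)) := by
    refine (ae_le_set.2 ?_).antisymm (LE.le.eventuallyLE ?_)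
    -- A boundary point off `∂Ω` that is missed by the union lies in a piece of dimension less than
    -- `k`, because a piece that meets the complement of `∂Ω` is a component. Such pieces are null.
    · refine measure_mono_null (t := ⋃ j ∈ {j | D.dim j < k}, closure (D.S j)) ?_ ?_
      · rintro x ⟨⟨hxf, hxb⟩, hxL⟩
        obtain ⟨j, hj, hxj⟩ := mem_iUnion₂.1 (D.bdry_subset i hxb)
        have hj' : D.dim j < D.dim i := hj
        refine mem_iUnion₂.2 ⟨j, ?_, subset_closure hxj⟩
        by_contra hjk
        have hjk' : ¬D.dim j < k := hjk
        refine hxL (mem_iUnion₂.2 ⟨j, Finset.mem_filter.2 ⟨hcomp j ?_, by omega⟩, hxb, hxj⟩)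
        exact (D.frontier_or_interior j).resolve_left fun hfr => hxf (hfr hxj)
      · exact (measure_biUnion_null_iff (to_countable _)).2 fun j hj => D.measure_closure_eq_zero hj
    · intro x hx
      obtain ⟨j, hj, hxb, hxj⟩ := mem_iUnion₂.1 hx
      exact ⟨fun hf => hf.2 (hsub j hj hxj), hxb⟩
  rw [Measure.restrict_congr_set hae, restrict_biUnion_finset_eq_sum]
  · refine Finset.sum_congr rfl fun j hj => ?_
    rw [vol, Measure.restrict_restrict hbm, hLk j hj]
  · exact fun j _ => hbm.inter (D.measurableSet_S j)
  · exact fun j _ j' _ hjj' => (D.disjoint j j' hjj').mono inter_subset_right inter_subset_right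

end FracturedDomain

end Fractured

end

/-! ### Interface terms, the quadratic form, and coercivity. -/

noncomputable section

namespace Fractured

open Filter Topology
open scoped ENNReal NNReal

lemma absNeg_eq (t : ℝ) : absNeg t = (|t| - t) / 2 := by
  rcases le_total 0 t with h | h
  · simp [absNeg, abs_of_nonneg h, h]
  · rw [absNeg, min_eq_left h, abs_of_nonpos h]
    ring

lemma absNeg_nonneg (t : ℝ) : 0 ≤ absNeg t := abs_nonneg _

lemma absNeg_le_abs (t : ℝ) : absNeg t ≤ |t| := by
  rw [absNeg_eq]
  linarith [neg_le_abs t]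

lemma integrable_absNeg_mul_sq {X : Type*} [MeasurableSpace X] {μ : Measure X} {w f : X → ℝ}
    (h : Integrable (fun x => w x * f x ^ 2) μ) : Integrable (fun x => absNeg (w x) * f x ^ 2) μ := by
  refine ((h.norm.sub h).div_const 2).congr (Eventually.of_forall fun x => ?_)
  simp only [Pi.sub_apply]
  rw [absNeg_eq, Real.norm_eq_abs, abs_mul, abs_of_nonneg (sq_nonneg (f x))]
  ring

/-- Pointwise, `t + 2 |t|_- = |t| ≥ |t|_-`. -/
lemma integral_absNeg_mul_sq_le {X : Type*} [MeasurableSpace X] {μ : Measure X} {w f : X → ℝ}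
    (h : Integrable (fun x => w x * f x ^ 2) μ) :
    ∫ x, absNeg (w x) * f x ^ 2 ∂μ ≤
      ∫ x, w x * f x ^ 2 ∂μ + 2 * ∫ x, absNeg (w x) * f x ^ 2 ∂μ := by
  have h' := integrable_absNeg_mul_sq h
  rw [← integral_const_mul, ← integral_add h (h'.const_mul 2)]
  refine integral_mono h' (h.add (h'.const_mul 2)) fun x => ?_
  have h1 := absNeg_le_abs (w x)
  have h2 := absNeg_eq (w x)
  simp only
  nlinarith [sq_nonneg (f x)]

namespace FracturedDomain

variable {n : ℕ} (D : FracturedDomain n)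

open Classical in
/-- The components of one dimension more. -/
def upper (j : Fin D.N) : Finset (Fin D.N) := D.comps.filter fun i => D.dim i = D.dim j + 1

/-- The measure on the part of the boundary of one piece that lies in another piece. -/
def ivol (i j : Fin D.N) : Measure (E n) := (D.vol j).restrict (bdry (D.S i))

lemma sumJump_mul (f : D.Fun) (h : E n → ℝ) (j : Fin D.N) (x : E n) :
    D.sumJump f j x * h x =
      ∑ i ∈ D.upper j, (bdry (D.S i)).indicator (fun x => f i x * h x) x := by
  classical
  rw [sumJump, Finset.sum_mul, upper, ← Finset.filter_filter, Finset.sum_filter]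
  refine Finset.sum_congr (Finset.filter_congr_decidable ..) fun i _ => ?_
  rw [indicator_apply]

lemma integrable_sumJump_mul {f : D.Fun} {h : E n → ℝ} {j : Fin D.N}
    (hf : ∀ i ∈ D.upper j, Integrable (fun x => f i x * h x) (D.ivol i j)) :
    Integrable (fun x => D.sumJump f j x * h x) (D.vol j) := by
  simp only [sumJump_mul]
  exact integrable_finsetSum _ fun i hi =>
    (integrable_indicator_iff (D.isClosed_bdry i).measurableSet).2 (hf i hi)

lemma integral_sumJump_mul {f : D.Fun} {h : E n → ℝ} {j : Fin D.N}
    (hf : ∀ i ∈ D.upper j, Integrable (fun x => f i x * h x) (D.ivol i j)) :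
    ∫ x, D.sumJump f j x * h x ∂D.vol j = ∑ i ∈ D.upper j, ∫ x, f i x * h x ∂D.ivol i j := by
  simp only [sumJump_mul]
  rw [integral_finsetSum _ fun i hi =>
    (integrable_indicator_iff (D.isClosed_bdry i).measurableSet).2 (hf i hi)]
  exact Finset.sum_congr rfl fun i _ => integral_indicator (D.isClosed_bdry i).measurableSet

/-- Integration over the interior boundary, sorted by the components that carry it. -/
lemma sum_integral_compl_frontier {f : D.Fun}
    (hf : ∀ j ∈ D.comps, ∀ i ∈ D.upper j, Integrable (f i) (D.ivol i j)) :
    ∑ i ∈ D.comps, ∫ x in (frontier D.Ω)ᶜ, f i x ∂D.bvol i =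
      ∑ j ∈ D.comps, ∑ i ∈ D.upper j, ∫ x, f i x ∂D.ivol i j := by
  classical
  have h1 : ∀ i ∈ D.comps, ∫ x in (frontier D.Ω)ᶜ, f i x ∂D.bvol i =
      ∑ j ∈ D.comps with D.dim j + 1 = D.dim i, ∫ x, f i x ∂D.ivol i j := by
    intro i hi
    rw [bvol_restrict_compl_frontier, integral_finsetSum_measure]
    · exact Finset.sum_congr (Finset.filter_congr_decidable ..) fun _ _ => rfl
    · intro j hj
      obtain ⟨hj1, hj2⟩ := Finset.mem_filter.1 hj
      exact hf j hj1 i (Finset.mem_filter.2 ⟨hi, hj2.symm⟩)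
  rw [Finset.sum_congr rfl h1]
  refine Finset.sum_comm' fun i j => ?_
  simp only [upper, Finset.mem_filter]
  grind

lemma ae_ivol {i j : Fin D.N} {p : E n → Prop} (hp : ∀ x ∈ D.S j, p x) :
    ∀ᵐ x ∂D.ivol i j, p x :=
  ae_restrict_of_ae ((ae_restrict_mem (D.measurableSet_S j)).mono hp)

variable {D} {β : Fin D.N → E n → E n} {α v : D.Fun}

/-- The pieces are disjoint, so only the term of `j` survives in the sum defining the jump. -/
lemma jump_eq {i j : Fin D.N} (hj : j ∈ D.comps) (hij : i ∈ D.upper j) {x : E n} (hx : x ∈ D.S j) :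
    D.jump β v i x = D.trace β v i x - v j x := by
  classical
  rw [jump]
  congr 1
  refine Finset.sum_eq_single_of_mem j ?_ fun j' hj' hne => ?_
  · exact Finset.mem_filter.2 ⟨hj, (Finset.mem_filter.1 hij).2.symm, hx⟩
  · exact absurd hx ((D.disjoint j' j hne).notMem_of_mem_left (Finset.mem_filter.1 hj').2.2)

lemma ivol_le_bvol {i j : Fin D.N} (hj : j ∈ D.comps) (hij : i ∈ D.upper j) :
    D.ivol i j ≤ D.bvol i := by
  classical
  refine le_trans ?_ (Measure.restrict_le_self (s := (frontier D.Ω)ᶜ))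
  rw [bvol_restrict_compl_frontier]
  refine Finset.single_le_sum (f := fun j => (D.vol j).restrict (bdry (D.S i)))
    (fun _ _ => Measure.zero_le _) ?_
  exact Finset.mem_filter.2 ⟨hj, (Finset.mem_filter.1 hij).2.symm⟩

section Interface

variable {i j : Fin D.N}

lemma nuBeta_ivol (hβ : D.IsSmoothTangential β) (hj : j ∈ D.comps) (hij : i ∈ D.upper j) :
    AEStronglyMeasurable (D.nuBeta β i) (D.ivol i j) ∧
      ∃ M, ∀ᵐ x ∂D.ivol i j, |D.nuBeta β i x| ≤ M := by
  obtain ⟨h1, M, hM⟩ := hβ.nuBeta (Finset.mem_filter.1 hij).1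
  exact ⟨h1.mono_measure (ivol_le_bvol hj hij), M, ae_mono (ivol_le_bvol hj hij) hM⟩

lemma memLp_value_ivol (hβ : D.IsSmoothTangential β) (hv : v ∈ D.V β) (hj : j ∈ D.comps)
    (hij : i ∈ D.upper j) :
    MemLp (fun x => √|D.nuBeta β i x| * v j x) 2 (D.ivol i j) := by
  obtain ⟨h1, M, hM⟩ := nuBeta_ivol hβ hj hij
  have hs : AEStronglyMeasurable (fun x => √|D.nuBeta β i x|) (D.ivol i j) :=
    (Real.continuous_sqrt.comp continuous_abs).comp_aestronglyMeasurable h1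
  have hvj : MemLp (v j) 2 (D.ivol i j) := (hv j hj).1.mono_measure Measure.restrict_le_self
  refine MemLp.mono' (hvj.norm.const_mul √M) (hs.mul hvj.1) ?_
  filter_upwards [hM] with x hx
  rw [norm_mul, Real.norm_eq_abs (√_), abs_of_nonneg (Real.sqrt_nonneg _)]
  exact mul_le_mul_of_nonneg_right (Real.sqrt_le_sqrt hx) (norm_nonneg _)

lemma memLp_trace_ivol (hv : v ∈ D.V β) (hj : j ∈ D.comps) (hij : i ∈ D.upper j) :
    MemLp (fun x => √|D.nuBeta β i x| * D.trace β v i x) 2 (D.ivol i j) :=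
  (isTrace_trace hv (Finset.mem_filter.1 hij).1).1.mono_measure (ivol_le_bvol hj hij)

lemma memLp_jump_ivol (hβ : D.IsSmoothTangential β) (hv : v ∈ D.V β) (hj : j ∈ D.comps)
    (hij : i ∈ D.upper j) :
    MemLp (fun x => √|D.nuBeta β i x| * D.jump β v i x) 2 (D.ivol i j) := by
  refine ((memLp_trace_ivol hv hj hij).sub (memLp_value_ivol hβ hv hj hij)).ae_eq ?_
  refine D.ae_ivol fun x hx => ?_
  simp only [Pi.sub_apply]
  rw [jump_eq hj hij hx]
  ring

lemma integrable_trace_sq_ivol (hβ : D.IsSmoothTangential β) (hv : v ∈ D.V β) (hj : j ∈ D.comps)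
    (hij : i ∈ D.upper j) :
    Integrable (fun x => D.nuBeta β i x * D.trace β v i x ^ 2) (D.ivol i j) :=
  integrable_weight_mul_sq (nuBeta_ivol hβ hj hij).1 (memLp_trace_ivol hv hj hij)

lemma integrable_jump_sq_ivol (hβ : D.IsSmoothTangential β) (hv : v ∈ D.V β) (hj : j ∈ D.comps)
    (hij : i ∈ D.upper j) :
    Integrable (fun x => D.nuBeta β i x * D.jump β v i x ^ 2) (D.ivol i j) :=
  integrable_weight_mul_sq (nuBeta_ivol hβ hj hij).1 (memLp_jump_ivol hβ hv hj hij)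

lemma integrable_value_sq_ivol (hβ : D.IsSmoothTangential β) (hv : v ∈ D.V β) (hj : j ∈ D.comps)
    (hij : i ∈ D.upper j) :
    Integrable (fun x => D.nuBeta β i x * v j x ^ 2) (D.ivol i j) :=
  integrable_weight_mul_sq (nuBeta_ivol hβ hj hij).1 (memLp_value_ivol hβ hv hj hij)

/-- The mixed product is a combination of the three weighted squares, which are integrable. -/
lemma integrable_jump_mul_ivol (hβ : D.IsSmoothTangential β) (hv : v ∈ D.V β) (hj : j ∈ D.comps)
    (hij : i ∈ D.upper j) :
    Integrable (fun x => D.nuBeta β i x * D.jump β v i x * v j x) (D.ivol i j) := by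
  have h := (((integrable_trace_sq_ivol hβ hv hj hij).sub
    (integrable_jump_sq_ivol hβ hv hj hij)).sub (integrable_value_sq_ivol hβ hv hj hij)).div_const 2
  refine h.congr (D.ae_ivol fun x hx => ?_)
  simp only [Pi.sub_apply]
  rw [jump_eq hj hij hx]
  ring

/-- The trace is the jump plus the value on `j`. Expanding its square gives the mixed term. -/
lemma two_mul_integral_jump_mul (hβ : D.IsSmoothTangential β) (hv : v ∈ D.V β) (hj : j ∈ D.comps)
    (hij : i ∈ D.upper j) :
    2 * ∫ x, D.nuBeta β i x * D.jump β v i x * v j x ∂D.ivol i j =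
      ∫ x, D.nuBeta β i x * D.trace β v i x ^ 2 ∂D.ivol i j -
        ∫ x, D.nuBeta β i x * D.jump β v i x ^ 2 ∂D.ivol i j -
        ∫ x, D.nuBeta β i x * v j x ^ 2 ∂D.ivol i j := by
  have h1 := integrable_trace_sq_ivol hβ hv hj hij
  have h2 := integrable_jump_sq_ivol hβ hv hj hij
  have h3 := integrable_value_sq_ivol hβ hv hj hij
  have h12 : Integrable (fun x => D.nuBeta β i x * D.trace β v i x ^ 2 -
    D.nuBeta β i x * D.jump β v i x ^ 2) (D.ivol i j) := h1.sub h2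
  rw [← integral_sub h1 h2, ← integral_sub h12 h3, ← integral_const_mul]
  refine integral_congr_ae (D.ae_ivol fun x hx => ?_)
  simp only
  rw [jump_eq hj hij hx]
  ring

end Interface

section Component

variable {j : Fin D.N}

lemma integrable_surfDiv_mul_sq (hβ : D.IsSmoothTangential β) (hv : v ∈ D.V β) (hj : j ∈ D.comps) :
    Integrable (fun x => v j x ^ 2 * surfDiv (D.S j) (β j) x) (D.vol j) := by
  obtain ⟨h1, M, hM⟩ := hβ.surfDiv hj
  exact (hv j hj).1.integrable_sq.mul_bdd (c := M) h1 hM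

lemma integrable_mul_betaGrad (hv : v ∈ D.V β) (hj : j ∈ D.comps) :
    Integrable (fun x => v j x * D.betaGrad β v j x) (D.vol j) :=
  (hv j hj).1.integrable_mul (memLp_betaGrad hv hj)

lemma integrable_coefficient_mul_sq (hα : D.IsBounded α) (hv : v ∈ D.V β) (hj : j ∈ D.comps) :
    Integrable (fun x => α j x * v j x ^ 2) (D.vol j) :=
  (hv j hj).1.integrable_sq.smul_of_top_right (hα j hj)

lemma integrable_sumJump_mul_sq (hβ : D.IsSmoothTangential β) (hv : v ∈ D.V β) (hj : j ∈ D.comps) :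
    Integrable (fun x => D.sumJump (D.nuBeta β) j x * v j x ^ 2) (D.vol j) :=
  D.integrable_sumJump_mul (h := fun x => v j x ^ 2) fun _ hi => integrable_value_sq_ivol hβ hv hj hi

lemma integral_dirDeriv_mul (hβ : D.IsSmoothTangential β) (hv : v ∈ D.V β) (hj : j ∈ D.comps) :
    ∫ x, D.dirDeriv β v j x * v j x ∂D.vol j = ∫ x, v j x * D.betaGrad β v j x ∂D.vol j -
      ∑ i ∈ D.upper j, ∫ x, D.nuBeta β i x * D.jump β v i x * v j x ∂D.ivol i j := by
  have h := fun i hi => integrable_jump_mul_ivol (i := i) hβ hv hj hi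
  rw [← D.integral_sumJump_mul (f := fun i y => D.nuBeta β i y * D.jump β v i y) h,
    ← integral_sub (integrable_mul_betaGrad hv hj) (D.integrable_sumJump_mul h)]
  refine integral_congr_ae (Eventually.of_forall fun x => ?_)
  simp only [dirDeriv]
  ring

lemma integrable_Div_mul_sq (hα : D.IsBounded α) (hβ : D.IsSmoothTangential β) (hv : v ∈ D.V β)
    (hj : j ∈ D.comps) :
    Integrable (fun x => (2 * α j x + D.Div β j x) * v j x ^ 2) (D.vol j) := by
  refine ((((integrable_coefficient_mul_sq hα hv hj).const_mul 2).add
    (integrable_surfDiv_mul_sq hβ hv hj)).sub (integrable_sumJump_mul_sq hβ hv hj)).congr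
    (Eventually.of_forall fun x => ?_)
  simp only [Div, Pi.add_apply, Pi.sub_apply]
  ring

/-- One of the two copies of `Div β` stays with `2 α`. The other is split: its tangential divergence
completes the energy identity, and its jump part will cancel the squares of the values on
interfaces. -/
lemma two_mul_integral_zeroth_order (hα : D.IsBounded α) (hβ : D.IsSmoothTangential β)
    (hv : v ∈ D.V β) (hj : j ∈ D.comps) :
    2 * ∫ x, (α j x + D.Div β j x) * v j x * v j x ∂D.vol j =
      ∫ x, (2 * α j x + D.Div β j x) * v j x ^ 2 ∂D.vol j +
        ∫ x, v j x ^ 2 * surfDiv (D.S j) (β j) x ∂D.vol j -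
        ∑ i ∈ D.upper j, ∫ x, D.nuBeta β i x * v j x ^ 2 ∂D.ivol i j := by
  have h1 := integrable_Div_mul_sq hα hβ hv hj
  have h2 := integrable_surfDiv_mul_sq hβ hv hj
  have h12 : Integrable (fun x => (2 * α j x + D.Div β j x) * v j x ^ 2 +
    v j x ^ 2 * surfDiv (D.S j) (β j) x) (D.vol j) := h1.add h2
  rw [← D.integral_sumJump_mul (h := fun x => v j x ^ 2)
      fun i hi => integrable_value_sq_ivol hβ hv hj hi, ← integral_add h1 h2,
    ← integral_sub h12 (integrable_sumJump_mul_sq hβ hv hj), ← integral_const_mul]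
  refine integral_congr_ae (Eventually.of_forall fun x => ?_)
  simp only [Div]
  ring

end Component

/-- Twice the quadratic form, after integration by parts. -/
theorem two_mul_a (hα : D.IsBounded α) (hβ : D.IsSmoothTangential β) (hv : v ∈ D.V β) :
    2 * D.a β α v v =
      ∑ j ∈ D.comps, ∫ x, (2 * α j x + D.Div β j x) * v j x ^ 2 ∂D.vol j +
        ∑ j ∈ D.comps, ∑ i ∈ D.upper j, (∫ x, D.nuBeta β i x * D.jump β v i x ^ 2 ∂D.ivol i j +
          2 * ∫ x, D.inflow β i x * D.jump β v i x ^ 2 ∂D.ivol i j) +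
        ∑ i ∈ D.comps, (∫ x in frontier D.Ω, D.nuBeta β i x * D.trace β v i x ^ 2 ∂D.bvol i +
          2 * ∫ x in frontier D.Ω, D.inflow β i x * D.trace β v i x ^ 2 ∂D.bvol i) := by
  have hI : D.ipI (fun i x => D.inflow β i x * D.jump β v i x) (D.jump β v) =
      ∑ j ∈ D.comps, ∑ i ∈ D.upper j,
        ∫ x, D.inflow β i x * D.jump β v i x ^ 2 ∂D.ivol i j := by
    rw [← D.sum_integral_compl_frontier (f := fun i x => D.inflow β i x * D.jump β v i x ^ 2)]
    · simp only [ipI, mul_assoc, sq]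
    · exact fun j hj i hi => integrable_absNeg_mul_sq (integrable_jump_sq_ivol hβ hv hj hi)
  have hB : D.ipB (fun i x => D.inflow β i x * D.trace β v i x) (D.trace β v) =
      ∑ i ∈ D.comps, ∫ x in frontier D.Ω, D.inflow β i x * D.trace β v i x ^ 2 ∂D.bvol i := by
    simp only [ipB, mul_assoc, sq]
  -- The boundary terms of the energy identities, with the interior part sorted by the component on
  -- which it lies.
  have hbd : ∑ i ∈ D.comps, ∫ x, D.nuBeta β i x * D.trace β v i x ^ 2 ∂D.bvol i =
      ∑ j ∈ D.comps, ∑ i ∈ D.upper j, ∫ x, D.nuBeta β i x * D.trace β v i x ^ 2 ∂D.ivol i j +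
      ∑ i ∈ D.comps, ∫ x in frontier D.Ω, D.nuBeta β i x * D.trace β v i x ^ 2 ∂D.bvol i := by
    rw [← D.sum_integral_compl_frontier (f := fun i x => D.nuBeta β i x * D.trace β v i x ^ 2)
      fun j hj i hi => integrable_trace_sq_ivol hβ hv hj hi, ← Finset.sum_add_distrib]
    refine Finset.sum_congr rfl fun i hi => ?_
    rw [add_comm, integral_add_compl isClosed_frontier.measurableSet]
    exact integrable_weight_mul_sq (hβ.nuBeta hi).1 (isTrace_trace hv hi).1
  have hen : ∀ j ∈ D.comps, 2 * ∫ x, v j x * D.betaGrad β v j x ∂D.vol j +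
      ∫ x, v j x ^ 2 * surfDiv (D.S j) (β j) x ∂D.vol j =
      ∫ x, D.nuBeta β j x * D.trace β v j x ^ 2 ∂D.bvol j := by
    intro j hj
    rw [← energy_identity_comp hβ hv hj, ← integral_const_mul, ← integral_add
      ((integrable_mul_betaGrad hv hj).const_mul 2) (integrable_surfDiv_mul_sq hβ hv hj)]
    simp only [mul_assoc]
  -- The squares of the values on the interface have cancelled here. The squares of the traces
  -- cancel only after summation over all components, by `hbd`.
  have hcomp : ∀ j ∈ D.comps, 2 * ∫ x, D.dirDeriv β v j x * v j x ∂D.vol j +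
      2 * ∫ x, (α j x + D.Div β j x) * v j x * v j x ∂D.vol j =
      ∫ x, (2 * α j x + D.Div β j x) * v j x ^ 2 ∂D.vol j +
      ∫ x, D.nuBeta β j x * D.trace β v j x ^ 2 ∂D.bvol j +
      ∑ i ∈ D.upper j, (∫ x, D.nuBeta β i x * D.jump β v i x ^ 2 ∂D.ivol i j -
        ∫ x, D.nuBeta β i x * D.trace β v i x ^ 2 ∂D.ivol i j) := by
    intro j hj
    rw [integral_dirDeriv_mul hβ hv hj, two_mul_integral_zeroth_order hα hβ hv hj, ← hen j hj,
      mul_sub, Finset.mul_sum,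
      Finset.sum_congr rfl fun i hi => two_mul_integral_jump_mul hβ hv hj hi]
    simp only [Finset.sum_sub_distrib]
    ring
  have hsum := Finset.sum_congr rfl hcomp
  simp only [Finset.sum_add_distrib, Finset.sum_sub_distrib, ← Finset.mul_sum] at hsum ⊢
  rw [hbd] at hsum
  rw [a, hI, hB, ip, ip]
  linarith

/-- Coercivity of the quadratic form. -/
theorem coercivity {c₀ : ℝ} (hα : D.IsBounded α) (hβ : D.IsSmoothTangential β)
    (hc : ∀ i ∈ D.comps, ∀ᵐ x ∂D.vol i, c₀ ≤ 2 * α i x + D.Div β i x) (hv : v ∈ D.V β) :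
    c₀ * D.normSq v + D.normSqI β (D.jump β v) + D.normSqB β (D.trace β v) ≤
      2 * D.a β α v v := by
  have hw : ∀ (i : Fin D.N) (f : E n → ℝ) x, √(D.inflow β i x) * f x * (√(D.inflow β i x) * f x) =
      D.inflow β i x * f x ^ 2 := fun i f x => by
    rw [mul_mul_mul_comm, Real.mul_self_sqrt (show 0 ≤ D.inflow β i x from absNeg_nonneg _), sq]
  have hI : D.normSqI β (D.jump β v) = ∑ j ∈ D.comps, ∑ i ∈ D.upper j,
      ∫ x, D.inflow β i x * D.jump β v i x ^ 2 ∂D.ivol i j := by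
    rw [← D.sum_integral_compl_frontier (f := fun i x => D.inflow β i x * D.jump β v i x ^ 2)]
    · simp only [normSqI, ipI, hw]
    · exact fun j hj i hi => integrable_absNeg_mul_sq (integrable_jump_sq_ivol hβ hv hj hi)
  rw [two_mul_a hα hβ hv, hI]
  refine add_le_add (add_le_add ?_ ?_) ?_
  · rw [normSq, ip, Finset.mul_sum]
    refine Finset.sum_le_sum fun j hj => ?_
    rw [← integral_const_mul]
    refine integral_mono_ae ?_ (integrable_Div_mul_sq hα hβ hv hj) ?_
    · simp only [← sq]
      exact (hv j hj).1.integrable_sq.const_mul c₀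
    · filter_upwards [hc j hj] with x hx
      rw [← sq]
      exact mul_le_mul_of_nonneg_right hx (sq_nonneg _)
  · exact Finset.sum_le_sum fun j hj => Finset.sum_le_sum fun i hi =>
      integral_absNeg_mul_sq_le (integrable_jump_sq_ivol hβ hv hj hi)
  · simp only [normSqB, ipB, hw]
    refine Finset.sum_le_sum fun i hi => integral_absNeg_mul_sq_le ?_
    exact (integrable_weight_mul_sq (hβ.nuBeta hi).1 (isTrace_trace hv hi).1).integrableOn

lemma ipI_self_nonneg (w : D.Fun) : 0 ≤ D.ipI w w :=
  Finset.sum_nonneg fun _ _ => integral_nonneg fun _ => mul_self_nonneg _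

lemma ipB_self_nonneg (w : D.Fun) : 0 ≤ D.ipB w w :=
  Finset.sum_nonneg fun _ _ => integral_nonneg fun _ => mul_self_nonneg _

lemma normSq_nonneg (w : D.Fun) : 0 ≤ D.normSq w := by
  unfold normSq ip
  exact Finset.sum_nonneg fun _ _ => integral_nonneg fun _ => mul_self_nonneg _

end FracturedDomain

end Fractured

end

/-! ### The lemma with an explicit constant. -/

theorem mainTheorem3 (c₀ : ℝ) (hc₀ : 0 < c₀) :
    ∃ C : ℝ, 0 < C ∧ ∀ (n : ℕ) (D : Fractured.FracturedDomain n)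
      (β : Fin D.N → Fractured.E n → Fractured.E n) (α : D.Fun),
      D.IsSmoothTangential β → D.IsBounded α →
      (∀ i ∈ D.comps, ∀ᵐ x ∂D.vol i, c₀ ≤ 2 * α i x + D.Div β i x) →
      ∀ v ∈ D.V β,
        D.normSq v + D.normSqI β (D.jump β v) + D.normSqB β (D.trace β v) ≤ C * D.a β α v v := by
  -- The factor `2` comes from the bound on `2 a(v, v)`, the part `1 / c₀` recovers the norm of `v`,
  -- and the part `1` recovers the two boundary norms.
  refine ⟨2 * (1 / c₀ + 1), by positivity, fun n D β α hβ hα hc v hv => ?_⟩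
  have h := D.coercivity hα hβ hc hv
  have h1 := D.normSq_nonneg v
  have h2 : 0 ≤ D.normSqI β (D.jump β v) := D.ipI_self_nonneg _
  have h3 : 0 ≤ D.normSqB β (D.trace β v) := D.ipB_self_nonneg _
  have h4 : 0 < 1 / c₀ := by positivity
  have h5 : 1 / c₀ * (c₀ * D.normSq v) = D.normSq v := by field_simp
  have h6 := mul_le_mul_of_nonneg_left h (show 0 ≤ 1 / c₀ + 1 by positivity)
  nlinarith [mul_nonneg h4.le h2, mul_nonneg h4.le h3, mul_nonneg hc₀.le h1]
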